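/- **Corollary 1.4.** *Model.* For $L\in\mathbb N$ let $\Lambda=[-L,L]\cap\mathbb Z$ and let $\mathcal X_\Lambda^n=\{\mathbf x=(x_1,\dots,x_n)\in\Lambda^n: x_1<\dots<x_n\}$, whose elements are also regarded as $n$-element subsets of $\Lambda$. A cluster of $\mathbf x$ is a non-empty set of consecutive sites of $\mathbf x$ which is not neighbouring any other site of $\mathbf x$; let $k(\mathbf x)$ be the number of clusters of $\mathbf x$. On $\ell^2(\mathcal X_\Lambda^n)$ with orthonormal basis $(\delta_{\mathbf x})$ define, for $g>1$ and $\lambda\ge 0$, $$H_\Lambda=-A+2g\,U+\lambda V,\qquad A\delta_{\mathbf x}=\sum_{\mathbf y:\ \sum_j|x_j-y_j|=1}\delta_{\mathbf y},\quad U\delta_{\mathbf x}=k(\mathbf x)\,\delta_{\mathbf x},\quad V\delta_{\mathbf x}=\Big(\sum_{j=1}^n\omega(x_j)\Big)\delta_{\mathbf x},$$ where $(\omega(\alpha))_{\alpha\in\Lambda}$ are i.i.d. real random variables with a bounded probability density $\varrho\in L^\infty(\mathbb R)$ supported in $[0,\omega_{\max}]$. For an interval $I\subset\mathbb R$ and $U,V\subset\Lambda$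 put $$q_\Lambda^{(n)}(U,V,I)=\sum_{E\in\sigma(H_\Lambda)\cap I}\ \sum_{\mathbf x\in\mathcal X_\Lambda^n:\ \mathbf x\cap U\ne\emptyset}\ \sum_{\mathbf y\in\mathcal X_\Lambda^n:\ \mathbf y\cap V\neq\emptyset}\big|\langle\delta_{\mathbf x},P_{\{E\}}(H_\Lambda)\delta_{\mathbf y}\rangle\big|,$$ where $P_{\{E\}}(H_\Lambda)$ is the orthogonal projection onto $\ker(H_\Lambda-E)$. *Statement.* Let $g>1$ and $\mu_T>0$ be such that $E(g,\mu_T):=4g-12e^{\mu_T}>0$, let $I\subset[0,E(g,\mu_T))$ be a compact interval, and let $\varrho$ be as above. Then there exist constants $\lambda_0,C,c,\mu\in(0,\infty)$ such that for all $\lambda>\lambda_0$, all $n\ge 2$, all $L\in\mathbb N$ with $\Lambda=[-L,L]\cap\mathbb Z$, and all non-empty, connected (that is, consisting of consecutive sites) and disjoint $U,V\subset\Lambda$, $$\mathbb E\big[q_\Lambda^{(n)}(U,V,I)\big]\le C\,e^{-cn}\,e^{-\mu\,\mathrm{dist}(U,V)},\qquad \mathrm{dist}(U,V)=\min\{|u-v|:u\in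 U,\ v\in V\}.$$ -/

import Mathlib

open MeasureTheory ProbabilityTheory

noncomputable section

namespace HardCore

/-- The finite chain `[-L, L] ∩ ℤ`. -/
def box (L : ℕ) : Finset ℤ := Finset.Icc (-(L : ℤ)) (L : ℤ)

/-- A nonempty set of sites is connected (for the nearest-neighbour structure of `ℤ`) iff it is
an interval of `ℤ`. -/
def IsConnectedSites (s : Finset ℤ) : Prop := s.Nonempty ∧ (s : Set ℤ).OrdConnected

/-- `dist(U, V) = min {|u - v| : u ∈ U, v ∈ V}`; the minimum is attained for nonempty `U`, `V`. -/
def siteDist (U V : Finset ℤ) : ℕ := sInf {r : ℕ | ∃ u ∈ U, ∃ v ∈ V, r = (u - v).natAbs}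

/-- Configurations of `n` hard-core particles on `Λ`: tuples `x₁ < x₂ < … < xₙ` in `Λ`. -/
def Config (Λ : Finset ℤ) (n : ℕ) : Type := {x : Fin n → Λ // StrictMono x}

variable {Λ : Finset ℤ} {n : ℕ}

instance : Finite (Config Λ n) := inferInstanceAs (Finite {x : Fin n → Λ // StrictMono x})

instance : Fintype (Config Λ n) := Fintype.ofFinite _

instance : DecidableEq (Config Λ n) := Classical.decEq _

/-- The `j`-th particle position, as a site of `Λ`. -/
def Config.pos (x : Config Λ n) (j : Fin n) : Λ := x.1 j

/-- The set of occupied sites. -/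
def Config.sites (x : Config Λ n) : Finset ℤ := Finset.univ.image fun j => (x.pos j : ℤ)

/-- The `ℓ¹`-distance of two configurations. -/
def Config.l1Dist (x y : Config Λ n) : ℤ := ∑ j, |(x.pos j : ℤ) - (y.pos j : ℤ)|

/-- `c` is a cluster of the set `s` of occupied sites: a connected subset of `s` which is not
neighbouring any other site of `s`. -/
def IsCluster (s c : Finset ℤ) : Prop :=
  c ⊆ s ∧ IsConnectedSites c ∧ ∀ u ∈ s \ c, ∀ v ∈ c, |u - v| ≠ 1

open Classical in
/-- The number of clusters of a configuration. -/
def Config.clusterCount (x : Config Λ n) : ℕ := (x.sites.powerset.filter (IsCluster x.sites)).card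

/-- The hopping term: the adjacency matrix of the configuration space. -/
def adjacency (Λ : Finset ℤ) (n : ℕ) : Matrix (Config Λ n) (Config Λ n) ℂ :=
  Matrix.of fun x y => if x.l1Dist y = 1 then 1 else 0

/-- The attractive interaction: multiplication by the number of clusters. -/
def interaction (Λ : Finset ℤ) (n : ℕ) : Matrix (Config Λ n) (Config Λ n) ℂ :=
  Matrix.diagonal fun x => (x.clusterCount : ℂ)

/-- The potential `(∑ⱼ ω(xⱼ))` as a multiplication operator. -/
def potential (n : ℕ) (ω : Λ → ℝ) : Matrix (Config Λ n) (Config Λ n) ℂ :=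
  Matrix.diagonal fun x => ((∑ j, ω (x.pos j) : ℝ) : ℂ)

/-- The Hamiltonian `H = -A + 2 g U + lam V` on `ℓ²(Config Λ n)`, in the basis `δ_x`. -/
def hamiltonian (n : ℕ) (g lam : ℝ) (ω : Λ → ℝ) : Matrix (Config Λ n) (Config Λ n) ℂ :=
  -adjacency Λ n + ((2 * g : ℝ) : ℂ) • interaction Λ n + (lam : ℂ) • potential n ω

/-- The orthogonal projection `P_{E}(H)` onto the eigenspace `ker (H - E)`. -/
def eigenprojection {X : Type} [Fintype X] [DecidableEq X] (H : Matrix X X ℂ) (E : ℝ) :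
    EuclideanSpace ℂ X →L[ℂ] EuclideanSpace ℂ X :=
  (Module.End.eigenspace (Matrix.toEuclideanLin H) (E : ℂ)).starProjection

/-- The finite set `σ(H) ∩ I`. -/
def spectrumIn {X : Type} [Fintype X] [DecidableEq X] (H : Matrix X X ℂ) (I : Set ℝ) :
    Finset ℝ :=
  ((Matrix.finite_real_spectrum (A := H)).inter_of_left I).toFinset

/-- The matrix element `⟨δ_x, P_{E}(H) δ_y⟩`. -/
def eigenprojectionEntry {X : Type} [Fintype X] [DecidableEq X] (H : Matrix X X ℂ) (E : ℝ)
    (x y : X) : ℂ :=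
  inner ℂ (EuclideanSpace.single x (1 : ℂ)) (eigenprojection H E (EuclideanSpace.single y (1 : ℂ)))

open Classical in
/-- The summed correlator `q(U, V, I)`: the sum over `E ∈ σ(H) ∩ I`, over all configurations `x`
with a particle in `U` and over all configurations `y` with a particle in `V`, of
`|⟨δ_x, P_{E}(H) δ_y⟩|`. -/
def summedCorrelator (n : ℕ) (g lam : ℝ) (ω : Λ → ℝ) (U V : Finset ℤ) (I : Set ℝ) : ℝ :=
  ∑ E ∈ spectrumIn (hamiltonian n g lam ω) I,
    ∑ x : Config Λ n with (x.sites ∩ U).Nonempty,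
      ∑ y : Config Λ n with (y.sites ∩ V).Nonempty,
        ‖eigenprojectionEntry (hamiltonian n g lam ω) E x y‖

/-- The energy threshold `E(g, μT) = 4 g - 12 exp μT`. -/
def energyThreshold (g μT : ℝ) : ℝ := 4 * g - 12 * Real.exp μT

/-- `ρ` is a bounded probability density on `ℝ` supported in `[0, ωmax]`. -/
structure IsAdmissibleDensity (ρ : ℝ → ℝ) (ωmax : ℝ) : Prop where
  bounded : MemLp ρ ⊤ volume
  nonneg : ∀ᵐ v, 0 ≤ ρ v
  support : ∀ᵐ v, v ∉ Set.Icc 0 ωmax → ρ v = 0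
  total : ∫ v, ρ v = 1

/-- `ω` is a family of iid real random variables with density `ρ`. -/
structure IsDisorder {Ω : Type*} [MeasurableSpace Ω] (ρ : ℝ → ℝ) (P : Measure Ω)
    (ω : Λ → Ω → ℝ) : Prop where
  measurable : ∀ α, Measurable (ω α)
  indep : iIndepFun ω P
  law : ∀ α, P.map (ω α) = volume.withDensity fun v => ENNReal.ofReal (ρ v)

end HardCore

end

/-! The proof is a fractional-moment argument for droplets. A configuration forming one contiguous
block has interaction energy `2g`, any other at least `4g`. Below the threshold `4g - 12 exp μT`,
the eigenvalue equation at a non-contiguous configuration, or at a block with potential energy at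
least `b / 2`, is therefore dominated by its diagonal (`local_bound`). Both the interaction energy
and the number of hops are governed by the number of cluster ends, so an `ℓ¹` Combes–Thomas estimate
holds uniformly in the particle number (`weighted_sum_le`). Eigenfunctions are thus concentrated
near "bad" blocks, those of small potential, and `summedCorrelator_le` reduces everything to
eigenfunction correlators between bad blocks.

Decay between blocks comes from cutting the system at a site `β`, keeping only configurations to the
right of it. For blocks `s`, `t` with `α = s.left < t.left`, the resolvent column at `t` of the
system cut at `α` solves the equation of the larger system up to a source on configurations whose
leftmost particle is at `α` (`cutHamiltonian_mulVec_cutColumn`). This source is independent of `ω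
α`, whereas `ω α` multiplies a coordinate projection whose range contains both `s` and the source.
Averaging over `ω α` costs a factor of order `lam ^ (-1/2)` for square roots of resolvent entries.
The source is in turn bounded by block entries of the smaller system, and for large `lam` the
recursion closes (`lintegral_sqrt_resolv_le`). The averaging bounds follow from analyticity of the
resolvent in the coupling on the lower half-plane (`lintegral_re_le`).

The source also represents eigenprojections: `P_E(t, y) = ∑ u, source u * P_E(u, y)`. An
interpolation inequality turns this into a bound linear in spectral weights, with only the square
root of the source as a factor. Spectral averaging at `ω α` then replaces the spectral measures by
Lebesgue measure in `E`, where the fractional moments apply (`lintegral_correlator_le`).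

The factor exponential in `n` comes from rarity: in a bad block every site has disorder below `b /
(2 lam)`, so its probability is at most a small number to the power `n` (`measure_bad_le`). The
geometric mean of this bound and the decay in distance is then summed over pairs of blocks. -/

noncomputable section

namespace HardCore

/-! ### Cluster ends, hops and contiguous configurations -/

section Combinatorics

variable {Λ : Finset ℤ} {m : ℕ}

/-- The position of the leftmost particle. -/
def Config.left (x : Config Λ (m + 1)) : ℤ := x.pos 0

/-- The position of the rightmost particle. -/
def Config.right (x : Config Λ (m + 1)) : ℤ := x.pos (Fin.last m)

/-- The particles occupy consecutive sites. -/
def Config.Contiguous (x : Config Λ (m + 1)) : Prop :=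
  ∀ j : Fin (m + 1), (x.pos j : ℤ) = x.left + j

lemma Config.pos_strictMono {n : ℕ} (x : Config Λ n) {i j : Fin n} (h : i < j) :
    (x.pos i : ℤ) < x.pos j := x.2 h

lemma Config.pos_injective {n : ℕ} (x : Config Λ n) {i j : Fin n}
    (h : (x.pos i : ℤ) = x.pos j) : i = j :=
  x.2.injective (Subtype.ext h)

lemma Config.ext_pos {n : ℕ} {x y : Config Λ n} (h : ∀ j, (x.pos j : ℤ) = y.pos j) : x = y :=
  Subtype.ext (funext fun j => Subtype.ext (h j))

lemma Config.mem_sites {n : ℕ} (x : Config Λ n) (u : ℤ) :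
    u ∈ x.sites ↔ ∃ j, (x.pos j : ℤ) = u := by
  simp [Config.sites]

lemma Config.left_le_pos (x : Config Λ (m + 1)) (j : Fin (m + 1)) : x.left ≤ x.pos j := by
  rcases eq_or_ne j 0 with rfl | h
  · exact le_rfl
  · exact (x.pos_strictMono (Fin.pos_iff_ne_zero.2 h)).le

lemma Config.pos_le_right (x : Config Λ (m + 1)) (j : Fin (m + 1)) : (x.pos j : ℤ) ≤ x.right := by
  rcases eq_or_ne j (Fin.last m) with rfl | h
  · exact le_rfl
  · exact (x.pos_strictMono (Fin.lt_last_iff_ne_last.2 h)).le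

lemma Config.Contiguous.ext {x y : Config Λ (m + 1)} (hx : x.Contiguous) (hy : y.Contiguous)
    (h : x.left = y.left) : x = y :=
  Config.ext_pos fun j => by rw [hx j, hy j, h]

lemma Config.Contiguous.right_eq {x : Config Λ (m + 1)} (hx : x.Contiguous) :
    x.right = x.left + m := by
  simpa [Config.right] using hx (Fin.last m)

lemma Config.l1Dist_comm {n : ℕ} (x y : Config Λ n) : x.l1Dist y = y.l1Dist x := by
  simp [Config.l1Dist, abs_sub_comm]

lemma Config.l1Dist_self {n : ℕ} (x : Config Λ n) : x.l1Dist x = 0 := by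
  simp [Config.l1Dist]

lemma Config.abs_pos_sub_le {n : ℕ} {x y : Config Λ n} (h : x.l1Dist y = 1) (j : Fin n) :
    |(x.pos j : ℤ) - y.pos j| ≤ 1 := by
  rw [← h]
  exact Finset.single_le_sum (f := fun j => |(x.pos j : ℤ) - y.pos j|)
    (fun i _ => abs_nonneg _) (Finset.mem_univ j)

/-- Neighbouring configurations differ by moving one particle by one site. -/
lemma Config.exists_move {n : ℕ} {x y : Config Λ n} (h : x.l1Dist y = 1) :
    ∃ j, ((y.pos j : ℤ) = x.pos j + 1 ∨ (y.pos j : ℤ) = x.pos j - 1) ∧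
      ∀ i, i ≠ j → (y.pos i : ℤ) = x.pos i := by
  classical
  have hex : ∃ j, (x.pos j : ℤ) - y.pos j ≠ 0 := by
    by_contra! hcon
    have : x.l1Dist y = 0 := by simp [Config.l1Dist, hcon]
    omega
  obtain ⟨j, hj⟩ := hex
  have hsum := Finset.add_sum_erase Finset.univ (fun j => |(x.pos j : ℤ) - y.pos j|)
    (Finset.mem_univ j)
  have hnn : ∀ i ∈ Finset.univ.erase j, 0 ≤ |(x.pos i : ℤ) - y.pos i| := fun i _ => abs_nonneg _
  have hnn' := Finset.sum_nonneg hnn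
  have h1 : 1 ≤ |(x.pos j : ℤ) - y.pos j| := Int.one_le_abs hj
  have hh : |(x.pos j : ℤ) - y.pos j| +
      ∑ i ∈ Finset.univ.erase j, |(x.pos i : ℤ) - y.pos i| = 1 := hsum.trans h
  have hz : ∑ i ∈ Finset.univ.erase j, |(x.pos i : ℤ) - y.pos i| = 0 := by omega
  refine ⟨j, ?_, fun i hi => ?_⟩
  · have : |(x.pos j : ℤ) - y.pos j| = 1 := by omega
    rcases abs_eq (by norm_num : (0 : ℤ) ≤ 1) |>.1 this with h2 | h2
    · right; omega
    · left; omega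
  · have := (Finset.sum_eq_zero_iff_of_nonneg hnn).1 hz i (by simp [hi])
    have := abs_eq_zero.1 this
    omega

/-- Indices of particles whose right neighbouring site is empty. -/
def Config.rightEnds {n : ℕ} (x : Config Λ n) : Finset (Fin n) :=
  Finset.univ.filter fun j => ∀ i, (x.pos i : ℤ) ≠ x.pos j + 1

/-- Indices of particles whose left neighbouring site is empty. -/
def Config.leftEnds {n : ℕ} (x : Config Λ n) : Finset (Fin n) :=
  Finset.univ.filter fun j => ∀ i, (x.pos i : ℤ) ≠ x.pos j - 1

/-- The number of cluster ends divided by two. -/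
def Config.halfEnds {n : ℕ} (x : Config Λ n) : ℝ :=
  ((x.rightEnds.card : ℝ) + x.leftEnds.card) / 2

/-- A right end is sent to the maximal run of occupied sites terminating there. The empty site to
its right makes the run a cluster, and the end is recovered as the maximum of the run, so the map is
injective. -/
lemma Config.card_rightEnds_le {n : ℕ} (x : Config Λ n) :
    x.rightEnds.card ≤ x.clusterCount := by
  classical
  let c : Fin n → Finset ℤ := fun j =>
    x.sites.filter fun u => u ≤ x.pos j ∧ Finset.Icc u (x.pos j : ℤ) ⊆ x.sites
  have hself : ∀ j, (x.pos j : ℤ) ∈ c j := fun j => by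
    have : (x.pos j : ℤ) ∈ x.sites := (x.mem_sites _).2 ⟨j, rfl⟩
    simp [c, this]
  refine Finset.card_le_card_of_injOn c (fun j hj => ?_) (fun i _ j _ hij => ?_)
  · have hj' : ∀ i, (x.pos i : ℤ) ≠ x.pos j + 1 := by
      simpa [Config.rightEnds] using hj
    simp only [Finset.coe_filter, Finset.mem_powerset, Set.mem_ofPred_eq]
    refine ⟨Finset.filter_subset _ _, Finset.filter_subset _ _, ⟨⟨_, hself j⟩, ⟨?_⟩⟩, ?_⟩
    · intro a ha b hb t ht
      simp only [c, Finset.coe_filter, Set.mem_ofPred_eq] at ha hb ⊢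
      have htb : t ≤ x.pos j := ht.2.trans hb.2.1
      exact ⟨ha.2.2 (Finset.mem_Icc.2 ⟨ht.1, htb⟩), htb,
        (Finset.Icc_subset_Icc_left ht.1).trans ha.2.2⟩
    · intro u hu v hv huv
      simp only [Finset.mem_sdiff, c, Finset.mem_filter] at hu hv
      apply hu.2
      refine ⟨hu.1, ?_⟩
      rcases (abs_eq (by norm_num : (0 : ℤ) ≤ 1)).1 huv with h | h
      · have hne : u ≠ x.pos j + 1 := by
          rintro rfl
          obtain ⟨i, hi⟩ := (x.mem_sites _).1 hu.1
          exact hj' i hi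
        have hle : u ≤ x.pos j := by have := hv.2.1; omega
        exact ⟨hle, (Finset.Icc_subset_Icc_left (by omega)).trans hv.2.2⟩
      · refine ⟨by have := hv.2.1; omega, fun t ht => ?_⟩
        rw [Finset.mem_Icc] at ht
        rcases eq_or_lt_of_le ht.1 with rfl | h'
        · exact hu.1
        · exact hv.2.2 (Finset.mem_Icc.2 ⟨by omega, ht.2⟩)
  · have h1 : (x.pos i : ℤ) ∈ c j := hij ▸ hself i
    have h2 : (x.pos j : ℤ) ∈ c i := hij ▸ hself j
    simp only [c, Finset.mem_filter] at h1 h2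
    exact x.pos_injective (le_antisymm h1.2.1 h2.2.1)

lemma Config.card_leftEnds_le {n : ℕ} (x : Config Λ n) :
    x.leftEnds.card ≤ x.clusterCount := by
  classical
  let c : Fin n → Finset ℤ := fun j =>
    x.sites.filter fun u => (x.pos j : ℤ) ≤ u ∧ Finset.Icc (x.pos j : ℤ) u ⊆ x.sites
  have hself : ∀ j, (x.pos j : ℤ) ∈ c j := fun j => by
    have : (x.pos j : ℤ) ∈ x.sites := (x.mem_sites _).2 ⟨j, rfl⟩
    simp [c, this]
  refine Finset.card_le_card_of_injOn c (fun j hj => ?_) (fun i _ j _ hij => ?_)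
  · have hj' : ∀ i, (x.pos i : ℤ) ≠ x.pos j - 1 := by
      simpa [Config.leftEnds] using hj
    simp only [Finset.coe_filter, Finset.mem_powerset, Set.mem_ofPred_eq]
    refine ⟨Finset.filter_subset _ _, Finset.filter_subset _ _, ⟨⟨_, hself j⟩, ⟨?_⟩⟩, ?_⟩
    · intro a ha b hb t ht
      simp only [c, Finset.coe_filter, Set.mem_ofPred_eq] at ha hb ⊢
      have htb : (x.pos j : ℤ) ≤ t := ha.2.1.trans ht.1
      exact ⟨hb.2.2 (Finset.mem_Icc.2 ⟨htb, ht.2⟩), htb,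
        (Finset.Icc_subset_Icc_right ht.2).trans hb.2.2⟩
    · intro u hu v hv huv
      simp only [Finset.mem_sdiff, c, Finset.mem_filter] at hu hv
      apply hu.2
      refine ⟨hu.1, ?_⟩
      rcases (abs_eq (by norm_num : (0 : ℤ) ≤ 1)).1 huv with h | h
      · refine ⟨by have := hv.2.1; omega, fun t ht => ?_⟩
        rw [Finset.mem_Icc] at ht
        rcases eq_or_lt_of_le ht.2 with rfl | h'
        · exact hu.1
        · exact hv.2.2 (Finset.mem_Icc.2 ⟨ht.1, by omega⟩)
      · have hne : u ≠ x.pos j - 1 := by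
          rintro rfl
          obtain ⟨i, hi⟩ := (x.mem_sites _).1 hu.1
          exact hj' i hi
        have hle : (x.pos j : ℤ) ≤ u := by have := hv.2.1; omega
        exact ⟨hle, (Finset.Icc_subset_Icc_right (by omega)).trans hv.2.2⟩
  · have h1 : (x.pos i : ℤ) ∈ c j := hij ▸ hself i
    have h2 : (x.pos j : ℤ) ∈ c i := hij ▸ hself j
    simp only [c, Finset.mem_filter] at h1 h2
    exact x.pos_injective (le_antisymm h2.2.1 h1.2.1)

lemma Config.halfEnds_le_clusterCount {n : ℕ} (x : Config Λ n) :
    x.halfEnds ≤ x.clusterCount := by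
  have h1 : (x.rightEnds.card : ℝ) ≤ x.clusterCount := by exact_mod_cast x.card_rightEnds_le
  have h2 : (x.leftEnds.card : ℝ) ≤ x.clusterCount := by exact_mod_cast x.card_leftEnds_le
  unfold Config.halfEnds
  linarith

lemma Config.last_mem_rightEnds (x : Config Λ (m + 1)) : Fin.last m ∈ x.rightEnds := by
  simp only [Config.rightEnds, Finset.mem_filter, Finset.mem_univ, true_and]
  intro i hi
  have := x.pos_le_right i
  unfold Config.right at this
  omega

lemma Config.zero_mem_leftEnds (x : Config Λ (m + 1)) : 0 ∈ x.leftEnds := by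
  simp only [Config.leftEnds, Finset.mem_filter, Finset.mem_univ, true_and]
  intro i hi
  have := x.left_le_pos i
  unfold Config.left at this
  omega

lemma Config.one_le_halfEnds (x : Config Λ (m + 1)) : 1 ≤ x.halfEnds := by
  have h1 : 1 ≤ x.rightEnds.card := Finset.card_pos.2 ⟨_, x.last_mem_rightEnds⟩
  have h2 : 1 ≤ x.leftEnds.card := Finset.card_pos.2 ⟨_, x.zero_mem_leftEnds⟩
  have h1' : (1 : ℝ) ≤ x.rightEnds.card := by exact_mod_cast h1
  have h2' : (1 : ℝ) ≤ x.leftEnds.card := by exact_mod_cast h2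
  unfold Config.halfEnds
  linarith

lemma Config.Contiguous.halfEnds_eq {x : Config Λ (m + 1)} (hx : x.Contiguous) :
    x.halfEnds = 1 := by
  have h1 : x.rightEnds.card ≤ 1 := by
    rw [Finset.card_le_one_iff_subset_singleton]
    refine ⟨Fin.last m, fun j hj => ?_⟩
    simp only [Config.rightEnds, Finset.mem_filter, Finset.mem_univ, true_and] at hj
    by_contra hne
    rw [Finset.mem_singleton, ← ne_eq, ← Fin.lt_last_iff_ne_last] at hne
    have hlt : (j : ℕ) + 1 < m + 1 := by have := Fin.lt_def.1 hne; simpa using this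
    refine hj ⟨j + 1, hlt⟩ ?_
    rw [hx, hx j]; push_cast; ring
  have h2 : x.leftEnds.card ≤ 1 := by
    rw [Finset.card_le_one_iff_subset_singleton]
    refine ⟨0, fun j hj => ?_⟩
    simp only [Config.leftEnds, Finset.mem_filter, Finset.mem_univ, true_and] at hj
    by_contra hne
    rw [Finset.mem_singleton] at hne
    have hpos : 0 < (j : ℕ) := by
      rcases Nat.eq_zero_or_pos (j : ℕ) with h | h
      · exact absurd (Fin.ext h) hne
      · exact h
    refine hj ⟨j - 1, by omega⟩ ?_
    rw [hx, hx j]; push_cast [Nat.cast_sub hpos]; ring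
  have h1' : (x.rightEnds.card : ℝ) ≤ 1 := by exact_mod_cast h1
  have h2' : (x.leftEnds.card : ℝ) ≤ 1 := by exact_mod_cast h2
  refine le_antisymm ?_ x.one_le_halfEnds
  unfold Config.halfEnds
  linarith

lemma Config.exists_gap {x : Config Λ (m + 1)} (hx : ¬ x.Contiguous) :
    ∃ j : Fin m, (x.pos j.castSucc : ℤ) + 1 < x.pos j.succ := by
  by_contra! hcon
  apply hx
  intro j
  induction j using Fin.induction with
  | zero => simp [Config.left]
  | succ i ih =>
    have h1 := hcon i
    have h2 := x.pos_strictMono (Fin.castSucc_lt_succ (i := i))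
    have : (x.pos i.succ : ℤ) = x.pos i.castSucc + 1 := by omega
    rw [this, ih]
    simp [add_assoc]

/-- A gap creates a right end before it and a left end after it, in addition to the two outermost
ends. This is the source of the energy gap between blocks and all other configurations. -/
lemma Config.two_le_halfEnds {x : Config Λ (m + 1)} (hx : ¬ x.Contiguous) : 2 ≤ x.halfEnds := by
  obtain ⟨j, hj⟩ := Config.exists_gap hx
  have hsplit : ∀ i : Fin (m + 1), i ≤ j.castSucc ∨ j.succ ≤ i := fun i => by
    rcases le_or_gt i j.castSucc with h | h
    · exact Or.inl h
    · exact Or.inr (Fin.castSucc_lt_iff_succ_le.1 h)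
  have hmono : ∀ {i k : Fin (m + 1)}, i ≤ k → (x.pos i : ℤ) ≤ x.pos k := fun {i k} h =>
    h.eq_or_lt.elim (fun h => h ▸ le_rfl) fun h => (x.pos_strictMono h).le
  have hr : j.castSucc ∈ x.rightEnds := by
    simp only [Config.rightEnds, Finset.mem_filter, Finset.mem_univ, true_and]
    intro i hi
    rcases hsplit i with h | h <;> have := hmono h <;> omega
  have hl : j.succ ∈ x.leftEnds := by
    simp only [Config.leftEnds, Finset.mem_filter, Finset.mem_univ, true_and]
    intro i hi
    rcases hsplit i with h | h <;> have := hmono h <;> omega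
  have h1 : 2 ≤ x.rightEnds.card := by
    rw [← Finset.card_pair (Fin.castSucc_lt_last j).ne]
    exact Finset.card_le_card (by
      intro i hi; rcases Finset.mem_insert.1 hi with rfl | hi
      · exact hr
      · rw [Finset.mem_singleton.1 hi]; exact x.last_mem_rightEnds)
  have h2 : 2 ≤ x.leftEnds.card := by
    rw [← Finset.card_pair (Fin.succ_ne_zero j)]
    exact Finset.card_le_card (by
      intro i hi; rcases Finset.mem_insert.1 hi with rfl | hi
      · exact hl
      · rw [Finset.mem_singleton.1 hi]; exact x.zero_mem_leftEnds)
  have h1' : (2 : ℝ) ≤ x.rightEnds.card := by exact_mod_cast h1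
  have h2' : (2 : ℝ) ≤ x.leftEnds.card := by exact_mod_cast h2
  unfold Config.halfEnds
  linarith

/-- The configurations reached by moving one particle by one site. -/
def Config.nbrs {n : ℕ} (x : Config Λ n) : Finset (Config Λ n) :=
  Finset.univ.filter fun y => x.l1Dist y = 1

lemma Config.mem_nbrs {n : ℕ} {x y : Config Λ n} : y ∈ x.nbrs ↔ x.l1Dist y = 1 := by
  simp [Config.nbrs]

lemma Config.mem_nbrs_comm {n : ℕ} {x y : Config Λ n} : y ∈ x.nbrs ↔ x ∈ y.nbrs := by
  rw [Config.mem_nbrs, Config.mem_nbrs, Config.l1Dist_comm]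

/-- A particle can only hop onto an empty site, so a neighbour is determined by a cluster end and a
direction. The degree is thus controlled by the quantity that bounds the interaction from below,
which keeps all later estimates independent of `n`. -/
lemma Config.card_nbrs_le {n : ℕ} (x : Config Λ n) : (x.nbrs.card : ℝ) ≤ 2 * x.halfEnds := by
  classical
  have hex : ∀ y ∈ x.nbrs, ∃ e : Fin n ⊕ Fin n, e ∈ x.rightEnds.disjSum x.leftEnds ∧
      (∀ i, (y.pos i : ℤ) = x.pos i + Sum.elim (fun j => if i = j then 1 else 0)
        (fun j => if i = j then -1 else 0) e) := by
    intro y hy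
    obtain ⟨j, hj, hi⟩ := Config.exists_move (Config.mem_nbrs.1 hy)
    rcases hj with hj | hj
    · refine ⟨Sum.inl j, ?_, fun i => ?_⟩
      · simp only [Finset.inl_mem_disjSum, Config.rightEnds, Finset.mem_filter,
          Finset.mem_univ, true_and]
        intro i h
        have hij : i ≠ j := by rintro rfl; omega
        exact hij (y.pos_injective (by rw [hi i hij, hj, h]))
      · rcases eq_or_ne i j with rfl | h
        · simp [hj]
        · simp [h, hi i h]
    · refine ⟨Sum.inr j, ?_, fun i => ?_⟩
      · simp only [Finset.inr_mem_disjSum, Config.leftEnds, Finset.mem_filter,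
          Finset.mem_univ, true_and]
        intro i h
        have hij : i ≠ j := by rintro rfl; omega
        exact hij (y.pos_injective (by rw [hi i hij, hj, h]))
      · rcases eq_or_ne i j with rfl | h
        · simp [hj]; ring
        · simp [h, hi i h]
  rcases isEmpty_or_nonempty (Fin n) with hn | hn
  · have : x.nbrs = ∅ := Finset.eq_empty_of_forall_notMem fun y hy =>
      hn.elim (Config.exists_move (Config.mem_nbrs.1 hy)).choose
    rw [this]
    simp only [Finset.card_empty, Nat.cast_zero, Config.halfEnds]
    positivity
  choose! e he using hex
  have hcard : x.nbrs.card ≤ (x.rightEnds.disjSum x.leftEnds).card := by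
    refine Finset.card_le_card_of_injOn e (fun y hy => (he y hy).1) (fun y hy z hz hyz => ?_)
    refine Config.ext_pos fun i => ?_
    rw [(he y hy).2 i, (he z hz).2 i, hyz]
  rw [Finset.card_disjSum] at hcard
  have : (x.nbrs.card : ℝ) ≤ (x.rightEnds.card : ℝ) + x.leftEnds.card := by exact_mod_cast hcard
  unfold Config.halfEnds
  linarith

lemma Config.abs_left_sub_le {x y : Config Λ (m + 1)} (h : y ∈ x.nbrs) :
    |x.left - y.left| ≤ 1 := Config.abs_pos_sub_le (Config.mem_nbrs.1 h) 0

lemma Config.abs_right_sub_le {x y : Config Λ (m + 1)} (h : y ∈ x.nbrs) :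
    |x.right - y.right| ≤ 1 := Config.abs_pos_sub_le (Config.mem_nbrs.1 h) (Fin.last m)

end Combinatorics

/-! ### An `ℓ¹` Combes–Thomas estimate -/

section WeightedSums

/-- A function which, off a set `B`, is dominated by `r / κ` times the sum of its values over
neighbours has its weighted `ℓ¹`-mass controlled by its mass on `B`. -/
lemma weighted_sum_le {X : Type*} [Fintype X] (nbrs : X → Finset X)
    (hsymm : ∀ x y, y ∈ nbrs x ↔ x ∈ nbrs y) (κ D p : X → ℝ) (hD : ∀ x, 0 ≤ D x)
    (hp : ∀ x, 0 ≤ p x) (hdeg : ∀ x, ((nbrs x).card : ℝ) ≤ 2 * κ x) {r q : ℝ} (hr : 0 ≤ r)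
    (hq : ∀ x, ∀ y ∈ nbrs x, p y ≤ q * p x) (hrq : 2 * r * q ≤ 1 / 3) (hq0 : 0 ≤ q)
    (B : Finset X) (hB : ∀ x ∉ B, κ x * D x ≤ r * ∑ y ∈ nbrs x, D y) :
    ∑ x, κ x * p x * D x ≤ 3 / 2 * ∑ x ∈ B, κ x * p x * D x := by
  classical
  have hκ : ∀ x, 0 ≤ κ x := fun x => by
    have := (Nat.cast_nonneg (α := ℝ) (nbrs x).card).trans (hdeg x); linarith
  have h1 : ∑ x ∈ Bᶜ, κ x * p x * D x ≤ ∑ x ∈ Bᶜ, ∑ y ∈ nbrs x, r * (p x * D y) := by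
    refine Finset.sum_le_sum fun x hx => ?_
    have := mul_le_mul_of_nonneg_left (hB x (by simpa using hx)) (hp x)
    rw [← Finset.mul_sum, ← Finset.mul_sum]
    linarith
  have h2 : ∑ x ∈ Bᶜ, ∑ y ∈ nbrs x, r * (p x * D y) ≤ ∑ x, ∑ y ∈ nbrs x, r * (p x * D y) :=
    Finset.sum_le_sum_of_subset_of_nonneg (Finset.subset_univ _) fun x _ _ =>
      Finset.sum_nonneg fun y _ => mul_nonneg hr (mul_nonneg (hp x) (hD y))
  have h3 : ∑ x, ∑ y ∈ nbrs x, r * (p x * D y) = ∑ y, ∑ x ∈ nbrs y, r * (p x * D y) :=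
    Finset.sum_comm' (by intro x y; simp [hsymm x y])
  have h4 : ∑ y, ∑ x ∈ nbrs y, r * (p x * D y) ≤ ∑ y, 1 / 3 * (κ y * p y * D y) := by
    refine Finset.sum_le_sum fun y _ => ?_
    calc ∑ x ∈ nbrs y, r * (p x * D y) ≤ ∑ x ∈ nbrs y, r * (q * p y * D y) :=
          Finset.sum_le_sum fun x hx => mul_le_mul_of_nonneg_left
            (mul_le_mul_of_nonneg_right (hq y x hx) (hD y)) hr
      _ = (nbrs y).card * (r * (q * p y * D y)) := by rw [Finset.sum_const, nsmul_eq_mul]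
      _ ≤ 2 * κ y * (r * (q * p y * D y)) := mul_le_mul_of_nonneg_right (hdeg y)
          (mul_nonneg hr (mul_nonneg (mul_nonneg hq0 (hp y)) (hD y)))
      _ = 2 * r * q * (κ y * p y * D y) := by ring
      _ ≤ 1 / 3 * (κ y * p y * D y) := mul_le_mul_of_nonneg_right hrq
          (mul_nonneg (mul_nonneg (hκ y) (hp y)) (hD y))
  rw [← Finset.mul_sum] at h4
  have h5 := Finset.sum_add_sum_compl B fun x => κ x * p x * D x
  linarith

end WeightedSums

end HardCore

end

noncomputable section

namespace HardCore

/-! ### Boundary integrals of positive harmonic functions -/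

section HalfPlane

open Filter Topology Complex

/-- The Möbius map taking the unit disc to the lower half-plane and `0` to `-i W`. -/
def mobius (W : ℝ) (ζ : ℂ) : ℂ := -I * W * (1 + ζ) / (1 - ζ)

lemma mobius_im_neg {W : ℝ} (hW : 0 < W) {ζ : ℂ} (hζ : ‖ζ‖ < 1) : (mobius W ζ).im < 0 := by
  have hne : (1 : ℂ) - ζ ≠ 0 := by
    intro h
    have : ζ = 1 := by linear_combination -h
    simp [this] at hζ
  have hpos : 0 < normSq (1 - ζ) := normSq_pos.2 hne
  have hsq : ζ.re ^ 2 + ζ.im ^ 2 < 1 := by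
    have h1 : normSq ζ < 1 := by
      rw [normSq_eq_norm_sq]; nlinarith [norm_nonneg ζ]
    rw [normSq_apply] at h1; nlinarith
  have : (mobius W ζ).im = -W * (1 - ζ.re ^ 2 - ζ.im ^ 2) / normSq (1 - ζ) := by
    rw [mobius, div_im]
    simp
    field_simp
    ring
  rw [this]
  apply div_neg_of_neg_of_pos _ hpos
  nlinarith

/-- With `φ = arctan (v / W)` the point on the circle is `-exp (-2iφ)`, and the map sends it to `W
tan φ = v`. -/
lemma mobius_boundary {W : ℝ} (hW : 0 < W) (v : ℝ) :
    exp (((Real.pi - 2 * Real.arctan (v / W) : ℝ) : ℂ) * I) ≠ 1 ∧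
      mobius W (exp (((Real.pi - 2 * Real.arctan (v / W) : ℝ) : ℂ) * I)) = v := by
  set φ : ℝ := Real.arctan (v / W) with hφ
  have hcos : Real.cos φ ≠ 0 := (Real.cos_arctan_pos _).ne'
  have htan : v * Real.cos φ = W * Real.sin φ := by
    have h : Real.tan φ = v / W := Real.tan_arctan _
    rw [Real.tan_eq_sin_div_cos] at h
    field_simp at h
    linarith
  set c : ℂ := exp (φ * I) with hc
  set d : ℂ := exp (-(φ * I)) with hd
  have hcd : c * d = 1 := by rw [hc, hd, ← exp_add]; simp
  have hz : exp (((Real.pi - 2 * φ : ℝ) : ℂ) * I) = -(d * d) := by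
    have : (((Real.pi - 2 * φ : ℝ) : ℂ) * I) = Real.pi * I + (-(φ * I) + -(φ * I)) := by
      push_cast; ring
    rw [this, exp_add, exp_add, exp_pi_mul_I]; ring
  have hc1 : c = Real.cos φ + Real.sin φ * I := by
    rw [hc, exp_mul_I]; push_cast; ring
  have hd1 : d = Real.cos φ - Real.sin φ * I := by
    rw [hd, ← neg_mul, exp_mul_I]; push_cast; simp; ring
  have hcC : (Real.cos φ : ℂ) ≠ 0 := by exact_mod_cast hcos
  have hden : 1 + d * d = 2 * Real.cos φ * d := by
    have : c + d = 2 * Real.cos φ := by rw [hc1, hd1]; ring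
    rw [← this, add_mul, hcd]
  have hdne : d ≠ 0 := exp_ne_zero _
  rw [hz]
  constructor
  · intro h
    have : 1 + d * d = 0 := by linear_combination -h
    rw [hden] at this
    exact mul_ne_zero (mul_ne_zero two_ne_zero hcC) hdne this
  · have hnum : 1 - d * d = 2 * I * Real.sin φ * d := by
      have : c - d = 2 * I * Real.sin φ := by rw [hc1, hd1]; ring
      rw [← this, sub_mul, hcd]
    have htanC : (v : ℂ) * Real.cos φ = W * Real.sin φ := by exact_mod_cast htan
    have e1 : 1 + -(d * d) = 2 * I * Real.sin φ * d := by rw [← hnum]; ring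
    have e2 : 1 - -(d * d) = 2 * Real.cos φ * d := by rw [← hden]; ring
    rw [mobius, e1, e2, div_eq_iff (mul_ne_zero (mul_ne_zero two_ne_zero hcC) hdne)]
    linear_combination (-2 * d) * htanC - 2 * W * Real.sin φ * d * I_sq

/-- A nonnegative harmonic function on the lower half-plane has, on the real interval `[-W, W]`,
integral at most `2 π W` times its value at `-i W`. -/
lemma lintegral_re_le {g : ℂ → ℂ} (hd : DifferentiableOn ℂ g {z | z.im < 0})
    (hc : ContinuousOn g {z | z.im ≤ 0}) (hre : ∀ z : ℂ, z.im < 0 → 0 ≤ (g z).re)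
    {W : ℝ} (hW : 0 < W) :
    ∫⁻ v in Set.Icc (-W) W, ENNReal.ofReal (g (v : ℂ)).re ≤
      ENNReal.ofReal (2 * Real.pi * W * (g (-I * W)).re) := by
  set θ : ℝ → ℝ := fun v => Real.pi - 2 * Real.arctan (v / W) with hθ
  have hθc : Continuous θ := by
    simp only [hθ]; fun_prop
  -- Circles of radius below 1 stay where `G` is holomorphic, so the mean value property applies.
  -- The shift by 2 makes the first radius `1/2` positive.
  set R : ℕ → ℝ := fun j => 1 - 1 / ((j : ℝ) + 2) with hR
  have hR0 : ∀ j, 0 < R j := fun j => by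
    have : (1 : ℝ) / ((j : ℝ) + 2) < 1 := by
      rw [div_lt_one (by positivity)]; have : (0 : ℝ) ≤ j := Nat.cast_nonneg j; linarith
    simp only [hR]; linarith
  have hR1 : ∀ j, R j < 1 := fun j => by
    have : (0 : ℝ) < 1 / ((j : ℝ) + 2) := by positivity
    simp only [hR]; linarith
  have hRlim : Tendsto R atTop (𝓝 1) := by
    have h1 : Tendsto (fun j : ℕ => 1 / ((j : ℝ) + 2)) atTop (𝓝 0) := by
      have := (tendsto_const_div_atTop_nhds_zero_nat (1 : ℝ)).comp (tendsto_add_atTop_nat 2)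
      refine this.congr fun j => ?_
      simp
    simpa [hR] using h1.const_sub 1
  set G : ℂ → ℂ := fun ζ => g (mobius W ζ) with hG
  have hGd : DifferentiableOn ℂ G (Metric.ball 0 1) := by
    refine hd.comp ?_ fun ζ hζ => mobius_im_neg hW (by simpa using hζ)
    intro ζ hζ
    have hne : (1 : ℂ) - ζ ≠ 0 := by
      intro h
      have : ζ = 1 := by linear_combination -h
      simp [this] at hζ
    unfold mobius
    apply DifferentiableAt.differentiableWithinAt
    fun_prop (disch := exact hne)
  have hcm : ∀ j (t : ℝ), circleMap 0 (R j) t ∈ Metric.ball (0 : ℂ) 1 := fun j t => by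
    simp [abs_of_pos (hR0 j), hR1 j]
  have hcont : ∀ j, Continuous fun t : ℝ => G (circleMap 0 (R j) t) := fun j =>
    hGd.continuousOn.comp_continuous (continuous_circleMap 0 (R j)) (hcm j)
  have hmean : ∀ j, ∫ t in (0 : ℝ)..2 * Real.pi, (G (circleMap 0 (R j) t)).re =
      2 * Real.pi * (g (-I * W)).re := fun j => by
    have h1 : DiffContOnCl ℂ G (Metric.ball 0 |R j|) := by
      apply DifferentiableOn.diffContOnCl
      refine hGd.mono ?_
      refine Metric.closure_ball_subset_closedBall.trans (Metric.closedBall_subset_ball ?_)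
      rw [abs_of_pos (hR0 j)]; exact hR1 j
    have h2 := h1.circleAverage
    rw [Real.circleAverage_def] at h2
    have h3 : G 0 = g (-I * W) := by simp [hG, mobius]
    rw [h3] at h2
    have h4 : ∫ t in (0 : ℝ)..2 * Real.pi, G (circleMap 0 (R j) t) =
        ((2 * Real.pi : ℝ) : ℂ) * g (-I * W) := by
      rw [← h2, Complex.real_smul, ← mul_assoc, ← Complex.ofReal_mul,
        mul_inv_cancel₀ (by positivity)]
      simp
    have h5 := Complex.reCLM.intervalIntegral_comp_comm
      ((hcont j).intervalIntegrable (μ := volume) 0 (2 * Real.pi))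
    simp only [Complex.reCLM_apply] at h5
    rw [h5, h4, Complex.re_ofReal_mul]
  have hnn : ∀ j t, 0 ≤ (G (circleMap 0 (R j) t)).re := fun j t =>
    hre _ (mobius_im_neg hW (by simpa using hcm j t))
  have hlin : ∀ j, ∫⁻ t in Set.Ioc 0 (2 * Real.pi), ENNReal.ofReal (G (circleMap 0 (R j) t)).re =
      ENNReal.ofReal (2 * Real.pi * (g (-I * W)).re) := fun j => by
    rw [← hmean j, intervalIntegral.integral_of_le (by positivity),
      ofReal_integral_eq_lintegral_ofReal]
    · exact (Complex.continuous_re.comp (hcont j)).integrableOn_Ioc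
    · exact Eventually.of_forall fun t => hnn j t
  have hder : ∀ v ∈ Set.Icc (-W) W, HasDerivWithinAt θ (-2 / W / (1 + (v / W) ^ 2))
      (Set.Icc (-W) W) v := fun v _ => by
    have h1 : HasDerivAt (fun v : ℝ => v / W) (1 / W) v := (hasDerivAt_id v).div_const W
    have h2 := ((h1.arctan).const_mul 2).const_sub Real.pi
    refine (h2.congr_deriv ?_).hasDerivWithinAt
    field_simp
  have hinj : Set.InjOn θ (Set.Icc (-W) W) := fun a _ b _ h => by
    have : Real.arctan (a / W) = Real.arctan (b / W) := by
      simp only [hθ] at h; linarith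
    have := Real.arctan_injective this
    field_simp at this
    exact this
  have himg : θ '' Set.Icc (-W) W ⊆ Set.Ioc 0 (2 * Real.pi) := by
    rintro _ ⟨v, _, rfl⟩
    have h1 := Real.arctan_lt_pi_div_two (v / W)
    have h2 := Real.neg_pi_div_two_lt_arctan (v / W)
    exact ⟨by simp only [hθ]; linarith, by simp only [hθ]; linarith⟩
  have hbound : ∀ j, ∫⁻ v in Set.Icc (-W) W, ENNReal.ofReal (G (circleMap 0 (R j) (θ v))).re ≤
      ENNReal.ofReal (2 * Real.pi * W * (g (-I * W)).re) := fun j => by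
    have h1 := lintegral_image_eq_lintegral_abs_deriv_mul measurableSet_Icc hder hinj
      (fun t => ENNReal.ofReal (G (circleMap 0 (R j) t)).re)
    -- On `[-W, W]` the Jacobian `(2 / W) / (1 + (v / W)²)` is at least `1 / W`. Choosing the base
    -- point `-i W` at the scale of the window is what makes this hold.
    have h2 : ∫⁻ v in Set.Icc (-W) W, ENNReal.ofReal (G (circleMap 0 (R j) (θ v))).re ≤
        ∫⁻ v in Set.Icc (-W) W, ENNReal.ofReal W * (ENNReal.ofReal |-2 / W / (1 + (v / W) ^ 2)| *
          ENNReal.ofReal (G (circleMap 0 (R j) (θ v))).re) := by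
      refine setLIntegral_mono' measurableSet_Icc fun v hv => ?_
      rw [← mul_assoc, ← ENNReal.ofReal_mul hW.le]
      refine le_mul_of_one_le_left (zero_le) ?_
      rw [← ENNReal.ofReal_one]
      apply ENNReal.ofReal_le_ofReal
      have hvW : (v / W) ^ 2 ≤ 1 := by
        rw [sq_le_one_iff_abs_le_one, abs_div, abs_of_pos hW, div_le_one hW]
        exact abs_le.2 hv
      rw [abs_div, abs_div, abs_of_pos hW, abs_of_pos (by positivity : 0 < 1 + (v / W) ^ 2)]
      rw [mul_div, mul_div_cancel₀ _ hW.ne', le_div_iff₀ (by positivity)]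
      norm_num
      linarith
    refine h2.trans ?_
    rw [lintegral_const_mul' _ _ ENNReal.ofReal_ne_top, ← h1]
    calc ENNReal.ofReal W * ∫⁻ t in θ '' Set.Icc (-W) W,
          ENNReal.ofReal (G (circleMap 0 (R j) t)).re
        ≤ ENNReal.ofReal W * ∫⁻ t in Set.Ioc 0 (2 * Real.pi),
          ENNReal.ofReal (G (circleMap 0 (R j) t)).re := by
          gcongr
      _ = ENNReal.ofReal (2 * Real.pi * W * (g (-I * W)).re) := by
          rw [hlin, ← ENNReal.ofReal_mul hW.le]; congr 1; ring
  have hlim : ∀ v : ℝ, Tendsto (fun j => ENNReal.ofReal (G (circleMap 0 (R j) (θ v))).re) atTop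
      (𝓝 (ENNReal.ofReal (g (v : ℂ)).re)) := fun v => by
    obtain ⟨hne, hmv⟩ := mobius_boundary hW v
    have h1 : Tendsto (fun j => circleMap 0 (R j) (θ v)) atTop (𝓝 (exp ((θ v : ℂ) * I))) := by
      have : Tendsto (fun j => ((R j : ℝ) : ℂ) * exp ((θ v : ℂ) * I)) atTop
          (𝓝 (((1 : ℝ) : ℂ) * exp ((θ v : ℂ) * I))) :=
        ((continuous_ofReal.tendsto 1).comp hRlim).mul_const _
      simpa [circleMap] using this
    have h2 : ContinuousAt (mobius W) (exp ((θ v : ℂ) * I)) := by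
      have : (1 : ℂ) - exp ((θ v : ℂ) * I) ≠ 0 := sub_ne_zero.2 (Ne.symm hne)
      unfold mobius
      fun_prop (disch := exact this)
    have h3 : Tendsto (fun j => mobius W (circleMap 0 (R j) (θ v))) atTop (𝓝 (v : ℂ)) := by
      have := h2.tendsto.comp h1
      rwa [show mobius W (exp ((θ v : ℂ) * I)) = v from hmv] at this
    have h4 : Tendsto (fun j => mobius W (circleMap 0 (R j) (θ v))) atTop
        (𝓝[{z | z.im ≤ 0}] (v : ℂ)) := by
      refine tendsto_nhdsWithin_iff.2 ⟨h3, Eventually.of_forall fun j => ?_⟩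
      exact (mobius_im_neg hW (by simpa using hcm j (θ v))).le
    have h5 := (hc (v : ℂ) (by simp)).tendsto.comp h4
    exact ENNReal.tendsto_ofReal ((Complex.continuous_re.tendsto _).comp h5)
  -- Fatou's lemma passes the uniform bound to radius 1; positivity of the real part replaces any
  -- domination.
  calc ∫⁻ v in Set.Icc (-W) W, ENNReal.ofReal (g (v : ℂ)).re
      = ∫⁻ v in Set.Icc (-W) W,
          liminf (fun j => ENNReal.ofReal (G (circleMap 0 (R j) (θ v))).re) atTop :=
        lintegral_congr fun v => ((hlim v).liminf_eq).symm
    _ ≤ liminf (fun j => ∫⁻ v in Set.Icc (-W) W,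
          ENNReal.ofReal (G (circleMap 0 (R j) (θ v))).re) atTop :=
        lintegral_liminf_le fun j => ENNReal.measurable_ofReal.comp
          (Complex.continuous_re.comp ((hcont j).comp hθc)).measurable
    _ ≤ ENNReal.ofReal (2 * Real.pi * W * (g (-I * W)).re) :=
        liminf_le_of_le (by isBoundedDefault) fun b hb => by
          obtain ⟨j, hj⟩ := hb.exists
          exact hj.trans (hbound j)

end HalfPlane

end HardCore

end

noncomputable section

namespace HardCore

/-! ### Averaging the resolvent over the coupling of a projection -/

section Resolvent

open Matrix Complex

variable {X : Type*} [Fintype X] [DecidableEq X]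

/-- The resolvent `(H - z)⁻¹`. -/
def resolv (H : Matrix X X ℂ) (z : ℂ) : Matrix X X ℂ := (H - z • (1 : Matrix X X ℂ))⁻¹

/-- The coordinate projection onto the span of the basis vectors indexed by `A`. -/
def coordProj (A : Finset X) : Matrix X X ℂ := diagonal fun x => if x ∈ A then 1 else 0

lemma inv_apply_eq (M : Matrix X X ℂ) (x y : X) : M⁻¹ x y = M.det⁻¹ * M.adjugate x y := by
  rw [Matrix.inv_def, Matrix.smul_apply, Ring.inverse_eq_inv', smul_eq_mul]

lemma measurable_det {Ω : Type*} [MeasurableSpace Ω] {M : Ω → Matrix X X ℂ}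
    (hM : ∀ x y, Measurable fun w => M w x y) : Measurable fun w => (M w).det := by
  simp only [Matrix.det_apply]
  refine Finset.measurable_sum _ fun σ _ => ?_
  exact (Finset.measurable_prod _ fun i _ => hM _ _).const_smul _

lemma measurable_inv_apply {Ω : Type*} [MeasurableSpace Ω] {M : Ω → Matrix X X ℂ}
    (hM : ∀ x y, Measurable fun w => M w x y) (x y : X) : Measurable fun w => (M w)⁻¹ x y := by
  simp only [inv_apply_eq, Matrix.adjugate_apply]
  refine (measurable_det hM).inv.mul (measurable_det fun i j => ?_)
  by_cases h : i = y
  · subst h; simp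
  · simpa [Matrix.updateRow_ne h] using hM i j

lemma differentiableAt_det {M : ℂ → Matrix X X ℂ} {t : ℂ}
    (hM : ∀ x y, DifferentiableAt ℂ (fun w => M w x y) t) :
    DifferentiableAt ℂ (fun w => (M w).det) t := by
  simp only [Matrix.det_apply]
  refine DifferentiableAt.fun_sum fun σ _ => ?_
  exact (DifferentiableAt.fun_finsetProd fun i _ => hM _ _).const_smul _

lemma differentiableAt_inv_apply {M : ℂ → Matrix X X ℂ} {t : ℂ}
    (hM : ∀ x y, DifferentiableAt ℂ (fun w => M w x y) t) (hdet : (M t).det ≠ 0) (x y : X) :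
    DifferentiableAt ℂ (fun w => (M w)⁻¹ x y) t := by
  simp only [inv_apply_eq, Matrix.adjugate_apply]
  refine ((differentiableAt_det hM).inv hdet).mul (differentiableAt_det fun i j => ?_)
  by_cases h : i = y
  · subst h; simp
  · simpa [Matrix.updateRow_ne h] using hM i j

variable {H : Matrix X X ℂ} {A : Finset X}

lemma star_dotProduct_self_eq {X : Type*} [Fintype X] (f : X → ℂ) : star f ⬝ᵥ f = ((∑ x, ‖f x‖ ^ 2 : ℝ) : ℂ) := by
  simp [dotProduct, conj_mul']

/-- For `Im t ≤ 0 < Im z` both contributions have the same sign. Hence the matrix is invertible on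
the closed lower half-plane of couplings, and the resolvent form is analytic there with non-negative
imaginary part. -/
lemma im_quadratic (hH : H.IsHermitian) (A : Finset X) (t z : ℂ) (f : X → ℂ) :
    (star f ⬝ᵥ ((H + t • coordProj A - z • (1 : Matrix X X ℂ)) *ᵥ f)).im =
      t.im * ∑ x ∈ A, ‖f x‖ ^ 2 - z.im * ∑ x, ‖f x‖ ^ 2 := by
  have h1 : (star f ⬝ᵥ (H *ᵥ f)).im = 0 := hH.im_star_dotProduct_mulVec_self f
  have h2 : star f ⬝ᵥ (coordProj A *ᵥ f) = ((∑ x ∈ A, ‖f x‖ ^ 2 : ℝ) : ℂ) := by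
    simp only [coordProj, dotProduct, mulVec_diagonal, Pi.star_apply, RCLike.star_def]
    rw [← Finset.sum_subset (Finset.subset_univ A)]
    · push_cast
      refine Finset.sum_congr rfl fun x hx => ?_
      rw [if_pos hx, one_mul, conj_mul']
    · intro x _ hx; simp [hx]
  rw [sub_mulVec, add_mulVec, smul_mulVec, smul_mulVec, one_mulVec, dotProduct_sub,
    dotProduct_add, dotProduct_smul, dotProduct_smul, h2, star_dotProduct_self_eq]
  simp only [smul_eq_mul, sub_im, add_im, h1, mul_im, ofReal_re, ofReal_im]
  ring

lemma det_ne_zero_of_im (hH : H.IsHermitian) (A : Finset X) {t z : ℂ} (ht : t.im ≤ 0)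
    (hz : 0 < z.im) : (H + t • coordProj A - z • (1 : Matrix X X ℂ)).det ≠ 0 := by
  intro h
  obtain ⟨f, hf0, hf⟩ := exists_mulVec_eq_zero_iff.2 h
  have h1 := im_quadratic hH A t z f
  rw [hf, dotProduct_zero, zero_im] at h1
  have h2 : 0 ≤ ∑ x ∈ A, ‖f x‖ ^ 2 := Finset.sum_nonneg fun _ _ => by positivity
  have h3 : 0 < ∑ x, ‖f x‖ ^ 2 := by
    obtain ⟨x, hx⟩ := Function.ne_iff.1 hf0
    refine Finset.sum_pos' (fun _ _ => by positivity) ⟨x, Finset.mem_univ x, ?_⟩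
    have : 0 < ‖f x‖ := norm_pos_iff.2 hx
    positivity
  nlinarith [mul_nonneg_of_nonpos_of_nonpos ht (neg_nonpos.2 h2), mul_pos hz h3]

lemma det_sub_smul_ne_zero (hH : H.IsHermitian) {z : ℂ} (hz : 0 < z.im) :
    (H - z • (1 : Matrix X X ℂ)).det ≠ 0 := by
  simpa using det_ne_zero_of_im hH ∅ (t := 0) (by simp) hz

/-- The quadratic form of the resolvent of `H + lam t N`. -/
def resolvForm (H : Matrix X X ℂ) (A : Finset X) (lam : ℝ) (z : ℂ) (φ ψ : X → ℂ) (t : ℂ) : ℂ :=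
  star φ ⬝ᵥ (resolv (H + (lam * t) • coordProj A) z *ᵥ ψ)

lemma differentiableAt_resolvForm (hH : H.IsHermitian) {lam : ℝ} (hlam : 0 < lam) {z : ℂ}
    (hz : 0 < z.im) (φ ψ : X → ℂ) {t : ℂ} (ht : t.im ≤ 0) :
    DifferentiableAt ℂ (resolvForm H A lam z φ ψ) t := by
  unfold resolvForm
  simp only [dotProduct, mulVec]
  refine DifferentiableAt.fun_sum fun x _ => DifferentiableAt.const_mul ?_ _
  refine DifferentiableAt.fun_sum fun y _ => DifferentiableAt.mul_const ?_ _
  refine differentiableAt_inv_apply (M := fun t => H + (lam * t) • coordProj A - z • 1)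
    (fun x y => ?_) (det_ne_zero_of_im hH A ?_ hz) x y
  · simp only [Matrix.sub_apply, Matrix.add_apply, Matrix.smul_apply, smul_eq_mul]
    fun_prop
  · rw [im_ofReal_mul]; exact mul_nonpos_of_nonneg_of_nonpos hlam.le ht

lemma im_resolvForm (hH : H.IsHermitian) {lam : ℝ} (hlam : 0 < lam) {z : ℂ} (hz : 0 < z.im)
    (φ : X → ℂ) {t : ℂ} (ht : t.im ≤ 0) :
    ∃ f : X → ℂ, (H + (lam * t) • coordProj A - z • (1 : Matrix X X ℂ)) *ᵥ f = φ ∧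
      resolvForm H A lam z φ φ t = star φ ⬝ᵥ f ∧
      (resolvForm H A lam z φ φ t).im =
        -(lam * t.im) * ∑ x ∈ A, ‖f x‖ ^ 2 + z.im * ∑ x, ‖f x‖ ^ 2 := by
  set M := H + (lam * t) • coordProj A - z • (1 : Matrix X X ℂ) with hM
  have ht' : ((lam : ℂ) * t).im ≤ 0 := by
    rw [im_ofReal_mul]; exact mul_nonpos_of_nonneg_of_nonpos hlam.le ht
  have hdet : M.det ≠ 0 := det_ne_zero_of_im hH A ht' hz
  have hMf : M *ᵥ (M⁻¹ *ᵥ φ) = φ := by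
    rw [mulVec_mulVec, mul_nonsing_inv _ (isUnit_iff_ne_zero.2 hdet), one_mulVec]
  refine ⟨M⁻¹ *ᵥ φ, hMf, rfl, ?_⟩
  have h1 := im_quadratic hH A (lam * t) z (M⁻¹ *ᵥ φ)
  rw [← hM, hMf] at h1
  have h2 : resolvForm H A lam z φ φ t = star (star (M⁻¹ *ᵥ φ) ⬝ᵥ φ) :=
    star_dotProduct _ _
  rw [h2, RCLike.star_def, conj_im, h1, im_ofReal_mul]
  ring

lemma im_resolvForm_nonneg (hH : H.IsHermitian) {lam : ℝ} (hlam : 0 < lam) {z : ℂ}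
    (hz : 0 < z.im) (φ : X → ℂ) {t : ℂ} (ht : t.im ≤ 0) :
    0 ≤ (resolvForm H A lam z φ φ t).im := by
  obtain ⟨f, -, -, h⟩ := im_resolvForm (A := A) hH hlam hz φ ht
  rw [h]
  have h2 : 0 ≤ ∑ x ∈ A, ‖f x‖ ^ 2 := Finset.sum_nonneg fun _ _ => by positivity
  have h3 : 0 ≤ ∑ x, ‖f x‖ ^ 2 := Finset.sum_nonneg fun _ _ => by positivity
  have h4 : 0 ≤ -(lam * t.im) := by nlinarith
  positivity

lemma im_resolvForm_pos (hH : H.IsHermitian) {lam : ℝ} (hlam : 0 < lam) {z : ℂ}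
    (hz : 0 < z.im) {φ : X → ℂ} (hφ : φ ≠ 0) {t : ℂ} (ht : t.im ≤ 0) :
    0 < (resolvForm H A lam z φ φ t).im := by
  obtain ⟨f, hf, -, h⟩ := im_resolvForm (A := A) hH hlam hz φ ht
  rw [h]
  have h2 : 0 ≤ ∑ x ∈ A, ‖f x‖ ^ 2 := Finset.sum_nonneg fun _ _ => by positivity
  have hf0 : f ≠ 0 := by
    rintro rfl
    exact hφ (by rw [← hf, mulVec_zero])
  have h3 : 0 < ∑ x, ‖f x‖ ^ 2 := by
    obtain ⟨x, hx⟩ := Function.ne_iff.1 hf0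
    refine Finset.sum_pos' (fun _ _ => by positivity) ⟨x, Finset.mem_univ x, ?_⟩
    have : 0 < ‖f x‖ := norm_pos_iff.2 hx
    positivity
  have h4 : 0 ≤ -(lam * t.im) := by nlinarith
  positivity

/-- At coupling `-i W` the imaginary part dominates `lam W` times the mass of the solution on `A`,
while Cauchy–Schwarz bounds the squared form by that mass times `‖φ‖²`. The resulting bound does not
see `Im z`. -/
lemma norm_resolvForm_le (hH : H.IsHermitian) {lam : ℝ} (hlam : 0 < lam) {z : ℂ}
    (hz : 0 < z.im) {φ : X → ℂ} (hφ : ∀ x ∉ A, φ x = 0) {W : ℝ} (hW : 0 < W) :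
    ‖resolvForm H A lam z φ φ (-I * W)‖ ≤ (∑ x, ‖φ x‖ ^ 2) / (lam * W) := by
  obtain ⟨f, hf, hform, him⟩ := im_resolvForm (A := A) hH hlam hz φ (t := -I * W)
    (by simp [hW.le])
  set q := ‖resolvForm H A lam z φ φ (-I * W)‖
  set S := ∑ x ∈ A, ‖f x‖ ^ 2
  have hS : 0 ≤ S := Finset.sum_nonneg fun _ _ => by positivity
  have h3 : 0 ≤ ∑ x, ‖f x‖ ^ 2 := Finset.sum_nonneg fun _ _ => by positivity
  have hΦ : 0 ≤ ∑ x, ‖φ x‖ ^ 2 := Finset.sum_nonneg fun _ _ => by positivity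
  have h1 : lam * W * S ≤ q := by
    have : (resolvForm H A lam z φ φ (-I * W)).im ≤ q :=
      (le_abs_self _).trans (abs_im_le_norm _)
    rw [him] at this
    simp at this
    nlinarith [mul_nonneg hz.le h3]
  have h2 : q ^ 2 ≤ S * ∑ x, ‖φ x‖ ^ 2 := by
    have hq : q ≤ ∑ x ∈ A, ‖f x‖ * ‖φ x‖ := by
      have : star φ ⬝ᵥ f = ∑ x ∈ A, star (φ x) * f x := by
        rw [dotProduct, ← Finset.sum_subset (Finset.subset_univ A)]
        · rfl
        · intro x _ hx; simp [hφ x hx]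
      simp only [q, hform, this]
      refine (norm_sum_le _ _).trans (Finset.sum_le_sum fun x _ => ?_)
      rw [norm_mul, norm_star, mul_comm]
    have h4 : (∑ x ∈ A, ‖f x‖ * ‖φ x‖) ^ 2 ≤ S * ∑ x ∈ A, ‖φ x‖ ^ 2 :=
      Finset.sum_mul_sq_le_sq_mul_sq _ _ _
    have h5 : ∑ x ∈ A, ‖φ x‖ ^ 2 ≤ ∑ x, ‖φ x‖ ^ 2 :=
      Finset.sum_le_sum_of_subset_of_nonneg (Finset.subset_univ _) fun _ _ _ => by positivity
    calc q ^ 2 ≤ (∑ x ∈ A, ‖f x‖ * ‖φ x‖) ^ 2 := by gcongr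
      _ ≤ S * ∑ x ∈ A, ‖φ x‖ ^ 2 := h4
      _ ≤ _ := by gcongr
  rw [le_div_iff₀ (by positivity)]
  have hq0 : 0 ≤ q := norm_nonneg _
  rcases hq0.eq_or_lt with h | h
  · rw [← h]; simpa using hΦ
  · have h4 : q ^ 2 * (lam * W) ≤ q * ∑ x, ‖φ x‖ ^ 2 := by
      have hlW : 0 < lam * W := by positivity
      nlinarith [mul_le_mul_of_nonneg_right h2 hlW.le, mul_le_mul_of_nonneg_right h1 hΦ]
    have : q * (q * (lam * W)) ≤ q * ∑ x, ‖φ x‖ ^ 2 := by nlinarith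
    exact le_of_mul_le_mul_left this h

/-- The imaginary part is a non-negative harmonic function of the coupling, so its boundary integral
is controlled by its value at `-i W`. The factor `W` cancels there. -/
lemma lintegral_im_resolvForm_le (hH : H.IsHermitian) {lam : ℝ} (hlam : 0 < lam) {z : ℂ}
    (hz : 0 < z.im) {φ : X → ℂ} (hφ : ∀ x ∉ A, φ x = 0) {W : ℝ} (hW : 0 < W) :
    ∫⁻ v in Set.Icc (-W) W, ENNReal.ofReal (resolvForm H A lam z φ φ (v : ℂ)).im ≤
      ENNReal.ofReal (2 * Real.pi / lam * ∑ x, ‖φ x‖ ^ 2) := by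
  have h := lintegral_re_le (g := fun t => -I * resolvForm H A lam z φ φ t)
    (fun t ht => ((differentiableAt_resolvForm hH hlam hz φ φ
      (le_of_lt ht)).const_mul _).differentiableWithinAt)
    (fun t ht => ((differentiableAt_resolvForm hH hlam hz φ φ
      ht).const_mul _).continuousAt.continuousWithinAt)
    (fun t ht => by simpa using im_resolvForm_nonneg hH hlam hz φ ht.le) hW
  have e : ∀ w : ℂ, (-I * w).re = w.im := fun w => by simp
  simp only [e] at h
  refine h.trans (ENNReal.ofReal_le_ofReal ?_)
  have h1 := (le_abs_self _).trans ((abs_im_le_norm _).trans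
    (norm_resolvForm_le hH hlam hz hφ hW))
  calc 2 * Real.pi * W * (resolvForm H A lam z φ φ (-I * W)).im
      ≤ 2 * Real.pi * W * ((∑ x, ‖φ x‖ ^ 2) / (lam * W)) := by gcongr
    _ = _ := by field_simp

/-- Multiplied by `-i`, the form has positive real part, so its principal square root is holomorphic
and stays in the sector `|arg| < π/4`. There the modulus is at most `√2` times the real part, which
is a positive harmonic function. The bound 4 on `‖φ‖²` anticipates polarization of two vectors of
norm at most 1. -/
lemma lintegral_sqrt_resolvForm_self_le (hH : H.IsHermitian) {lam : ℝ} (hlam : 0 < lam) {z : ℂ}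
    (hz : 0 < z.im) {φ : X → ℂ} (hφ : ∀ x ∉ A, φ x = 0) (hφ4 : ∑ x, ‖φ x‖ ^ 2 ≤ 4)
    {W : ℝ} (hW : 0 < W) :
    ∫⁻ v in Set.Icc (-W) W, ENNReal.ofReal √‖resolvForm H A lam z φ φ (v : ℂ)‖ ≤
      ENNReal.ofReal (8 * Real.pi * √(W / lam)) := by
  rcases eq_or_ne φ 0 with rfl | hφ0
  · simp [resolvForm]
  have hslit : ∀ t : ℂ, t.im ≤ 0 → 0 < (-I * resolvForm H A lam z φ φ t).re := fun t ht => by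
    simpa using im_resolvForm_pos hH hlam hz hφ0 ht
  have hdiff : ∀ t : ℂ, t.im ≤ 0 → DifferentiableAt ℂ
      (fun t => (-I * resolvForm H A lam z φ φ t) ^ (2⁻¹ : ℂ)) t := fun t ht =>
    ((differentiableAt_resolvForm hH hlam hz φ φ ht).const_mul _).cpow_const
      (Or.inl (hslit t ht))
  have h := lintegral_re_le (g := fun t => (-I * resolvForm H A lam z φ φ t) ^ (2⁻¹ : ℂ))
    (fun t ht => (hdiff t (le_of_lt ht)).differentiableWithinAt)
    (fun t ht => (hdiff t ht).continuousAt.continuousWithinAt)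
    (fun t ht => by rw [cpow_inv_two_re]; positivity) hW
  have hle : ∀ v : ℝ, ENNReal.ofReal √‖resolvForm H A lam z φ φ (v : ℂ)‖ ≤ ENNReal.ofReal √2 *
      ENNReal.ofReal (((-I * resolvForm H A lam z φ φ v) ^ (2⁻¹ : ℂ)).re) := fun v => by
    rw [← ENNReal.ofReal_mul (by positivity), cpow_inv_two_re, ← Real.sqrt_mul (by norm_num)]
    refine ENNReal.ofReal_le_ofReal (Real.sqrt_le_sqrt ?_)
    have := hslit v (by simp)
    rw [norm_mul]
    simp only [norm_neg, norm_I, one_mul]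
    linarith
  have hval : ((-I * resolvForm H A lam z φ φ (-I * W)) ^ (2⁻¹ : ℂ)).re ≤ √(4 / (lam * W)) := by
    rw [cpow_inv_two_re]
    refine Real.sqrt_le_sqrt ?_
    have h1 := norm_resolvForm_le hH hlam hz hφ hW
    have h2 : (∑ x, ‖φ x‖ ^ 2) / (lam * W) ≤ 4 / (lam * W) := by gcongr
    have h3 := (le_abs_self _).trans (abs_re_le_norm (-I * resolvForm H A lam z φ φ (-I * W)))
    have h4 : ‖-I * resolvForm H A lam z φ φ (-I * W)‖ = ‖resolvForm H A lam z φ φ (-I * W)‖ := by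
      rw [norm_mul]; simp
    linarith
  calc ∫⁻ v in Set.Icc (-W) W, ENNReal.ofReal √‖resolvForm H A lam z φ φ (v : ℂ)‖
      ≤ ∫⁻ v in Set.Icc (-W) W, ENNReal.ofReal √2 *
        ENNReal.ofReal (((-I * resolvForm H A lam z φ φ v) ^ (2⁻¹ : ℂ)).re) :=
        lintegral_mono fun v => hle v
    _ = ENNReal.ofReal √2 * ∫⁻ v in Set.Icc (-W) W,
        ENNReal.ofReal (((-I * resolvForm H A lam z φ φ v) ^ (2⁻¹ : ℂ)).re) :=
        lintegral_const_mul' _ _ ENNReal.ofReal_ne_top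
    _ ≤ ENNReal.ofReal √2 * ENNReal.ofReal (2 * Real.pi * W * √(4 / (lam * W))) := by
        refine mul_le_mul_right (h.trans (ENNReal.ofReal_le_ofReal ?_)) _
        gcongr
    _ ≤ ENNReal.ofReal (8 * Real.pi * √(W / lam)) := by
        rw [← ENNReal.ofReal_mul (by positivity)]
        refine ENNReal.ofReal_le_ofReal ?_
        have h1 : √(4 / (lam * W)) = 2 / W * √(W / lam) := by
          rw [show 4 / (lam * W) = (2 / W) ^ 2 * (W / lam) by field_simp; ring,
            Real.sqrt_mul (by positivity), Real.sqrt_sq (by positivity)]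
        have h2 : √2 ≤ 2 := by
          rw [Real.sqrt_le_left (by norm_num)]; norm_num
        rw [h1]
        calc √2 * (2 * Real.pi * W * (2 / W * √(W / lam)))
            = √2 * (4 * Real.pi * √(W / lam)) := by field_simp; ring
          _ ≤ 2 * (4 * Real.pi * √(W / lam)) := by gcongr
          _ = _ := by ring

lemma resolvForm_polarization (lam : ℝ) (z : ℂ) (φ χ : X → ℂ) (t : ℂ) :
    4 * resolvForm H A lam z φ χ t = resolvForm H A lam z (φ + χ) (φ + χ) t
      - resolvForm H A lam z (φ - χ) (φ - χ) t
      - I * resolvForm H A lam z (φ + I • χ) (φ + I • χ) t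
      + I * resolvForm H A lam z (φ - I • χ) (φ - I • χ) t := by
  simp only [resolvForm, star_add, star_sub, star_smul, mulVec_add, mulVec_sub, mulVec_smul,
    add_dotProduct, sub_dotProduct, dotProduct_add, dotProduct_sub, smul_dotProduct,
    dotProduct_smul, smul_eq_mul, RCLike.star_def, conj_I]
  linear_combination (2 * (star φ ⬝ᵥ resolv (H + (↑lam * t) • coordProj A) z *ᵥ χ) -
    2 * (star χ ⬝ᵥ resolv (H + (↑lam * t) • coordProj A) z *ᵥ φ)) * I_sq

lemma sq_norm_add_le_four {X : Type*} [Fintype X] {φ χ : X → ℂ} (hφ : ∑ x, ‖φ x‖ ^ 2 ≤ 1) (hχ : ∑ x, ‖χ x‖ ^ 2 ≤ 1)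
    {c : ℂ} (hc : ‖c‖ = 1) : ∑ x, ‖φ x + c * χ x‖ ^ 2 ≤ 4 := by
  calc ∑ x, ‖φ x + c * χ x‖ ^ 2 ≤ ∑ x, (2 * ‖φ x‖ ^ 2 + 2 * ‖χ x‖ ^ 2) := by
        refine Finset.sum_le_sum fun x _ => ?_
        have h1 : ‖φ x + c * χ x‖ ≤ ‖φ x‖ + ‖χ x‖ := by
          refine (norm_add_le _ _).trans ?_
          rw [norm_mul, hc, one_mul]
        have h2 := norm_nonneg (φ x + c * χ x)
        nlinarith [sq_nonneg (‖φ x‖ - ‖χ x‖)]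
    _ ≤ 4 := by
        rw [Finset.sum_add_distrib, ← Finset.mul_sum, ← Finset.mul_sum]; linarith

lemma lintegral_sqrt_resolvForm_le (hH : H.IsHermitian) {lam : ℝ} (hlam : 0 < lam) {z : ℂ}
    (hz : 0 < z.im) {φ χ : X → ℂ} (hφ : ∀ x ∉ A, φ x = 0) (hχ : ∀ x ∉ A, χ x = 0)
    (hφ1 : ∑ x, ‖φ x‖ ^ 2 ≤ 1) (hχ1 : ∑ x, ‖χ x‖ ^ 2 ≤ 1) {W : ℝ} (hW : 0 < W) :
    ∫⁻ v in Set.Icc (-W) W, ENNReal.ofReal √‖resolvForm H A lam z φ χ (v : ℂ)‖ ≤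
      ENNReal.ofReal (16 * Real.pi * √(W / lam)) := by
  have hcont : ∀ ψ : X → ℂ, Measurable fun v : ℝ =>
      ENNReal.ofReal √‖resolvForm H A lam z ψ ψ (v : ℂ)‖ := fun ψ => by
    have : Continuous fun v : ℝ => resolvForm H A lam z ψ ψ (v : ℂ) :=
      continuous_iff_continuousAt.2 fun v => ContinuousAt.comp
        (g := resolvForm H A lam z ψ ψ) (differentiableAt_resolvForm hH hlam hz ψ ψ (by simp)).continuousAt
        continuous_ofReal.continuousAt
    exact ENNReal.measurable_ofReal.comp (Real.continuous_sqrt.comp this.norm).measurable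
  have hsq : ∀ a b : ℝ, 0 ≤ a → 0 ≤ b → √(a + b) ≤ √a + √b := fun a b ha hb => by
    rw [Real.sqrt_le_left (by positivity)]
    nlinarith [Real.sq_sqrt ha, Real.sq_sqrt hb, mul_nonneg (Real.sqrt_nonneg a) (Real.sqrt_nonneg b)]
  set F : (X → ℂ) → ℝ → ENNReal := fun ψ v =>
    ENNReal.ofReal √‖resolvForm H A lam z ψ ψ (v : ℂ)‖ with hF
  -- The polarization factor `1/4` becomes `1/2` under the square root, which is subadditive over
  -- the four terms.
  have hpt : ∀ v : ℝ, ENNReal.ofReal √‖resolvForm H A lam z φ χ (v : ℂ)‖ ≤ ENNReal.ofReal 2⁻¹ *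
      (F (φ + χ) v + F (φ - χ) v + F (φ + I • χ) v + F (φ - I • χ) v) := fun v => by
    simp only [hF]
    rw [← ENNReal.ofReal_add (by positivity) (by positivity),
      ← ENNReal.ofReal_add (by positivity) (by positivity),
      ← ENNReal.ofReal_add (by positivity) (by positivity), ← ENNReal.ofReal_mul (by norm_num)]
    refine ENNReal.ofReal_le_ofReal ?_
    have h := congrArg norm (resolvForm_polarization (H := H) (A := A) lam z φ χ v)
    set a := resolvForm H A lam z (φ + χ) (φ + χ) v
    set b := resolvForm H A lam z (φ - χ) (φ - χ) v
    set c := resolvForm H A lam z (φ + I • χ) (φ + I • χ) v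
    set d := resolvForm H A lam z (φ - I • χ) (φ - I • χ) v
    have h1 : 4 * ‖resolvForm H A lam z φ χ v‖ ≤ ‖a‖ + ‖b‖ + ‖c‖ + ‖d‖ := by
      rw [norm_mul] at h
      have h4 : ‖(4 : ℂ)‖ = 4 := by norm_num
      rw [h4] at h
      rw [h]
      refine (norm_add_le _ _).trans (add_le_add ((norm_sub_le _ _).trans
        (add_le_add (norm_sub_le _ _) ?_)) ?_) <;> rw [norm_mul, norm_I, one_mul]
    have h2 : √(4 * ‖resolvForm H A lam z φ χ v‖) = 2 * √‖resolvForm H A lam z φ χ v‖ := by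
      rw [Real.sqrt_mul (by norm_num), show (4 : ℝ) = 2 ^ 2 by norm_num,
        Real.sqrt_sq (by norm_num)]
    have h3 := Real.sqrt_le_sqrt h1
    have h5 := hsq (‖a‖ + ‖b‖ + ‖c‖) ‖d‖ (by positivity) (by positivity)
    have h6 := hsq (‖a‖ + ‖b‖) ‖c‖ (by positivity) (by positivity)
    have h7 := hsq ‖a‖ ‖b‖ (by positivity) (by positivity)
    rw [h2] at h3
    linarith
  have hbd : ∀ c : ℂ, ‖c‖ = 1 → ∫⁻ v in Set.Icc (-W) W, F (φ + c • χ) v ≤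
      ENNReal.ofReal (8 * Real.pi * √(W / lam)) := fun c hc =>
    lintegral_sqrt_resolvForm_self_le hH hlam hz
      (fun x hx => by simp [hφ x hx, hχ x hx])
      (by simpa using sq_norm_add_le_four hφ1 hχ1 hc) hW
  have hb1 := hbd 1 (by simp)
  have hb2 := hbd (-1) (by simp)
  have hb3 := hbd I (by simp)
  have hb4 := hbd (-I) (by simp)
  rw [one_smul] at hb1
  rw [neg_smul, one_smul, ← sub_eq_add_neg] at hb2
  rw [neg_smul, ← sub_eq_add_neg] at hb4
  calc ∫⁻ v in Set.Icc (-W) W, ENNReal.ofReal √‖resolvForm H A lam z φ χ (v : ℂ)‖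
      ≤ ∫⁻ v in Set.Icc (-W) W, ENNReal.ofReal 2⁻¹ *
      (F (φ + χ) v + F (φ - χ) v + F (φ + I • χ) v + F (φ - I • χ) v) := lintegral_mono hpt
    _ = ENNReal.ofReal 2⁻¹ * ((∫⁻ v in Set.Icc (-W) W, F (φ + χ) v) +
        (∫⁻ v in Set.Icc (-W) W, F (φ - χ) v) + (∫⁻ v in Set.Icc (-W) W, F (φ + I • χ) v) +
        ∫⁻ v in Set.Icc (-W) W, F (φ - I • χ) v) := by
        rw [lintegral_const_mul' _ _ ENNReal.ofReal_ne_top, lintegral_add_right _ (hcont _),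
          lintegral_add_right _ (hcont _), lintegral_add_right _ (hcont _)]
    _ ≤ ENNReal.ofReal 2⁻¹ * (ENNReal.ofReal (8 * Real.pi * √(W / lam)) +
        ENNReal.ofReal (8 * Real.pi * √(W / lam)) + ENNReal.ofReal (8 * Real.pi * √(W / lam)) +
        ENNReal.ofReal (8 * Real.pi * √(W / lam))) := by gcongr
    _ = ENNReal.ofReal (16 * Real.pi * √(W / lam)) := by
        rw [← ENNReal.ofReal_add (by positivity) (by positivity),
          ← ENNReal.ofReal_add (by positivity) (by positivity),
          ← ENNReal.ofReal_add (by positivity) (by positivity), ← ENNReal.ofReal_mul (by norm_num)]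
        congr 1; ring

/-- Fractional-moment bound for the resolvent of `H + lam v N` applied to a vector in the range of
the projection `N`, uniformly in the spectral parameter. -/
lemma lintegral_sqrt_resolv_mulVec_le (hH : H.IsHermitian) {lam : ℝ} (hlam : 0 < lam) {z : ℂ}
    (hz : 0 < z.im) {s : X} (hs : s ∈ A) {χ : X → ℂ} (hχ : ∀ x ∉ A, χ x = 0)
    {W : ℝ} (hW : 0 < W) :
    ∫⁻ v in Set.Icc (-W) W,
      ENNReal.ofReal √‖(resolv (H + ((lam * v : ℝ) : ℂ) • coordProj A) z *ᵥ χ) s‖ ≤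
      ENNReal.ofReal (16 * Real.pi * √(W / lam)) * ENNReal.ofReal √(∑ x, ‖χ x‖) := by
  have hform : ∀ (ψ : X → ℂ) (v : ℝ), (resolv (H + ((lam * v : ℝ) : ℂ) • coordProj A) z *ᵥ ψ) s =
      resolvForm H A lam z (Pi.single s 1) ψ v := fun ψ v => by
    rw [resolvForm, ← Pi.single_star]; simp
  set b := ∑ x, ‖χ x‖ with hb
  have hb0 : 0 ≤ b := Finset.sum_nonneg fun _ _ => norm_nonneg _
  rcases hb0.eq_or_lt with h0 | hpos
  · have : χ = 0 := by
      funext x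
      have := (Finset.sum_eq_zero_iff_of_nonneg (fun _ _ => norm_nonneg _)).1 h0.symm x
        (Finset.mem_univ x)
      simpa using this
    simp [this]
  have hle : ∀ x, ‖χ x‖ ≤ b := fun x =>
    Finset.single_le_sum (f := fun x => ‖χ x‖) (fun _ _ => norm_nonneg _) (Finset.mem_univ x)
  -- Dividing by the `ℓ¹`-norm `b` gives a vector of `ℓ²`-norm at most 1, and homogeneity then
  -- produces the factor `√b`.
  have h := lintegral_sqrt_resolvForm_le (A := A) hH hlam hz (φ := Pi.single s 1)
    (χ := fun x => (b : ℂ)⁻¹ * χ x)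
    (fun x hx => Pi.single_eq_of_ne (by rintro rfl; exact hx hs) _)
    (fun x hx => by simp [hχ x hx])
    (by
      rw [Finset.sum_eq_single s]
      · simp
      · intro x _ hx; simp [hx]
      · simp)
    (by
      calc ∑ x, ‖(b : ℂ)⁻¹ * χ x‖ ^ 2 ≤ ∑ x, b⁻¹ * ‖χ x‖ := by
            refine Finset.sum_le_sum fun x _ => ?_
            rw [norm_mul, norm_inv, norm_real, Real.norm_of_nonneg hb0]
            have h1 : b⁻¹ * ‖χ x‖ ≤ 1 := by
              rw [inv_mul_le_iff₀ hpos]; simpa using hle x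
            have h2 : 0 ≤ b⁻¹ * ‖χ x‖ := by positivity
            nlinarith
        _ = 1 := by rw [← Finset.mul_sum, ← hb, inv_mul_cancel₀ hpos.ne']
        _ ≤ 1 := le_rfl) hW
  have hscale : ∀ v : ℝ, ENNReal.ofReal √‖(resolv (H + ((lam * v : ℝ) : ℂ) • coordProj A) z *ᵥ χ) s‖
      = ENNReal.ofReal √b * ENNReal.ofReal √‖resolvForm H A lam z (Pi.single s 1)
        (fun x => (b : ℂ)⁻¹ * χ x) (v : ℂ)‖ := fun v => by
    rw [← ENNReal.ofReal_mul (by positivity), ← Real.sqrt_mul hb0, hform]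
    congr 2
    have : (fun x => (b : ℂ)⁻¹ * χ x) = (b : ℂ)⁻¹ • χ := rfl
    rw [this]
    simp only [resolvForm, mulVec_smul, dotProduct_smul, smul_eq_mul, norm_mul, norm_inv,
      norm_real, Real.norm_of_nonneg hb0]
    field_simp
  simp only [hscale]
  rw [lintegral_const_mul' _ _ ENNReal.ofReal_ne_top, mul_comm]
  gcongr

/-- Averaging the imaginary part of a diagonal resolvent entry. -/
lemma lintegral_im_resolv_le (hH : H.IsHermitian) {lam : ℝ} (hlam : 0 < lam) {z : ℂ}
    (hz : 0 < z.im) {s : X} (hs : s ∈ A) {W : ℝ} (hW : 0 < W) :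
    ∫⁻ v in Set.Icc (-W) W,
      ENNReal.ofReal (resolv (H + ((lam * v : ℝ) : ℂ) • coordProj A) z s s).im ≤
      ENNReal.ofReal (2 * Real.pi / lam) := by
  have h := lintegral_im_resolvForm_le (A := A) hH hlam hz (φ := Pi.single s 1)
    (fun x hx => Pi.single_eq_of_ne (by rintro rfl; exact hx hs) _) hW
  have h1 : ∑ x, ‖(Pi.single s 1 : X → ℂ) x‖ ^ 2 = 1 := by
    rw [Finset.sum_eq_single s]
    · simp
    · intro x _ hx; simp [hx]
    · simp
  rw [h1, mul_one] at h
  refine le_trans (le_of_eq (lintegral_congr fun v => ?_)) h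
  rw [resolvForm, ← Pi.single_star]
  simp

end Resolvent

end HardCore

end

noncomputable section

namespace HardCore

/-! ### Eigenprojections as functions of the matrix -/

section Spectral

open Matrix Filter Topology

variable {X : Type} [Fintype X] [DecidableEq X] {H : Matrix X X ℂ}

/-- The matrix of the eigenprojection. -/
def eigMat (H : Matrix X X ℂ) (E : ℝ) : Matrix X X ℂ := Matrix.of (eigenprojectionEntry H E)

/-- The diagonal entries of the eigenprojection. -/
def eigWeight (H : Matrix X X ℂ) (E : ℝ) (x : X) : ℝ :=
  ‖eigenprojection H E (EuclideanSpace.single x (1 : ℂ))‖ ^ 2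

lemma eigenprojectionEntry_eq (H : Matrix X X ℂ) (E : ℝ) (x y : X) :
    eigenprojectionEntry H E x y = (eigenprojection H E (EuclideanSpace.single y (1 : ℂ))) x := by
  simp [eigenprojectionEntry, EuclideanSpace.inner_single_left]

lemma eigenprojectionEntry_eq_inner (H : Matrix X X ℂ) (E : ℝ) (x y : X) :
    eigenprojectionEntry H E x y = inner ℂ (eigenprojection H E (EuclideanSpace.single x (1 : ℂ)))
      (eigenprojection H E (EuclideanSpace.single y (1 : ℂ))) := by
  unfold eigenprojectionEntry eigenprojection
  rw [Submodule.inner_starProjection_left_eq_right]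
  congr 1
  exact (Submodule.starProjection_eq_self_iff.2 (Submodule.starProjection_apply_mem _ _)).symm

lemma eigenprojectionEntry_self (H : Matrix X X ℂ) (E : ℝ) (x : X) :
    eigenprojectionEntry H E x x = (eigWeight H E x : ℂ) := by
  rw [eigenprojectionEntry_eq_inner, inner_self_eq_norm_sq_to_K, eigWeight]
  simp

lemma eigWeight_nonneg (H : Matrix X X ℂ) (E : ℝ) (x : X) : 0 ≤ eigWeight H E x := by
  unfold eigWeight; positivity

lemma norm_eigenprojectionEntry_le (H : Matrix X X ℂ) (E : ℝ) (x y : X) :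
    ‖eigenprojectionEntry H E x y‖ ≤ √(eigWeight H E x) * √(eigWeight H E y) := by
  rw [eigenprojectionEntry_eq_inner, eigWeight, eigWeight, Real.sqrt_sq (norm_nonneg _),
    Real.sqrt_sq (norm_nonneg _)]
  exact norm_inner_le_norm _ _

lemma norm_eigenprojectionEntry_comm (H : Matrix X X ℂ) (E : ℝ) (x y : X) :
    ‖eigenprojectionEntry H E x y‖ = ‖eigenprojectionEntry H E y x‖ := by
  rw [eigenprojectionEntry_eq_inner, eigenprojectionEntry_eq_inner H E y x, norm_inner_symm]

lemma mul_eigMat (H : Matrix X X ℂ) (E : ℝ) : H * eigMat H E = (E : ℂ) • eigMat H E := by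
  ext x y
  have hmem : eigenprojection H E (EuclideanSpace.single y (1 : ℂ)) ∈
      Module.End.eigenspace (Matrix.toEuclideanLin H) (E : ℂ) :=
    Submodule.starProjection_apply_mem _ _
  have h1 := Module.End.mem_eigenspace_iff.1 hmem
  have h2 := congrArg (fun v : EuclideanSpace ℂ X => v x) h1
  simp only [Matrix.toLpLin_apply, PiLp.smul_apply, smul_eq_mul] at h2
  rw [Matrix.smul_apply, smul_eq_mul, eigMat, Matrix.of_apply, eigenprojectionEntry_eq, ← h2,
    Matrix.mul_apply]
  simp only [Matrix.of_apply, mulVec, dotProduct, eigenprojectionEntry_eq]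

/-- The spectrum as a finite set. -/
def specSet (H : Matrix X X ℂ) : Finset ℝ := spectrumIn H Set.univ

lemma mem_specSet {E : ℝ} : E ∈ specSet H ↔ E ∈ spectrum ℝ H := by
  simp [specSet, spectrumIn]

lemma mem_spectrumIn {E : ℝ} {I : Set ℝ} : E ∈ spectrumIn H I ↔ E ∈ specSet H ∧ E ∈ I := by
  simp [specSet, spectrumIn]

lemma eigenprojection_eigenvector (hH : H.IsHermitian) (E : ℝ) {μ : ℝ} {v : EuclideanSpace ℂ X}
    (hv : v ∈ Module.End.eigenspace (Matrix.toEuclideanLin H) (μ : ℂ)) :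
    eigenprojection H E v = if E = μ then v else 0 := by
  split_ifs with h
  · subst h
    exact Submodule.starProjection_eq_self_iff.2 hv
  · refine (Submodule.starProjection_apply_eq_zero_iff _).2 ?_
    rw [Submodule.mem_orthogonal]
    intro u hu
    have hsym : (Matrix.toEuclideanLin H).IsSymmetric := isSymmetric_toEuclideanLin_iff.2 hH
    have := hsym.orthogonalFamily_eigenspaces (i := (E : ℂ)) (j := (μ : ℂ))
      (by exact_mod_cast h) ⟨u, hu⟩ ⟨v, hv⟩
    simpa using this

lemma sum_eigenprojection (hH : H.IsHermitian) (v : EuclideanSpace ℂ X) :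
    ∑ E ∈ specSet H, eigenprojection H E v = v := by
  have hlin : (∑ E ∈ specSet H, (eigenprojection H E : EuclideanSpace ℂ X →ₗ[ℂ] EuclideanSpace ℂ X))
      = LinearMap.id := by
    refine hH.eigenvectorBasis.toBasis.ext fun i => ?_
    have hv : hH.eigenvectorBasis i ∈
        Module.End.eigenspace (Matrix.toEuclideanLin H) ((hH.eigenvalues i : ℝ) : ℂ) := by
      rw [Module.End.mem_eigenspace_iff, Matrix.toLpLin_apply, hH.mulVec_eigenvectorBasis]
      ext x
      simp
    simp only [OrthonormalBasis.coe_toBasis, LinearMap.sum_apply, ContinuousLinearMap.coe_coe,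
      LinearMap.id_apply, eigenprojection_eigenvector hH _ hv]
    rw [Finset.sum_ite_eq' , if_pos (mem_specSet.2 (hH.eigenvalues_mem_spectrum_real i))]
  have := congrArg (fun T => T v) hlin
  simpa using this

lemma sum_eigMat (hH : H.IsHermitian) : ∑ E ∈ specSet H, eigMat H E = 1 := by
  ext x y
  rw [Matrix.sum_apply]
  simp only [eigMat, Matrix.of_apply, eigenprojectionEntry_eq]
  have := congrArg (fun v : EuclideanSpace ℂ X => v x)
    (sum_eigenprojection hH (EuclideanSpace.single y (1 : ℂ)))
  simp only [WithLp.ofLp_sum, Finset.sum_apply] at this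
  rw [this]
  simp [Matrix.one_apply]

lemma sum_eigWeight (hH : H.IsHermitian) (x : X) : ∑ E ∈ specSet H, eigWeight H E x = 1 := by
  have h := congrFun (congrFun (sum_eigMat hH) x) x
  rw [Matrix.sum_apply] at h
  simp only [eigMat, Matrix.of_apply, eigenprojectionEntry_self, Matrix.one_apply_eq] at h
  exact_mod_cast h

/-- Functional calculus by hand: the proposed inverse is checked on each eigenprojection, and these
resolve the identity. It serves both the resolvent and `bump`. -/
lemma inv_eq_sum_eigMat (hH : H.IsHermitian) {M : Matrix X X ℂ} {f : ℝ → ℂ}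
    (hM : ∀ E, M * eigMat H E = f E • eigMat H E) (hf : ∀ E ∈ specSet H, f E ≠ 0) :
    M⁻¹ = ∑ E ∈ specSet H, (f E)⁻¹ • eigMat H E := by
  apply Matrix.inv_eq_right_inv
  rw [Finset.mul_sum, ← sum_eigMat hH]
  refine Finset.sum_congr rfl fun E hE => ?_
  rw [Matrix.mul_smul, hM, smul_smul, inv_mul_cancel₀ (hf E hE), one_smul]

lemma resolv_apply_eq_sum (hH : H.IsHermitian) {z : ℂ} (hz : z.im ≠ 0) (x y : X) :
    resolv H z x y = ∑ E ∈ specSet H, ((E : ℂ) - z)⁻¹ * eigenprojectionEntry H E x y := by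
  have h := inv_eq_sum_eigMat hH (M := H - z • (1 : Matrix X X ℂ)) (f := fun E => (E : ℂ) - z)
    (fun E => by
      rw [Matrix.sub_mul, mul_eigMat, Matrix.smul_mul, Matrix.one_mul, sub_smul])
    (fun E _ h => hz (by have := congrArg Complex.im h; simpa using this))
  rw [resolv, h, Matrix.sum_apply]
  simp [eigMat]

lemma pow_mul_eigMat (H : Matrix X X ℂ) (E c : ℝ) (k : ℕ) :
    (H - (c : ℂ) • (1 : Matrix X X ℂ)) ^ k * eigMat H E = ((E : ℂ) - c) ^ k • eigMat H E := by
  induction k with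
  | zero => simp
  | succ k ih =>
    rw [pow_succ, mul_assoc, Matrix.sub_mul, mul_eigMat, Matrix.smul_mul, Matrix.one_mul,
      ← sub_smul, Matrix.mul_smul, ih, smul_smul, pow_succ, mul_comm]

/-- The matrix `(1 + a (H - c)^(2k))⁻¹`. -/
def bump (H : Matrix X X ℂ) (a c : ℝ) (k : ℕ) : Matrix X X ℂ :=
  (1 + (a : ℂ) • (H - (c : ℂ) • (1 : Matrix X X ℂ)) ^ (2 * k))⁻¹

lemma bump_apply (hH : H.IsHermitian) {a : ℝ} (ha : 0 ≤ a) (c : ℝ) (k : ℕ) (x y : X) :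
    bump H a c k x y = ∑ E ∈ specSet H,
      (((1 + a * (E - c) ^ (2 * k))⁻¹ : ℝ) : ℂ) * eigenprojectionEntry H E x y := by
  have h := inv_eq_sum_eigMat hH
    (M := 1 + (a : ℂ) • (H - (c : ℂ) • (1 : Matrix X X ℂ)) ^ (2 * k))
    (f := fun E => ((1 + a * (E - c) ^ (2 * k) : ℝ) : ℂ))
    (fun E => by
      rw [Matrix.add_mul, Matrix.one_mul, Matrix.smul_mul, pow_mul_eigMat, smul_smul]
      push_cast
      rw [add_smul, one_smul])
    (fun E _ => by
      have h1 : 0 ≤ a * (E - c) ^ (2 * k) := mul_nonneg ha (by rw [pow_mul]; positivity)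
      have : (0 : ℝ) < 1 + a * (E - c) ^ (2 * k) := by linarith
      exact_mod_cast this.ne')
  rw [bump, h, Matrix.sum_apply]
  simp [eigMat]

/-! ### Measurable dependence of spectral data on the matrix -/

variable {Ω : Type*} [MeasurableSpace Ω]

lemma measurable_matrix_pow {M : Ω → Matrix X X ℂ} (hM : ∀ x y, Measurable fun w => M w x y)
    (k : ℕ) : ∀ x y, Measurable fun w => (M w ^ k) x y := by
  induction k with
  | zero => intro x y; simp
  | succ k ih =>
    intro x y
    simp only [pow_succ, Matrix.mul_apply]
    exact Finset.measurable_sum _ fun i _ => (ih x i).mul (hM i y)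

lemma measurable_bump {M : Ω → Matrix X X ℂ} (hM : ∀ x y, Measurable fun w => M w x y)
    (a : ℝ) {c : Ω → ℝ} (hc : Measurable c) (k : ℕ) (x y : X) :
    Measurable fun w => bump (M w) a (c w) k x y := by
  unfold bump
  refine measurable_inv_apply (fun i j => ?_) x y
  simp only [Matrix.add_apply, Matrix.smul_apply, smul_eq_mul]
  refine measurable_const.add (Measurable.const_mul (measurable_matrix_pow (fun i j => ?_) _ i j) _)
  simp only [Matrix.sub_apply, Matrix.smul_apply, smul_eq_mul]
  exact (hM i j).sub ((Complex.measurable_ofReal.comp hc).mul_const _)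

lemma eigenprojectionEntry_eq_zero (hH : H.IsHermitian) {E : ℝ} (hE : E ∉ specSet H) (x y : X) :
    eigenprojectionEntry H E x y = 0 := by
  have h := sum_eigenprojection hH (eigenprojection H E (EuclideanSpace.single y (1 : ℂ)))
  have hz : ∑ E' ∈ specSet H, eigenprojection H E' (eigenprojection H E
      (EuclideanSpace.single y (1 : ℂ))) = 0 := by
    refine Finset.sum_eq_zero fun E' hE' => ?_
    rw [eigenprojection_eigenvector (μ := E) hH E' (by
      unfold eigenprojection; exact Submodule.starProjection_apply_mem _ _), if_neg]
    rintro rfl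
    exact hE hE'
  rw [eigenprojectionEntry_eq, ← h, hz]
  rfl

/-- The functions `(1 + j (E' - E)²)⁻¹` decrease to the indicator of `E' = E`. The approximants are
rational in the matrix entries and in `E`, whence joint measurability without any measurable choice
of eigenvectors. -/
lemma tendsto_bump_eigenprojectionEntry (hH : H.IsHermitian) (E : ℝ) (x y : X) :
    Tendsto (fun j : ℕ => bump H (j : ℝ) E 1 x y) atTop
      (𝓝 (eigenprojectionEntry H E x y)) := by
  have h1 : ∀ E' : ℝ, Tendsto (fun j : ℕ => (((1 + (j : ℝ) * (E' - E) ^ (2 * 1))⁻¹ : ℝ) : ℂ)) atTop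
      (𝓝 (((if E' = E then 1 else 0 : ℝ) : ℝ) : ℂ)) := fun E' => by
    refine (Complex.continuous_ofReal.tendsto _).comp ?_
    split_ifs with h
    · simp [h]
    · have hpos : 0 < (E' - E) ^ (2 * 1) := by
        rw [pow_mul, pow_one]
        exact sq_pos_of_ne_zero (sub_ne_zero.2 h)
      refine tendsto_inv_atTop_zero.comp (tendsto_atTop_add_const_left _ _ ?_)
      exact tendsto_natCast_atTop_atTop.atTop_mul_const hpos
  have h2 := tendsto_finsetSum (specSet H)
    (fun E' _ => (h1 E').mul_const (eigenprojectionEntry H E' x y))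
  have h3 : ∑ E' ∈ specSet H, (((if E' = E then 1 else 0 : ℝ) : ℝ) : ℂ) *
      eigenprojectionEntry H E' x y = eigenprojectionEntry H E x y := by
    by_cases hE : E ∈ specSet H
    · rw [Finset.sum_eq_single E]
      · simp
      · intro E' _ hne; simp [hne]
      · exact fun h => absurd hE h
    · rw [eigenprojectionEntry_eq_zero hH hE]
      refine Finset.sum_eq_zero fun E' hE' => ?_
      have : E' ≠ E := by rintro rfl; exact hE hE'
      simp [this]
  rw [h3] at h2
  refine h2.congr fun j => ?_
  rw [bump_apply hH (Nat.cast_nonneg j)]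

lemma measurable_eigenprojectionEntry {M : Ω → Matrix X X ℂ}
    (hM : ∀ x y, Measurable fun w => M w x y) (hH : ∀ w, (M w).IsHermitian) (x y : X) :
    Measurable fun q : Ω × ℝ => eigenprojectionEntry (M q.1) q.2 x y :=
  measurable_of_tendsto_metrizable
    (fun j : ℕ => measurable_bump (M := fun q : Ω × ℝ => M q.1)
      (fun x y => (hM x y).comp measurable_fst) (j : ℝ) measurable_snd 1 x y)
    (tendsto_pi_nhds.2 fun q => tendsto_bump_eigenprojectionEntry (hH q.1) q.2 x y)

/-- The spectral measure of `H` at the basis vector `x`. -/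
def specMeasure (H : Matrix X X ℂ) (x : X) : Measure ℝ :=
  ∑ E ∈ specSet H, ENNReal.ofReal (eigWeight H E x) • Measure.dirac E

lemma lintegral_specMeasure (H : Matrix X X ℂ) (x : X) (F : ℝ → ENNReal) :
    ∫⁻ E, F E ∂specMeasure H x = ∑ E ∈ specSet H, ENNReal.ofReal (eigWeight H E x) * F E := by
  simp [specMeasure, lintegral_smul_measure, lintegral_dirac]

lemma specMeasure_univ (hH : H.IsHermitian) (x : X) : specMeasure H x Set.univ = 1 := by
  rw [← lintegral_one, lintegral_specMeasure]
  simp only [mul_one]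
  rw [← ENNReal.ofReal_sum_of_nonneg fun E _ => eigWeight_nonneg H E x, sum_eigWeight hH,
    ENNReal.ofReal_one]

lemma specMeasure_apply (H : Matrix X X ℂ) (x : X) {B : Set ℝ} (hB : MeasurableSet B) :
    specMeasure H x B =
      ENNReal.ofReal (∑ E ∈ specSet H, B.indicator (fun _ => 1) E * eigWeight H E x) := by
  rw [← lintegral_indicator_one hB, lintegral_specMeasure, ENNReal.ofReal_sum_of_nonneg]
  · refine Finset.sum_congr rfl fun E _ => ?_
    by_cases h : E ∈ B <;> simp [h]
  · intro E _
    exact mul_nonneg (Set.indicator_nonneg (fun _ _ => zero_le_one) _) (eigWeight_nonneg _ _ _)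

/-- With `q = ((E - c) / r)²` the approximant is `(1 + p q^p)⁻¹`. The factor `p` sends it to 0 also
at `q = 1`, so the limit is exactly the indicator of the open interval. -/
lemma tendsto_bump_Ioo (hH : H.IsHermitian) {c r : ℝ} (hr : 0 < r) (x : X) :
    Tendsto (fun p : ℕ => (bump H (p * r⁻¹ ^ (2 * p)) c p x x).re) atTop
      (𝓝 (∑ E ∈ specSet H, (Set.Ioo (c - r) (c + r)).indicator (fun _ => 1) E *
        eigWeight H E x)) := by
  have h1 : ∀ E : ℝ, Tendsto (fun p : ℕ => (1 + (p * r⁻¹ ^ (2 * p)) * (E - c) ^ (2 * p))⁻¹) atTop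
      (𝓝 ((Set.Ioo (c - r) (c + r)).indicator (fun _ => (1 : ℝ)) E)) := fun E => by
    set q := ((E - c) / r) ^ 2 with hq
    have hq0 : 0 ≤ q := by positivity
    have he : ∀ p : ℕ, ((p : ℝ) * r⁻¹ ^ (2 * p)) * (E - c) ^ (2 * p) = p * q ^ p := fun p => by
      rw [hq, mul_assoc, ← mul_pow, ← pow_mul]; congr 2; field_simp
    simp only [he]
    by_cases h : E ∈ Set.Ioo (c - r) (c + r)
    · rw [Set.indicator_of_mem h]
      have hlt : q < 1 := by
        rw [hq, sq_lt_one_iff_abs_lt_one, abs_div, abs_of_pos hr, div_lt_one hr, abs_lt]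
        exact ⟨by linarith [h.1], by linarith [h.2]⟩
      have h3 := tendsto_self_mul_const_pow_of_lt_one hq0 hlt
      have := (h3.const_add 1).inv₀ (by norm_num)
      simpa using this
    · rw [Set.indicator_of_notMem h]
      have hge : 1 ≤ q := by
        rw [hq, one_le_sq_iff_one_le_abs, abs_div, abs_of_pos hr, one_le_div hr, le_abs]
        by_contra! hcon
        exact h ⟨by linarith [hcon.2], by linarith [hcon.1]⟩
      refine tendsto_inv_atTop_zero.comp (tendsto_atTop_add_const_left _ _ ?_)
      refine tendsto_atTop_mono (fun p => ?_) tendsto_natCast_atTop_atTop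
      exact le_mul_of_one_le_right (Nat.cast_nonneg p) (one_le_pow₀ hge)
  have h2 := tendsto_finsetSum (specSet H)
    (fun E _ => (h1 E).mul_const (eigWeight H E x))
  refine h2.congr fun p => ?_
  rw [bump_apply hH (by positivity), Complex.re_sum]
  refine Finset.sum_congr rfl fun E _ => ?_
  rw [eigenprojectionEntry_self, ← Complex.ofReal_mul, Complex.ofReal_re]

lemma measurable_specMeasure {M : Ω → Matrix X X ℂ}
    (hM : ∀ x y, Measurable fun w => M w x y) (hH : ∀ w, (M w).IsHermitian) (x : X) :
    Measurable fun w => specMeasure (M w) x := by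
  have : ∀ w, IsProbabilityMeasure (specMeasure (M w) x) := fun w =>
    ⟨specMeasure_univ (hH w) x⟩
  refine Measurable.measure_of_isPiSystem_of_isProbabilityMeasure
    (BorelSpace.measurable_eq.trans Real.borel_eq_generateFrom_Ioo_rat) Real.isPiSystem_Ioo_rat ?_
  intro s hs
  simp only [Set.mem_iUnion, Set.mem_singleton_iff] at hs
  obtain ⟨a, b, hab, rfl⟩ := hs
  have hr : (0 : ℝ) < ((b : ℝ) - a) / 2 := by
    have : (a : ℝ) < b := by exact_mod_cast hab
    linarith
  have he : Set.Ioo (a : ℝ) b = Set.Ioo (((a : ℝ) + b) / 2 - ((b : ℝ) - a) / 2)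
      (((a : ℝ) + b) / 2 + ((b : ℝ) - a) / 2) := by congr 1 <;> ring
  rw [he]
  simp only [specMeasure_apply _ _ measurableSet_Ioo]
  refine ENNReal.measurable_ofReal.comp (measurable_of_tendsto_metrizable
    (fun p : ℕ => Complex.measurable_re.comp (measurable_bump hM _ measurable_const p x x))
    (tendsto_pi_nhds.2 fun w => tendsto_bump_Ioo (hH w) hr x))

/-- The spectral measures form a kernel. -/
def specKernel {M : Ω → Matrix X X ℂ}
    (hM : ∀ x y, Measurable fun w => M w x y) (hH : ∀ w, (M w).IsHermitian) (x : X) :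
    Kernel Ω ℝ := ⟨fun w => specMeasure (M w) x, measurable_specMeasure hM hH x⟩

instance {M : Ω → Matrix X X ℂ} (hM : ∀ x y, Measurable fun w => M w x y)
    (hH : ∀ w, (M w).IsHermitian) (x : X) : IsMarkovKernel (specKernel hM hH x) :=
  ⟨fun w => ⟨specMeasure_univ (hH w) x⟩⟩

lemma measurable_lintegral_specMeasure {M : Ω → Matrix X X ℂ}
    (hM : ∀ x y, Measurable fun w => M w x y) (hH : ∀ w, (M w).IsHermitian) (x : X)
    {F : Ω → ℝ → ENNReal} (hF : Measurable (Function.uncurry F)) :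
    Measurable fun w => ∫⁻ E, F w E ∂specMeasure (M w) x :=
  Measurable.lintegral_kernel_prod_right (κ := specKernel hM hH x) hF

/-- The eigenfunction correlator `∑_{E ∈ σ(H) ∩ I} |⟨δ_x, P_{E} δ_y⟩|`. -/
def correlator (H : Matrix X X ℂ) (I : Set ℝ) (x y : X) : ℝ :=
  ∑ E ∈ spectrumIn H I, ‖eigenprojectionEntry H E x y‖

lemma correlator_nonneg (H : Matrix X X ℂ) (I : Set ℝ) (x y : X) : 0 ≤ correlator H I x y :=
  Finset.sum_nonneg fun _ _ => norm_nonneg _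

lemma correlator_comm (H : Matrix X X ℂ) (I : Set ℝ) (x y : X) :
    correlator H I x y = correlator H I y x :=
  Finset.sum_congr rfl fun _ _ => norm_eigenprojectionEntry_comm _ _ _ _

lemma correlator_le_one (hH : H.IsHermitian) (I : Set ℝ) (x y : X) : correlator H I x y ≤ 1 := by
  calc correlator H I x y ≤ ∑ E ∈ specSet H, ‖eigenprojectionEntry H E x y‖ :=
        Finset.sum_le_sum_of_subset_of_nonneg (fun E hE => (mem_spectrumIn.1 hE).1)
          fun _ _ _ => norm_nonneg _
    _ ≤ ∑ E ∈ specSet H, (eigWeight H E x + eigWeight H E y) / 2 := by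
        refine Finset.sum_le_sum fun E _ => (norm_eigenprojectionEntry_le H E x y).trans ?_
        nlinarith [sq_nonneg (√(eigWeight H E x) - √(eigWeight H E y)),
          Real.sq_sqrt (eigWeight_nonneg H E x), Real.sq_sqrt (eigWeight_nonneg H E y)]
    _ = 1 := by
        rw [← Finset.sum_div, Finset.sum_add_distrib, sum_eigWeight hH, sum_eigWeight hH]
        norm_num

/-- A sum over a spectrum that moves with the matrix is rewritten as the integral of a jointly
measurable function against a kernel, which makes its measurability accessible. -/
lemma ofReal_correlator (H : Matrix X X ℂ) (I : Set ℝ) (x y : X) :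
    ENNReal.ofReal (correlator H I x y) = ∫⁻ E, I.indicator (fun E => ENNReal.ofReal
      (‖eigenprojectionEntry H E x y‖ / ‖eigenprojectionEntry H E x x‖)) E ∂specMeasure H x := by
  classical
  rw [lintegral_specMeasure, correlator,
    ENNReal.ofReal_sum_of_nonneg fun _ _ => norm_nonneg _]
  have : spectrumIn H I = (specSet H).filter (· ∈ I) := by
    ext E; rw [mem_spectrumIn, Finset.mem_filter]
  rw [this, Finset.sum_filter]
  refine Finset.sum_congr rfl fun E _ => ?_
  by_cases hE : E ∈ I
  · rw [if_pos hE, Set.indicator_of_mem hE, ← ENNReal.ofReal_mul (eigWeight_nonneg _ _ _),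
      eigenprojectionEntry_self, Complex.norm_real, Real.norm_of_nonneg (eigWeight_nonneg _ _ _)]
    congr 1
    -- At weight zero the quotient carries no information, but Cauchy–Schwarz makes the entry vanish
    -- as well.
    rcases (eigWeight_nonneg H E x).eq_or_lt with h | h
    · have := norm_eigenprojectionEntry_le H E x y
      rw [← h, Real.sqrt_zero, zero_mul] at this
      rw [← h, zero_mul]
      exact le_antisymm this (norm_nonneg _)
    · field_simp
  · rw [if_neg hE, Set.indicator_of_notMem hE, mul_zero]

lemma measurable_correlator {M : Ω → Matrix X X ℂ}
    (hM : ∀ x y, Measurable fun w => M w x y) (hH : ∀ w, (M w).IsHermitian)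
    {I : Set ℝ} (hI : MeasurableSet I) (x y : X) :
    Measurable fun w => correlator (M w) I x y := by
  have h : Measurable fun w => ENNReal.ofReal (correlator (M w) I x y) := by
    simp only [ofReal_correlator]
    refine measurable_lintegral_specMeasure hM hH x
      (F := fun w => I.indicator (fun E => ENNReal.ofReal
        (‖eigenprojectionEntry (M w) E x y‖ / ‖eigenprojectionEntry (M w) E x x‖))) ?_
    have h1 : Measurable fun q : Ω × ℝ => ENNReal.ofReal
        (‖eigenprojectionEntry (M q.1) q.2 x y‖ / ‖eigenprojectionEntry (M q.1) q.2 x x‖) :=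
      ENNReal.measurable_ofReal.comp ((measurable_eigenprojectionEntry hM hH x y).norm.div
        (measurable_eigenprojectionEntry hM hH x x).norm)
    exact h1.indicator (measurable_snd hI)
  have h2 := h.ennreal_toReal
  simpa only [ENNReal.toReal_ofReal (correlator_nonneg _ _ _ _)] using h2

end Spectral

/-! ### Spectral averaging -/

section SpectralAveraging

open Matrix

variable {X : Type} [Fintype X] [DecidableEq X] {H : Matrix X X ℂ} {A : Finset X}

/-- The Poisson kernel `η / ((E - c)² + η²)` is at least `1 / (2η)` on the interval. -/
lemma specMeasure_Icc_le (hH : H.IsHermitian) (x : X) (c : ℝ) {η : ℝ} (hη : 0 < η) :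
    specMeasure H x (Set.Icc (c - η) (c + η)) ≤
      ENNReal.ofReal (2 * η) * ENNReal.ofReal (resolv H (c + η * Complex.I) x x).im := by
  rw [specMeasure_apply _ _ measurableSet_Icc, ← ENNReal.ofReal_mul (by positivity)]
  refine ENNReal.ofReal_le_ofReal ?_
  rw [resolv_apply_eq_sum hH (by simpa using hη.ne'), Complex.im_sum, Finset.mul_sum]
  refine Finset.sum_le_sum fun E _ => ?_
  rw [eigenprojectionEntry_self, Complex.im_mul_ofReal, ← mul_assoc]
  refine mul_le_mul_of_nonneg_right ?_ (eigWeight_nonneg _ _ _)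
  have him : (((E : ℂ) - (c + η * Complex.I))⁻¹).im = η / ((E - c) ^ 2 + η ^ 2) := by
    rw [Complex.inv_im]
    simp [Complex.normSq_apply]
    ring
  rw [him]
  by_cases h : E ∈ Set.Icc (c - η) (c + η)
  · rw [Set.indicator_of_mem h, mul_div, le_div_iff₀ (by positivity)]
    nlinarith [h.1, h.2]
  · rw [Set.indicator_of_notMem h]
    positivity

/-- Lebesgue outer measure is the largest one dominated by the length function on covering
intervals, so comparison on intervals gives comparison on all sets. -/
lemma measure_le_of_Icc {m : Measure ℝ} {C : NNReal} (hC : C ≠ 0)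
    (h : ∀ c η : ℝ, 0 < η → m (Set.Icc (c - η) (c + η)) ≤ C * ENNReal.ofReal (2 * η)) :
    m ≤ C • (volume : Measure ℝ) := by
  have h1 : (C⁻¹ • m).toOuterMeasure ≤ (StieltjesFunction.id : StieltjesFunction ℝ).outer := by
    refine OuterMeasure.le_ofFunction.2 fun s => ?_
    rw [StieltjesFunction.length_eq]
    refine le_iInf fun a => le_iInf fun b => le_iInf fun hs => ?_
    simp only [botSet, not_isBot, Set.ofPred_false, Set.sdiff_empty] at hs
    have h2 : m s ≤ C * ENNReal.ofReal (b - a) := by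
      rcases lt_or_ge a b with hab | hab
      · have := h ((a + b) / 2) ((b - a) / 2) (by linarith)
        rw [show (a + b) / 2 - (b - a) / 2 = a by ring,
          show (a + b) / 2 + (b - a) / 2 = b by ring,
          show 2 * ((b - a) / 2) = b - a by ring] at this
        exact (measure_mono (hs.trans Set.Ioc_subset_Icc_self)).trans this
      · rw [Set.Ioc_eq_empty (not_lt.2 hab), Set.subset_empty_iff] at hs
        simp [hs]
    change (C⁻¹ • m) s ≤ ENNReal.ofReal (b - a)
    rw [Measure.smul_apply, ENNReal.smul_def, smul_eq_mul, ENNReal.coe_inv hC]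
    calc (C : ENNReal)⁻¹ * m s ≤ (C : ENNReal)⁻¹ * (C * ENNReal.ofReal (b - a)) := by gcongr
      _ = ENNReal.ofReal (b - a) := by
        rw [← mul_assoc, ENNReal.inv_mul_cancel (by exact_mod_cast hC) ENNReal.coe_ne_top, one_mul]
  refine Measure.le_iff'.2 fun s => ?_
  have h3 : (C⁻¹ • m) s ≤ volume s := by
    rw [Real.volume_eq_stieltjes_id, StieltjesFunction.measure_def]
    exact h1 s
  rw [Measure.smul_apply, ENNReal.smul_def, smul_eq_mul, ENNReal.coe_inv hC] at h3
  rw [Measure.smul_apply, ENNReal.smul_def, smul_eq_mul]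
  calc m s = (C : ENNReal) * ((C : ENNReal)⁻¹ * m s) := by
        rw [← mul_assoc, ENNReal.mul_inv_cancel (by exact_mod_cast hC) ENNReal.coe_ne_top, one_mul]
    _ ≤ C * volume s := by gcongr

lemma isHermitian_coordProj {X : Type} [DecidableEq X] (A : Finset X) : (coordProj A).IsHermitian :=
  Matrix.isHermitian_diagonal_of_self_adjoint _ (by
    rw [isSelfAdjoint_iff]; ext x; simp [apply_ite])

lemma isHermitian_add_coordProj {X : Type} [DecidableEq X] {H : Matrix X X ℂ}
    (hH : H.IsHermitian) (A : Finset X) (c : ℝ) :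
    (H + (c : ℂ) • coordProj A).IsHermitian := by
  refine hH.add ?_
  rw [Matrix.IsHermitian, Matrix.conjTranspose_smul, (isHermitian_coordProj A).eq]
  simp

lemma measurable_add_coordProj {X : Type} [DecidableEq X] (H : Matrix X X ℂ) (A : Finset X) (lam : ℝ) (x y : X) :
    Measurable fun v : ℝ => (H + ((lam * v : ℝ) : ℂ) • coordProj A) x y := by
  simp only [Matrix.add_apply, Matrix.smul_apply, smul_eq_mul]
  fun_prop

/-- Spectral averaging over the coupling `v` of a coordinate projection. -/
lemma lintegral_specMeasure_averaging (hH : H.IsHermitian) {lam : ℝ} (hlam : 0 < lam) {s : X}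
    (hs : s ∈ A) {W : ℝ} (hW : 0 < W) {F : ℝ → ENNReal} (hF : Measurable F) :
    ∫⁻ v in Set.Icc (-W) W, ∫⁻ E, F E ∂specMeasure (H + ((lam * v : ℝ) : ℂ) • coordProj A) s ≤
      ENNReal.ofReal (2 * Real.pi / lam) * ∫⁻ E, F E := by
  have hmeas : Measurable fun v : ℝ => specMeasure (H + ((lam * v : ℝ) : ℂ) • coordProj A) s :=
    measurable_specMeasure (measurable_add_coordProj H A lam)
      (fun v => isHermitian_add_coordProj hH A _) s
  set m : Measure ℝ := (volume.restrict (Set.Icc (-W) W)).bind fun v =>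
    specMeasure (H + ((lam * v : ℝ) : ℂ) • coordProj A) s with hm
  have hC : 0 < 2 * Real.pi / lam := by positivity
  have hle : m ≤ (2 * Real.pi / lam).toNNReal • (volume : Measure ℝ) := by
    refine measure_le_of_Icc (Real.toNNReal_pos.2 hC).ne' fun c η hη => ?_
    rw [hm, Measure.bind_apply measurableSet_Icc hmeas.aemeasurable]
    calc ∫⁻ v in Set.Icc (-W) W, specMeasure (H + ((lam * v : ℝ) : ℂ) • coordProj A) s
          (Set.Icc (c - η) (c + η))
        ≤ ∫⁻ v in Set.Icc (-W) W, ENNReal.ofReal (2 * η) * ENNReal.ofReal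
          (resolv (H + ((lam * v : ℝ) : ℂ) • coordProj A) (c + η * Complex.I) s s).im :=
          lintegral_mono fun v => specMeasure_Icc_le (isHermitian_add_coordProj hH A _) s c hη
      _ = ENNReal.ofReal (2 * η) * ∫⁻ v in Set.Icc (-W) W, ENNReal.ofReal
          (resolv (H + ((lam * v : ℝ) : ℂ) • coordProj A) (c + η * Complex.I) s s).im :=
          lintegral_const_mul' _ _ ENNReal.ofReal_ne_top
      _ ≤ ENNReal.ofReal (2 * η) * ENNReal.ofReal (2 * Real.pi / lam) := by
          gcongr
          exact lintegral_im_resolv_le hH hlam (by simpa using hη) hs hW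
      _ = _ := by rw [mul_comm]; rfl
  calc ∫⁻ v in Set.Icc (-W) W, ∫⁻ E, F E ∂specMeasure (H + ((lam * v : ℝ) : ℂ) • coordProj A) s
      = ∫⁻ E, F E ∂m := by
        rw [hm, Measure.lintegral_bind hmeas.aemeasurable hF.aemeasurable]
    _ ≤ ∫⁻ E, F E ∂((2 * Real.pi / lam).toNNReal • (volume : Measure ℝ)) :=
        lintegral_mono' hle le_rfl
    _ = _ := by rw [lintegral_smul_measure]; rfl

end SpectralAveraging

end HardCore

end

noncomputable section

namespace HardCore

/-! ### The Hamiltonian, its cut versions and the local energy estimate -/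

section Model

open Matrix

variable {Λ : Finset ℤ} {m : ℕ}

/-- The diagonal part of the Hamiltonian. -/
def diagEnergy (g lam : ℝ) (ω : Λ → ℝ) {n : ℕ} (x : Config Λ n) : ℝ :=
  2 * g * x.clusterCount + lam * ∑ j, ω (x.pos j)

lemma hamiltonian_apply {n : ℕ} (g lam : ℝ) (ω : Λ → ℝ) (x y : Config Λ n) :
    hamiltonian n g lam ω x y = if x = y then (diagEnergy g lam ω x : ℂ)
      else if y ∈ x.nbrs then -1 else 0 := by
  unfold hamiltonian interaction potential adjacency
  simp only [Matrix.add_apply, Matrix.neg_apply, Matrix.smul_apply, Matrix.of_apply, smul_eq_mul,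
    Config.mem_nbrs]
  rcases eq_or_ne x y with rfl | h
  · simp [diagEnergy, Config.l1Dist_self]
  · simp only [Matrix.diagonal_apply_ne _ h, if_neg h]
    split_ifs <;> simp

lemma hamiltonian_symm {n : ℕ} (g lam : ℝ) (ω : Λ → ℝ) (x y : Config Λ n) :
    hamiltonian n g lam ω x y = hamiltonian n g lam ω y x := by
  rcases eq_or_ne x y with rfl | h
  · rfl
  · rw [hamiltonian_apply, hamiltonian_apply, if_neg h, if_neg h.symm]
    simp only [Config.mem_nbrs_comm (x := x)]

lemma hamiltonian_conj {n : ℕ} (g lam : ℝ) (ω : Λ → ℝ) (x y : Config Λ n) :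
    star (hamiltonian n g lam ω x y) = hamiltonian n g lam ω x y := by
  rw [hamiltonian_apply]
  split_ifs <;> simp

lemma hamiltonian_isHermitian (n : ℕ) (g lam : ℝ) (ω : Λ → ℝ) :
    (hamiltonian n g lam ω).IsHermitian := by
  ext x y
  rw [Matrix.conjTranspose_apply, hamiltonian_conj, hamiltonian_symm]

lemma hamiltonian_mulVec {n : ℕ} (g lam : ℝ) (ω : Λ → ℝ) (f : Config Λ n → ℂ) (x : Config Λ n) :
    (hamiltonian n g lam ω *ᵥ f) x = diagEnergy g lam ω x * f x - ∑ y ∈ x.nbrs, f y := by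
  have hx : x ∉ x.nbrs := by simp [Config.mem_nbrs, Config.l1Dist_self]
  have h : ∀ y, hamiltonian n g lam ω x y * f y =
      (if x = y then (diagEnergy g lam ω x : ℂ) * f y else 0) +
        (if y ∈ x.nbrs then -f y else 0) := fun y => by
    rw [hamiltonian_apply]
    rcases eq_or_ne x y with rfl | hne
    · simp [hx]
    · simp [hne]
  simp only [mulVec, dotProduct, h, Finset.sum_add_distrib]
  rw [Finset.sum_ite_eq, if_pos (Finset.mem_univ x), ← Finset.sum_filter]
  simp [Finset.sum_neg_distrib, sub_eq_add_neg]

/-- The Hamiltonian restricted to configurations all of whose particles lie to the right of `β`. -/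
def cutHamiltonian (m : ℕ) (g lam : ℝ) (ω : Λ → ℝ) (β : ℤ) :
    Matrix (Config Λ (m + 1)) (Config Λ (m + 1)) ℂ :=
  Matrix.of fun x y => if β < x.left ∧ β < y.left then hamiltonian (m + 1) g lam ω x y else 0

lemma cutHamiltonian_symm (g lam : ℝ) (ω : Λ → ℝ) (β : ℤ) (x y : Config Λ (m + 1)) :
    cutHamiltonian m g lam ω β x y = cutHamiltonian m g lam ω β y x := by
  simp only [cutHamiltonian, Matrix.of_apply, hamiltonian_symm g lam ω x y, and_comm]

lemma cutHamiltonian_isHermitian (g lam : ℝ) (ω : Λ → ℝ) (β : ℤ) :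
    (cutHamiltonian m g lam ω β).IsHermitian := by
  ext x y
  rw [Matrix.conjTranspose_apply, cutHamiltonian_symm]
  simp only [cutHamiltonian, Matrix.of_apply]
  split_ifs
  · exact hamiltonian_conj _ _ _ _ _
  · simp

lemma cutHamiltonian_eq {g lam : ℝ} {ω : Λ → ℝ} {β : ℤ} (hβ : ∀ u ∈ Λ, β < u) :
    cutHamiltonian m g lam ω β = hamiltonian (m + 1) g lam ω := by
  ext x y
  simp only [cutHamiltonian, Matrix.of_apply]
  exact if_pos ⟨hβ _ (x.pos 0).2, hβ _ (y.pos 0).2⟩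

lemma cutHamiltonian_mulVec (g lam : ℝ) (ω : Λ → ℝ) {β : ℤ} {f : Config Λ (m + 1) → ℂ}
    (hf : ∀ x, x.left ≤ β → f x = 0) (x : Config Λ (m + 1)) :
    (cutHamiltonian m g lam ω β *ᵥ f) x =
      if β < x.left then diagEnergy g lam ω x * f x - ∑ y ∈ x.nbrs, f y else 0 := by
  rw [← hamiltonian_mulVec]
  simp only [mulVec, dotProduct, cutHamiltonian, Matrix.of_apply]
  split_ifs with h
  · refine Finset.sum_congr rfl fun y _ => ?_
    by_cases hy : β < y.left
    · simp [h, hy]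
    · simp [hf y (not_lt.1 hy)]
  · simp [h]

lemma resolv_symm {X : Type*} [Fintype X] [DecidableEq X] {H : Matrix X X ℂ}
    (hH : ∀ x y, H x y = H y x) (z : ℂ) (x y : X) : resolv H z x y = resolv H z y x := by
  have hT : Hᵀ = H := by ext a b; exact hH b a
  have : (resolv H z)ᵀ = resolv H z := by
    rw [resolv, Matrix.transpose_nonsing_inv]
    simp [hT]
  calc resolv H z x y = (resolv H z)ᵀ y x := rfl
    _ = _ := by rw [this]

lemma measurable_cutHamiltonian (g lam : ℝ) (β : ℤ) (x y : Config Λ (m + 1)) :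
    Measurable fun ω : Λ → ℝ => cutHamiltonian m g lam ω β x y := by
  simp only [cutHamiltonian, Matrix.of_apply, hamiltonian_apply, diagEnergy]
  split_ifs
  · refine Complex.measurable_ofReal.comp (measurable_const.add (Measurable.const_mul ?_ _))
    exact Finset.measurable_sum _ fun j _ => measurable_pi_apply _
  all_goals exact measurable_const

/-- Configurations right of `β` occupying the site `α`. -/
def occupied (m : ℕ) (β : ℤ) (α : Λ) : Finset (Config Λ (m + 1)) :=
  Finset.univ.filter fun x => β < x.left ∧ ∃ j, x.pos j = α

lemma sum_update (ω : Λ → ℝ) (α : Λ) (v : ℝ) (x : Config Λ (m + 1)) :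
    ∑ j, Function.update ω α v (x.pos j) = ∑ j, Function.update ω α 0 (x.pos j) +
      v * (if ∃ j, x.pos j = α then 1 else 0) := by
  by_cases h : ∃ j, x.pos j = α
  · obtain ⟨j, hj⟩ := h
    rw [if_pos ⟨j, hj⟩, ← Finset.add_sum_erase _ _ (Finset.mem_univ j),
      ← Finset.add_sum_erase _ (fun j => Function.update ω α 0 (x.pos j)) (Finset.mem_univ j)]
    have : ∀ i ∈ Finset.univ.erase j, Function.update ω α v (x.pos i) =
        Function.update ω α 0 (x.pos i) := fun i hi => by
      have hne : x.pos i ≠ α := by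
        intro h
        exact (Finset.ne_of_mem_erase hi) (x.pos_injective (by rw [h, hj]))
      rw [Function.update_of_ne hne, Function.update_of_ne hne]
    rw [Finset.sum_congr rfl this, hj]
    simp
    ring
  · rw [if_neg h, mul_zero, add_zero]
    refine Finset.sum_congr rfl fun i _ => ?_
    have hne : x.pos i ≠ α := fun h' => h ⟨i, h'⟩
    rw [Function.update_of_ne hne, Function.update_of_ne hne]

/-- By the hard-core condition a site is occupied at most once, so `ω α` enters through a coordinate
projection. This is the form required by the averaging estimates. -/
lemma cutHamiltonian_update (g lam : ℝ) (ω : Λ → ℝ) (β : ℤ) (α : Λ) (v : ℝ) :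
    cutHamiltonian m g lam (Function.update ω α v) β =
      cutHamiltonian m g lam (Function.update ω α 0) β +
        ((lam * v : ℝ) : ℂ) • coordProj (occupied m β α) := by
  ext x y
  simp only [cutHamiltonian, Matrix.of_apply, Matrix.add_apply, Matrix.smul_apply,
    hamiltonian_apply, coordProj, smul_eq_mul]
  rcases eq_or_ne x y with rfl | h
  · simp only [Matrix.diagonal_apply_eq, diagEnergy, sum_update ω α v x, and_self, if_true]
    by_cases hβ : β < x.left
    · by_cases hex : ∃ j, x.pos j = α
      · simp only [hβ, if_true, hex, occupied, Finset.mem_filter, Finset.mem_univ, and_self]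
        push_cast; ring
      · simp [hβ, hex, occupied]
    · simp [hβ, occupied]
  · simp [h]

/-- All particles of the cut system lie strictly right of `β`, so disorder at or left of `β` is
never sampled. The independence used in the recursion rests on this. -/
lemma cutHamiltonian_update_of_le (g lam : ℝ) (ω : Λ → ℝ) {β : ℤ} {α : Λ} (hα : (α : ℤ) ≤ β)
    (v : ℝ) : cutHamiltonian m g lam (Function.update ω α v) β = cutHamiltonian m g lam ω β := by
  ext x y
  simp only [cutHamiltonian, Matrix.of_apply, hamiltonian_apply, diagEnergy]
  split_ifs with h1
  · have : ∀ j, Function.update ω α v (x.pos j) = ω (x.pos j) := fun j => by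
      refine Function.update_of_ne ?_ _ _
      intro hj
      have h2 := x.left_le_pos j
      rw [hj] at h2
      have := h1.1
      omega
    simp [this]
  all_goals rfl

/-- The parameters of the model together with an energy bound `b` below the threshold. -/
structure Params where
  g : ℝ
  ν : ℝ
  b : ℝ
  hg : 1 < g
  hν : 0 < ν
  hb0 : 0 ≤ b
  hb : b < energyThreshold g ν

/-- The hopping ratio. -/
def Params.r (p : Params) : ℝ := 1 / (2 * p.g - p.b / 2)

lemma Params.gap_pos (p : Params) : 6 * Real.exp p.ν < 2 * p.g - p.b / 2 := by
  have := p.hb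
  unfold energyThreshold at this
  linarith

lemma Params.gap_pos' (p : Params) : 0 < 2 * p.g - p.b / 2 :=
  lt_trans (by positivity) p.gap_pos

lemma Params.r_nonneg (p : Params) : 0 ≤ p.r := by
  have := p.gap_pos'
  unfold Params.r
  positivity

/-- The threshold `4g - 12 exp ν` is calibrated for this: `b` below it means `2g - b/2 > 6 exp ν`.
-/
lemma Params.ratio_le (p : Params) : 2 * p.r * Real.exp p.ν ≤ 1 / 3 := by
  have h1 := p.gap_pos
  have h2 := p.gap_pos'
  unfold Params.r
  rw [mul_one_div, div_mul_eq_mul_div, div_le_div_iff₀ h2 (by norm_num)]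
  linarith

variable (p : Params)

/-- With `κ` the half number of ends, a non-contiguous `x` has `κ ≥ 2`, so `2gκ - b ≥ κ (2g - b/2)`.
A block has `κ = 1`, and its potential energy supplies the missing `b/2`. -/
lemma local_bound {lam : ℝ} (hlam : 0 ≤ lam) {ω : Λ → ℝ} (hω : ∀ α, 0 ≤ ω α) {z : ℂ}
    (hz : z.re ≤ p.b) {f : Config Λ (m + 1) → ℂ} {x : Config Λ (m + 1)}
    (hx : ¬ x.Contiguous ∨ p.b / 2 ≤ lam * ∑ j, ω (x.pos j))
    (heq : ((diagEnergy p.g lam ω x : ℂ) - z) * f x = ∑ y ∈ x.nbrs, f y) :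
    x.halfEnds * ‖f x‖ ≤ p.r * ∑ y ∈ x.nbrs, ‖f y‖ := by
  have hV : 0 ≤ lam * ∑ j, ω (x.pos j) := mul_nonneg hlam (Finset.sum_nonneg fun _ _ => hω _)
  have hk := x.halfEnds_le_clusterCount
  have h1 := x.one_le_halfEnds
  have hg := p.hg
  have hb0 := p.hb0
  have hgap := p.gap_pos'
  have hre : x.halfEnds * (2 * p.g - p.b / 2) ≤ ((diagEnergy p.g lam ω x : ℂ) - z).re := by
    rw [Complex.sub_re, Complex.ofReal_re, diagEnergy]
    have hgk : 2 * p.g * x.halfEnds ≤ 2 * p.g * x.clusterCount := by gcongr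
    by_cases hc : x.Contiguous
    · rw [hc.halfEnds_eq] at hgk ⊢
      have := hx.resolve_left (not_not.2 hc)
      linarith
    · have := Config.two_le_halfEnds hc
      nlinarith
  have hnorm : x.halfEnds * (2 * p.g - p.b / 2) * ‖f x‖ ≤ ∑ y ∈ x.nbrs, ‖f y‖ := by
    calc x.halfEnds * (2 * p.g - p.b / 2) * ‖f x‖
        ≤ ‖(diagEnergy p.g lam ω x : ℂ) - z‖ * ‖f x‖ := by
          gcongr
          exact hre.trans ((le_abs_self _).trans (Complex.abs_re_le_norm _))
      _ = ‖∑ y ∈ x.nbrs, f y‖ := by rw [← norm_mul, heq]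
      _ ≤ _ := norm_sum_le _ _
  rw [Params.r, one_div, inv_mul_eq_div, le_div_iff₀ hgap]
  linarith

open Classical in
/-- The contiguous configurations with small potential energy. -/
def badSet (m : ℕ) (lam : ℝ) (ω : Λ → ℝ) : Finset (Config Λ (m + 1)) :=
  Finset.univ.filter fun x => x.Contiguous ∧ lam * ∑ j, ω (x.pos j) < p.b / 2

open Classical in
/-- The contiguous configurations. -/
def contiguousSet (Λ : Finset ℤ) (m : ℕ) : Finset (Config Λ (m + 1)) :=
  Finset.univ.filter fun x => x.Contiguous

lemma mem_contiguousSet {x : Config Λ (m + 1)} : x ∈ contiguousSet Λ m ↔ x.Contiguous := by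
  simp [contiguousSet]

lemma mem_badSet {lam : ℝ} {ω : Λ → ℝ} {x : Config Λ (m + 1)} :
    x ∈ badSet p m lam ω ↔ x.Contiguous ∧ lam * ∑ j, ω (x.pos j) < p.b / 2 := by
  simp [badSet]

lemma exp_weight_le {ν : ℝ} (hν : 0 ≤ ν) {a b : ℝ} (h : |a - b| ≤ 1) :
    Real.exp (-ν * b) ≤ Real.exp ν * Real.exp (-ν * a) := by
  rw [← Real.exp_add, Real.exp_le_exp]
  nlinarith [(abs_le.1 h).2]

lemma model_weighted_sum_le {D : Config Λ (m + 1) → ℝ} (hD : ∀ x, 0 ≤ D x)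
    {φ : Config Λ (m + 1) → ℝ} (hφ : ∀ x, ∀ y ∈ x.nbrs, |φ x - φ y| ≤ 1)
    {B : Finset (Config Λ (m + 1))} (hBc : ∀ x ∈ B, x.Contiguous)
    (hB : ∀ x ∉ B, x.halfEnds * D x ≤ p.r * ∑ y ∈ x.nbrs, D y) :
    ∑ x : Config Λ (m + 1), x.halfEnds * Real.exp (-p.ν * φ x) * D x ≤
      3 / 2 * ∑ x ∈ B, Real.exp (-p.ν * φ x) * D x := by
  have h := weighted_sum_le (fun x : Config Λ (m + 1) => x.nbrs)
    (fun x y => Config.mem_nbrs_comm) (fun x => x.halfEnds) D (fun x => Real.exp (-p.ν * φ x)) hD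
    (fun x => (Real.exp_pos _).le) (fun x => x.card_nbrs_le) p.r_nonneg
    (fun x y hy => exp_weight_le p.hν.le (hφ x y hy)) p.ratio_le (Real.exp_pos _).le B hB
  refine h.trans (le_of_eq ?_)
  congr 1
  exact Finset.sum_congr rfl fun x hx => by rw [(hBc x hx).halfEnds_eq, one_mul]

/-- Eigenprojections are exponentially concentrated near the bad configurations. -/
lemma sum_eigenprojectionEntry_le {lam : ℝ} (hlam : 0 ≤ lam) {ω : Λ → ℝ} (hω : ∀ α, 0 ≤ ω α)
    {E : ℝ} (hE : E ≤ p.b) {φ : Config Λ (m + 1) → ℝ}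
    (hφ : ∀ x, ∀ y ∈ x.nbrs, |φ x - φ y| ≤ 1) (y : Config Λ (m + 1)) :
    ∑ x : Config Λ (m + 1), Real.exp (-p.ν * φ x) *
      ‖eigenprojectionEntry (hamiltonian (m + 1) p.g lam ω) E x y‖ ≤
      3 / 2 * ∑ x ∈ badSet p m lam ω, Real.exp (-p.ν * φ x) *
        ‖eigenprojectionEntry (hamiltonian (m + 1) p.g lam ω) E x y‖ := by
  set H := hamiltonian (m + 1) p.g lam ω
  set f : Config Λ (m + 1) → ℂ := fun x => eigenprojectionEntry H E x y with hf
  have heig : ∀ x, (H *ᵥ f) x = E * f x := fun x => by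
    have := congrFun (congrFun (mul_eigMat H E) x) y
    simpa [Matrix.mul_apply, mulVec, dotProduct, eigMat] using this
  refine le_trans (Finset.sum_le_sum fun x _ => ?_)
    (model_weighted_sum_le p (D := fun x => ‖f x‖) (fun x => norm_nonneg _) hφ
      (fun x hx => ((mem_badSet p).1 hx).1) fun x hx => ?_)
  · rw [mul_assoc]
    exact le_mul_of_one_le_left (by positivity) x.one_le_halfEnds
  · refine local_bound p hlam hω (z := E) (by simpa using hE) ?_ ?_
    · rw [mem_badSet] at hx
      by_cases hc : x.Contiguous
      · exact Or.inr (not_lt.1 fun h => hx ⟨hc, h⟩)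
      · exact Or.inl hc
    · have := heig x
      rw [hamiltonian_mulVec] at this
      linear_combination this

/-! ### Gluing across a cut -/

section Cut

variable {lam : ℝ} {ω : Λ → ℝ} {z : ℂ} {α : ℤ} {t : Config Λ (m + 1)}

/-- A column of the resolvent of the cut Hamiltonian. -/
def cutColumn (m : ℕ) (g lam : ℝ) (ω : Λ → ℝ) (α : ℤ) (z : ℂ) (t x : Config Λ (m + 1)) : ℂ :=
  resolv (cutHamiltonian m g lam ω α) z x t

/-- The boundary source produced by removing the cut. -/
def cutSource (m : ℕ) (g lam : ℝ) (ω : Λ → ℝ) (α : ℤ) (z : ℂ) (t u : Config Λ (m + 1)) : ℂ :=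
  if u.left = α then ∑ y ∈ u.nbrs, cutColumn m g lam ω α z t y else 0

lemma cutColumn_equation (hdet : (cutHamiltonian m p.g lam ω α - z • 1).det ≠ 0) :
    cutHamiltonian m p.g lam ω α *ᵥ cutColumn m p.g lam ω α z t =
      z • cutColumn m p.g lam ω α z t + Pi.single t 1 := by
  have h1 : (cutHamiltonian m p.g lam ω α - z • 1) *
      resolv (cutHamiltonian m p.g lam ω α) z = 1 :=
    mul_nonsing_inv _ (isUnit_iff_ne_zero.2 hdet)
  funext x
  have h2 := congrFun (congrFun h1 x) t
  rw [Matrix.sub_mul, Matrix.sub_apply, Matrix.smul_mul, Matrix.one_mul, Matrix.smul_apply,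
    Matrix.mul_apply, Matrix.one_apply] at h2
  simp only [mulVec, dotProduct, cutColumn, Pi.add_apply, Pi.smul_apply, Pi.single_apply]
  linear_combination h2

/-- The cut Hamiltonian is zero, rather than absent, on configurations touching the removed region,
so there the equation reads `0 = z f`. Hence energy 0 must be excluded. -/
lemma cutColumn_eq_zero (hdet : (cutHamiltonian m p.g lam ω α - z • 1).det ≠ 0)
    (hz0 : z ≠ 0) (ht : α < t.left) {x : Config Λ (m + 1)} (hx : x.left ≤ α) :
    cutColumn m p.g lam ω α z t x = 0 := by
  have h := congrFun (cutColumn_equation p (t := t) hdet) x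
  have hne : x ≠ t := by rintro rfl; omega
  have h0 : (cutHamiltonian m p.g lam ω α *ᵥ cutColumn m p.g lam ω α z t) x = 0 := by
    simp only [mulVec, dotProduct, cutHamiltonian, Matrix.of_apply]
    exact Finset.sum_eq_zero fun y _ => by rw [if_neg (fun h => by omega), zero_mul]
  rw [h0] at h
  simp only [Pi.add_apply, Pi.smul_apply, Pi.single_apply, if_neg hne, smul_eq_mul,
    add_zero] at h
  exact (mul_eq_zero.1 h.symm).resolve_left hz0

lemma cutColumn_local (hdet : (cutHamiltonian m p.g lam ω α - z • 1).det ≠ 0)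
    (hz0 : z ≠ 0) (ht : α < t.left) (x : Config Λ (m + 1)) (hx : α < x.left) :
    (diagEnergy p.g lam ω x : ℂ) * cutColumn m p.g lam ω α z t x -
      ∑ y ∈ x.nbrs, cutColumn m p.g lam ω α z t y =
      z * cutColumn m p.g lam ω α z t x + (Pi.single t 1 : Config Λ (m + 1) → ℂ) x := by
  have h := congrFun (cutColumn_equation p (t := t) hdet) x
  rw [cutHamiltonian_mulVec _ _ _ (fun y hy => cutColumn_eq_zero p hdet hz0 ht hy),
    if_pos hx] at h
  simpa using h

/-- Gluing: the column of the resolvent of the system cut at `α` solves the equation of the system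
cut at `β < α` up to a source on the configurations whose leftmost particle sits at `α`. -/
lemma cutHamiltonian_mulVec_cutColumn (hdet : (cutHamiltonian m p.g lam ω α - z • 1).det ≠ 0)
    (hz0 : z ≠ 0) (ht : α < t.left) {β : ℤ} (hβ : β < α) :
    cutHamiltonian m p.g lam ω β *ᵥ cutColumn m p.g lam ω α z t =
      z • cutColumn m p.g lam ω α z t + Pi.single t 1 - cutSource m p.g lam ω α z t := by
  funext x
  have hvan : ∀ y : Config Λ (m + 1), y.left ≤ α → cutColumn m p.g lam ω α z t y = 0 :=
    fun y hy => cutColumn_eq_zero p hdet hz0 ht hy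
  rw [cutHamiltonian_mulVec _ _ _ (fun y hy => hvan y (by omega))]
  simp only [Pi.sub_apply, Pi.add_apply, Pi.smul_apply, smul_eq_mul, cutSource]
  rcases lt_trichotomy x.left α with h | h | h
  · have hne : x ≠ t := by rintro rfl; omega
    have hs : ∑ y ∈ x.nbrs, cutColumn m p.g lam ω α z t y = 0 :=
      Finset.sum_eq_zero fun y hy => hvan y (by
        have := abs_le.1 (Config.abs_left_sub_le hy); omega)
    simp [hs, hvan x h.le, h.ne, hne]
  · have hne : x ≠ t := by rintro rfl; omega
    simp [hvan x h.le, h, hβ, hne]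
  · rw [if_pos (by omega), cutColumn_local p hdet hz0 ht x h, if_neg h.ne']
    ring

/-- Inverting the gluing identity writes the column at `t` of the system cut at `α` as the larger
resolvent applied to `δ_t - source`. Its value at `s` vanishes because `s` touches the cut. -/
lemma resolv_eq_mulVec_cutSource (hdet : (cutHamiltonian m p.g lam ω α - z • 1).det ≠ 0)
    (hz0 : z ≠ 0) (ht : α < t.left) {β : ℤ} (hβ : β < α)
    (hdet' : (cutHamiltonian m p.g lam ω β - z • 1).det ≠ 0)
    {s : Config Λ (m + 1)} (hs : s.left = α) :
    resolv (cutHamiltonian m p.g lam ω β) z s t =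
      (resolv (cutHamiltonian m p.g lam ω β) z *ᵥ cutSource m p.g lam ω α z t) s := by
  have h1 : (cutHamiltonian m p.g lam ω β - z • 1) *ᵥ cutColumn m p.g lam ω α z t =
      Pi.single t 1 - cutSource m p.g lam ω α z t := by
    rw [Matrix.sub_mulVec, cutHamiltonian_mulVec_cutColumn p hdet hz0 ht hβ, Matrix.smul_mulVec,
      Matrix.one_mulVec]
    abel
  have h2 : cutColumn m p.g lam ω α z t = resolv (cutHamiltonian m p.g lam ω β) z *ᵥ
      (Pi.single t 1 - cutSource m p.g lam ω α z t) := by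
    rw [← h1, mulVec_mulVec, resolv, nonsing_inv_mul _ (isUnit_iff_ne_zero.2 hdet'), one_mulVec]
  have h3 := congrFun h2 s
  rw [cutColumn_eq_zero p hdet hz0 ht hs.le, mulVec_sub, Pi.sub_apply,
    mulVec_single_one] at h3
  exact (sub_eq_zero.1 h3.symm)

/-- The gluing identity is paired with an eigenfunction of the full Hamiltonian at the same real
energy. The terms with `z` cancel, leaving the value at `t` against the source. -/
lemma eigenprojectionEntry_eq_sum_cutSource (hdet : (cutHamiltonian m p.g lam ω α - z • 1).det ≠ 0)
    (hz0 : z ≠ 0) (ht : α < t.left) {E : ℝ} (hzE : z = E) (y : Config Λ (m + 1)) :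
    eigenprojectionEntry (hamiltonian (m + 1) p.g lam ω) E t y =
      ∑ u, cutSource m p.g lam ω α z t u *
        eigenprojectionEntry (hamiltonian (m + 1) p.g lam ω) E u y := by
  obtain ⟨c, hc⟩ := Λ.bddBelow
  -- A cut left of all of `Λ` removes nothing, and the minimum with `α - 1` keeps it left of `α` as
  -- gluing demands.
  have hβ : ∀ u ∈ Λ, min (c - 1) (α - 1) < u := fun u hu => by
    have := hc hu
    omega
  have h1 := cutHamiltonian_mulVec_cutColumn p hdet hz0 ht (β := min (c - 1) (α - 1)) (by omega)
  rw [cutHamiltonian_eq hβ] at h1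
  set H := hamiltonian (m + 1) p.g lam ω with hH
  set ψ : Config Λ (m + 1) → ℂ := fun x => eigenprojectionEntry H E x y with hψ
  have heig : H *ᵥ ψ = z • ψ := by
    funext x
    have := congrFun (congrFun (mul_eigMat H E) x) y
    simpa [Matrix.mul_apply, mulVec, dotProduct, eigMat, hzE] using this
  -- The pairing is bilinear, without conjugation, so symmetry of `H` rather than hermiticity moves
  -- it across.
  have hsym : ψ ᵥ* H = H *ᵥ ψ := by
    rw [← Matrix.mulVec_transpose]
    congr 1
    ext a b
    exact hamiltonian_symm _ _ _ _ _
  have h2 : ψ ⬝ᵥ (H *ᵥ cutColumn m p.g lam ω α z t) =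
      z * (ψ ⬝ᵥ cutColumn m p.g lam ω α z t) := by
    rw [Matrix.dotProduct_mulVec, hsym, heig, smul_dotProduct, smul_eq_mul]
  rw [h1, dotProduct_sub, dotProduct_add, dotProduct_smul, smul_eq_mul, dotProduct_single,
    mul_one] at h2
  have h3 : ψ t = ψ ⬝ᵥ cutSource m p.g lam ω α z t := by linear_combination h2
  rw [dotProduct_comm] at h3
  exact h3

/-- Only neighbours with leftmost particle at `α + 1` contribute to the source, and there the weight
is 1. Counting with the degree bound gives a factor 2, and the weighted estimate towards blocks
gives `3/2`. Contiguity of `t` keeps the unit source of the column inside the exceptional set. -/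
lemma sum_cutSource_le (hdet : (cutHamiltonian m p.g lam ω α - z • 1).det ≠ 0)
    (hz0 : z ≠ 0) (ht : α < t.left) (hlam : 0 ≤ lam) (hω : ∀ α, 0 ≤ ω α) (hz : z.re ≤ p.b)
    (htc : t.Contiguous) :
    ∑ u, ‖cutSource m p.g lam ω α z t u‖ ≤
      3 * ∑ x ∈ contiguousSet Λ m, Real.exp (-p.ν * ((x.left : ℝ) - α - 1)) *
        ‖cutColumn m p.g lam ω α z t x‖ := by
  have hvan : ∀ y : Config Λ (m + 1), y.left ≤ α → cutColumn m p.g lam ω α z t y = 0 :=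
    fun y hy => cutColumn_eq_zero p hdet hz0 ht hy
  set h : Config Λ (m + 1) → ℂ := cutColumn m p.g lam ω α z t with hh
  set φ : Config Λ (m + 1) → ℝ := fun x => (x.left : ℝ) - α - 1 with hφ
  have h1 : ∑ u, ‖cutSource m p.g lam ω α z t u‖ ≤
      ∑ u : Config Λ (m + 1), ∑ y ∈ u.nbrs, Real.exp (-p.ν * φ y) * ‖h y‖ := by
    refine Finset.sum_le_sum fun u _ => ?_
    unfold cutSource
    split_ifs with hu
    · refine (norm_sum_le _ _).trans (Finset.sum_le_sum fun y hy => ?_)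
      by_cases hy' : y.left ≤ α
      · rw [← hh, hvan y hy']; simp
      · have h2 := abs_le.1 (Config.abs_left_sub_le hy)
        have h3 : y.left = α + 1 := by omega
        have h4 : φ y = 0 := by simp only [hφ, h3]; push_cast; ring
        simp [h4, hh]
    · rw [norm_zero]
      exact Finset.sum_nonneg fun y _ => by positivity
  have h2 : ∑ u : Config Λ (m + 1), ∑ y ∈ u.nbrs, Real.exp (-p.ν * φ y) * ‖h y‖ =
      ∑ y : Config Λ (m + 1), (y.nbrs.card : ℝ) * (Real.exp (-p.ν * φ y) * ‖h y‖) := by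
    rw [Finset.sum_comm' (t' := Finset.univ) (s' := fun y => y.nbrs)]
    · simp [Finset.sum_const, nsmul_eq_mul]
    · intro x y; simp [Config.mem_nbrs_comm (x := x)]
  have h3 : ∑ y : Config Λ (m + 1), (y.nbrs.card : ℝ) * (Real.exp (-p.ν * φ y) * ‖h y‖) ≤
      2 * ∑ y : Config Λ (m + 1), y.halfEnds * Real.exp (-p.ν * φ y) * ‖h y‖ := by
    rw [Finset.mul_sum]
    refine Finset.sum_le_sum fun y _ => ?_
    calc (y.nbrs.card : ℝ) * (Real.exp (-p.ν * φ y) * ‖h y‖)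
        ≤ 2 * y.halfEnds * (Real.exp (-p.ν * φ y) * ‖h y‖) := by
          gcongr
          exact y.card_nbrs_le
      _ = _ := by ring
  have h4 := model_weighted_sum_le p (D := fun x => ‖h x‖) (fun x => norm_nonneg _) (φ := φ)
    (fun x y hy => by
      have := Config.abs_left_sub_le hy
      have h5 : |((x.left - y.left : ℤ) : ℝ)| ≤ 1 := by exact_mod_cast this
      simp only [hφ]
      push_cast at h5
      convert h5 using 2
      ring)
    (B := contiguousSet Λ m) (fun x hx => mem_contiguousSet.1 hx)
    (fun x hx => by
      rw [mem_contiguousSet] at hx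
      by_cases hxα : x.left ≤ α
      · simp only [hvan x hxα, norm_zero, mul_zero]
        exact mul_nonneg p.r_nonneg (Finset.sum_nonneg fun _ _ => norm_nonneg _)
      · refine local_bound p hlam hω hz (Or.inl hx) ?_
        have h5 := cutColumn_local p hdet hz0 ht x (not_le.1 hxα)
        have hne : x ≠ t := by rintro rfl; exact hx htc
        rw [Pi.single_apply, if_neg hne] at h5
        linear_combination h5)
  linarith

end Cut

end Model

end HardCore

end

noncomputable section

namespace HardCore

/-! ### Fractional moments of the cut resolvents -/

section Averages

open Matrix

lemma sqrt_sum_le {ι : Type*} (s : Finset ι) (f : ι → ℝ) (hf : ∀ i, 0 ≤ f i) :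
    √(∑ i ∈ s, f i) ≤ ∑ i ∈ s, √(f i) := by
  classical
  induction s using Finset.induction_on with
  | empty => simp
  | insert a s ha ih =>
    rw [Finset.sum_insert ha, Finset.sum_insert ha]
    have h1 : 0 ≤ ∑ i ∈ s, f i := Finset.sum_nonneg fun i _ => hf i
    have h2 : √(f a + ∑ i ∈ s, f i) ≤ √(f a) + √(∑ i ∈ s, f i) := by
      rw [Real.sqrt_le_left (by positivity)]
      nlinarith [Real.sq_sqrt (hf a), Real.sq_sqrt h1,
        mul_nonneg (Real.sqrt_nonneg (f a)) (Real.sqrt_nonneg (∑ i ∈ s, f i))]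
    linarith

/-- Quantitative regularity of the single-site law. -/
structure LawBound (ν₀ : Measure ℝ) (R : NNReal) (W : ℝ) : Prop where
  W_pos : 0 < W
  le : ν₀ ≤ R • volume.restrict (Set.Icc (-W) W)
  nonneg : ∀ᵐ v ∂ν₀, 0 ≤ v

lemma LawBound.lintegral_le {ν₀ : Measure ℝ} {R : NNReal} {W : ℝ} (h : LawBound ν₀ R W)
    (F : ℝ → ENNReal) : ∫⁻ v, F v ∂ν₀ ≤ R * ∫⁻ v in Set.Icc (-W) W, F v := by
  refine (lintegral_mono' h.le le_rfl).trans (le_of_eq ?_)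
  rw [lintegral_smul_measure]; rfl

/-- Resampling one coordinate leaves a product measure unchanged. -/
lemma lintegral_resample {ι : Type*} [Fintype ι] [DecidableEq ι] (ν₀ : Measure ℝ)
    [IsProbabilityMeasure ν₀] {F : (ι → ℝ) → ENNReal} (hF : Measurable F) (i : ι) :
    ∫⁻ ω, F ω ∂(Measure.pi fun _ => ν₀) =
      ∫⁻ ω, ∫⁻ v, F (Function.update ω i v) ∂ν₀ ∂(Measure.pi fun _ => ν₀) := by
  have hG : Measurable fun ω : ι → ℝ => ∫⁻ v, F (Function.update ω i v) ∂ν₀ := by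
    refine Measurable.lintegral_prod_right'
      (f := fun q : (ι → ℝ) × ℝ => F (Function.update q.1 i q.2)) ?_
    exact hF.comp measurable_update'
  rw [lintegral_eq_lmarginal_univ (μ := fun _ : ι => ν₀) (fun _ => 0),
    lintegral_eq_lmarginal_univ (μ := fun _ : ι => ν₀) (fun _ => 0),
    lmarginal_erase' _ hF (Finset.mem_univ i), lmarginal_erase' _ hG (Finset.mem_univ i)]
  simp

variable {Λ : Finset ℤ} {m : ℕ} (p : Params)

/-- The decay rate of the fractional moments. -/
def Params.μ : ℝ := p.ν / 4

/-- The geometric sum controlling one step of the recursion. -/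
def Params.S : ℝ := Real.exp p.μ / (1 - Real.exp (-p.μ))

lemma Params.μ_pos : 0 < p.μ := by
  have := p.hν
  unfold Params.μ
  linarith

lemma Params.exp_neg_μ_lt : Real.exp (-p.μ) < 1 := by
  rw [Real.exp_lt_one_iff]; linarith [p.μ_pos]

lemma Params.S_pos : 0 < p.S := div_pos (Real.exp_pos _) (by linarith [p.exp_neg_μ_lt])

lemma sum_geometric_le {q : ℝ} (hq0 : 0 ≤ q) (hq : q < 1) {ι : Type*} (s : Finset ι) (k : ι → ℕ)
    (hk : Set.InjOn k s) : ∑ i ∈ s, q ^ k i ≤ (1 - q)⁻¹ := by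
  classical
  rw [← Finset.sum_image (f := fun n => q ^ n) hk]
  exact (Summable.sum_le_tsum _ (fun _ _ => by positivity)
    (summable_geometric_of_lt_one hq0 hq)).trans_eq (tsum_geometric_of_lt_one hq0 hq)

/-- The weights of the recursion sum up. -/
lemma sum_contiguous_weights_le (α : ℤ) (t : ℤ) :
    ∑ x ∈ (contiguousSet Λ m).filter (fun x => α < x.left),
      √(Real.exp (-p.ν * ((x.left : ℝ) - α - 1))) * Real.exp (-p.μ * |(x.left : ℝ) - t|) ≤
      p.S * Real.exp (-p.μ * |(α : ℝ) - t|) := by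
  set s := (contiguousSet Λ m).filter (fun x => α < x.left) with hs
  have hmem : ∀ x ∈ s, x.Contiguous ∧ α < x.left := fun x hx => by
    rw [hs, Finset.mem_filter] at hx
    exact ⟨mem_contiguousSet.1 hx.1, hx.2⟩
  have hterm : ∀ x ∈ s, √(Real.exp (-p.ν * ((x.left : ℝ) - α - 1))) *
      Real.exp (-p.μ * |(x.left : ℝ) - t|) ≤ Real.exp p.μ * Real.exp (-p.μ * |(α : ℝ) - t|) *
        Real.exp (-p.μ) ^ (x.left - α - 1).toNat := fun x hx => by
    have h1 := (hmem x hx).2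
    have hcast : (((x.left - α - 1).toNat : ℕ) : ℝ) = (x.left : ℝ) - α - 1 := by
      have : (((x.left - α - 1).toNat : ℕ) : ℤ) = x.left - α - 1 := Int.toNat_of_nonneg (by omega)
      exact_mod_cast this
    rw [← Real.exp_half, ← Real.exp_nat_mul, ← Real.exp_add, ← Real.exp_add, ← Real.exp_add,
      Real.exp_le_exp, hcast]
    have h2 : |(α : ℝ) - t| ≤ ((x.left : ℝ) - α) + |(x.left : ℝ) - t| := by
      have h3 := abs_sub_le (α : ℝ) x.left t
      have h4 : |(α : ℝ) - x.left| = (x.left : ℝ) - α := by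
        rw [abs_sub_comm, abs_of_nonneg]
        have : (α : ℝ) < x.left := by exact_mod_cast h1
        linarith
      linarith
    have h5 : 0 ≤ (x.left : ℝ) - α - 1 := by rw [← hcast]; positivity
    have hμ := p.μ_pos
    -- The square root halves `ν` to `2μ`: one `μ` pays for moving the reference point from `x.left`
    -- to `α`, the other leaves a geometric series. Blocks are determined by their left end, so each
    -- exponent occurs at most once.
    have hν : p.ν = 4 * p.μ := by unfold Params.μ; ring
    rw [hν]
    nlinarith [mul_le_mul_of_nonneg_left h2 hμ.le, mul_nonneg hμ.le h5]
  refine (Finset.sum_le_sum hterm).trans ?_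
  rw [← Finset.mul_sum]
  have h6 := sum_geometric_le (Real.exp_pos (-p.μ)).le p.exp_neg_μ_lt s
    (fun x => (x.left - α - 1).toNat) (fun x hx y hy hxy => by
      have h1 := hmem x hx
      have h2 := hmem y hy
      refine h1.1.ext h2.1 ?_
      have := h1.2
      have := h2.2
      simp only at hxy
      omega)
  calc Real.exp p.μ * Real.exp (-p.μ * |(α : ℝ) - t|) *
        ∑ x ∈ s, Real.exp (-p.μ) ^ (x.left - α - 1).toNat
      ≤ Real.exp p.μ * Real.exp (-p.μ * |(α : ℝ) - t|) * (1 - Real.exp (-p.μ))⁻¹ := by gcongr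
    _ = _ := by rw [Params.S]; ring

variable (ν₀ : Measure ℝ) [IsProbabilityMeasure ν₀] {R : NNReal} {W lam : ℝ}

/-- The law of the disorder. -/
def disorderLaw (Λ : Finset ℤ) (ν₀ : Measure ℝ) : Measure (Λ → ℝ) := Measure.pi fun _ => ν₀

instance : IsProbabilityMeasure (disorderLaw Λ ν₀) := by
  unfold disorderLaw; infer_instance

variable {ν₀}

lemma LawBound.ae_nonneg (h : LawBound ν₀ R W) : ∀ᵐ ω ∂disorderLaw Λ ν₀, ∀ α, 0 ≤ ω α := by
  rw [ae_all_iff]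
  intro α
  exact (measurePreserving_eval (fun _ : Λ => ν₀) α).quasiMeasurePreserving.ae h.nonneg

lemma measurable_cutColumn {Ω : Type*} [MeasurableSpace Ω] {ω : Ω → Λ → ℝ} (hω : Measurable ω)
    {z : Ω → ℂ} (hz : Measurable z) (α : ℤ) (t x : Config Λ (m + 1)) :
    Measurable fun w => cutColumn m p.g lam (ω w) α (z w) t x := by
  unfold cutColumn resolv
  refine measurable_inv_apply (fun i j => ?_) _ _
  simp only [Matrix.sub_apply, Matrix.smul_apply, smul_eq_mul]
  exact ((measurable_cutHamiltonian _ _ _ _ _).comp hω).sub (hz.mul_const _)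

lemma measurable_cutSource {Ω : Type*} [MeasurableSpace Ω] {ω : Ω → Λ → ℝ} (hω : Measurable ω)
    {z : Ω → ℂ} (hz : Measurable z) (α : ℤ) (t x : Config Λ (m + 1)) :
    Measurable fun w => cutSource m p.g lam (ω w) α (z w) t x := by
  unfold cutSource
  split_ifs
  · exact Finset.measurable_sum _ fun y _ => measurable_cutColumn p hω hz α t y
  · exact measurable_const

/-- The source is built from the system strictly right of `α`; this lets it be treated as a constant
when averaging over `ω α`. -/
lemma cutSource_update (ω : Λ → ℝ) {α : Λ} (v : ℝ) (z : ℂ) (t : Config Λ (m + 1)) :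
    cutSource m p.g lam (Function.update ω α v) α z t = cutSource m p.g lam ω α z t := by
  funext u
  simp only [cutSource, cutColumn, cutHamiltonian_update_of_le p.g lam ω (le_refl (α : ℤ))]

/-- The a priori fractional-moment constant. -/
def apriori (R : NNReal) (W lam : ℝ) : ℝ := R * (16 * Real.pi * √(W / lam))

lemma apriori_nonneg (R : NNReal) (W lam : ℝ) : 0 ≤ apriori R W lam := by
  unfold apriori; positivity

/-- Averaging over the disorder at `α` when the source does not depend on it. -/
lemma lintegral_sqrt_resolv_source_le (h : LawBound ν₀ R W) (hlam : 0 < lam) {z : ℂ}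
    (hz : 0 < z.im) {β : ℤ} {s : Config Λ (m + 1)} (hβ : β < s.left)
    {χ : (Λ → ℝ) → Config Λ (m + 1) → ℂ} (hχm : ∀ u, Measurable fun ω => χ ω u)
    (hχ : ∀ ω v, χ (Function.update ω (s.pos 0) v) = χ ω)
    (hsupp : ∀ ω u, u.left ≠ s.left → χ ω u = 0) :
    ∫⁻ ω, ENNReal.ofReal √‖(resolv (cutHamiltonian m p.g lam ω β) z *ᵥ χ ω) s‖
      ∂disorderLaw Λ ν₀ ≤
      ENNReal.ofReal (apriori R W lam) *
        ∫⁻ ω, ENNReal.ofReal √(∑ u, ‖χ ω u‖) ∂disorderLaw Λ ν₀ := by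
  have hF : Measurable fun ω => ENNReal.ofReal
      √‖(resolv (cutHamiltonian m p.g lam ω β) z *ᵥ χ ω) s‖ := by
    refine ENNReal.measurable_ofReal.comp (Measurable.sqrt (Measurable.norm ?_))
    simp only [mulVec, dotProduct]
    refine Finset.measurable_sum _ fun u _ => Measurable.mul ?_ (hχm u)
    exact measurable_cutColumn p measurable_id measurable_const β u s
  have hocc : ∀ u : Config Λ (m + 1), u.left = s.left → u ∈ occupied m β (s.pos 0) := fun u hu => by
    simp only [occupied, Finset.mem_filter, Finset.mem_univ, true_and]
    exact ⟨by omega, 0, Subtype.ext hu⟩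
  unfold disorderLaw
  rw [lintegral_resample ν₀ hF (s.pos 0), ← lintegral_const_mul' _ _ ENNReal.ofReal_ne_top]
  refine lintegral_mono fun ω => ?_
  refine (h.lintegral_le _).trans ?_
  have h1 := lintegral_sqrt_resolv_mulVec_le (A := occupied m β (s.pos 0))
    (cutHamiltonian_isHermitian p.g lam (Function.update ω (s.pos 0) 0) β) hlam hz
    (hocc s rfl) (χ := χ ω) (fun u hu => hsupp ω u fun h => hu (hocc u h)) h.W_pos
  simp only [hχ]
  simp only [← cutHamiltonian_update] at h1
  calc (R : ENNReal) * _ ≤ (R : ENNReal) * (ENNReal.ofReal (16 * Real.pi * √(W / lam)) *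
        ENNReal.ofReal √(∑ u, ‖χ ω u‖)) := by gcongr
    _ = _ := by
      rw [← mul_assoc, apriori, ENNReal.ofReal_mul (p := (R : ℝ)) R.coe_nonneg,
        ENNReal.ofReal_coe_nnreal]

lemma det_cut_ne_zero (ω : Λ → ℝ) (β : ℤ) {z : ℂ} (hz : 0 < z.im) :
    (cutHamiltonian m p.g lam ω β - z • 1).det ≠ 0 :=
  det_sub_smul_ne_zero (cutHamiltonian_isHermitian _ _ _ _) hz

/-- One step of the recursion: decay with constant `K` for block entries of the system cut at `α`
passes to the source. Subadditivity of the square root carries the deterministic bound on the source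
to half moments. -/
lemma lintegral_sqrt_source_le (h : LawBound ν₀ R W) (hlam : 0 < lam) {z : ℂ}
    (hz : 0 < z.im) (hzb : z.re ≤ p.b) {α : ℤ} {t : Config Λ (m + 1)} (htc : t.Contiguous)
    (ht : α < t.left) {K : ℝ} (hK : 0 ≤ K)
    (hyp : ∀ x : Config Λ (m + 1), x.Contiguous → α < x.left →
      ∫⁻ ω, ENNReal.ofReal √‖resolv (cutHamiltonian m p.g lam ω α) z x t‖ ∂disorderLaw Λ ν₀ ≤
        ENNReal.ofReal (K * Real.exp (-p.μ * |(x.left : ℝ) - t.left|))) :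
    ∫⁻ ω, ENNReal.ofReal √(∑ u, ‖cutSource m p.g lam ω α z t u‖) ∂disorderLaw Λ ν₀ ≤
      ENNReal.ofReal (√3 * p.S * K * Real.exp (-p.μ * |(α : ℝ) - t.left|)) := by
  have hz0 : z ≠ 0 := by rintro rfl; simp at hz
  set s := (contiguousSet Λ m).filter (fun x => α < x.left) with hs
  set w : Config Λ (m + 1) → ℝ := fun x => Real.exp (-p.ν * ((x.left : ℝ) - α - 1)) with hw
  have hpt : ∀ᵐ ω ∂disorderLaw Λ ν₀,
      ENNReal.ofReal √(∑ u, ‖cutSource m p.g lam ω α z t u‖) ≤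
      ∑ x ∈ s, ENNReal.ofReal (√3 * √(w x)) *
        ENNReal.ofReal √‖resolv (cutHamiltonian m p.g lam ω α) z x t‖ := by
    filter_upwards [h.ae_nonneg] with ω hω
    have h1 := sum_cutSource_le p (det_cut_ne_zero p ω α hz) hz0 ht hlam.le hω hzb htc
    have h2 : ∑ x ∈ contiguousSet Λ m, w x * ‖cutColumn m p.g lam ω α z t x‖ =
        ∑ x ∈ s, w x * ‖cutColumn m p.g lam ω α z t x‖ := by
      rw [hs, Finset.sum_filter]
      refine Finset.sum_congr rfl fun x _ => ?_
      split_ifs with hx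
      · rfl
      · rw [cutColumn_eq_zero p (det_cut_ne_zero p ω α hz) hz0 ht (not_lt.1 hx)]; simp
    rw [h2, Finset.mul_sum] at h1
    calc ENNReal.ofReal √(∑ u, ‖cutSource m p.g lam ω α z t u‖)
        ≤ ENNReal.ofReal (∑ x ∈ s, √(3 * (w x * ‖cutColumn m p.g lam ω α z t x‖))) :=
          ENNReal.ofReal_le_ofReal ((Real.sqrt_le_sqrt h1).trans
            (sqrt_sum_le _ _ fun x => by positivity))
      _ = _ := by
          rw [ENNReal.ofReal_sum_of_nonneg fun _ _ => Real.sqrt_nonneg _]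
          refine Finset.sum_congr rfl fun x _ => ?_
          rw [← ENNReal.ofReal_mul (by positivity), Real.sqrt_mul (by norm_num),
            Real.sqrt_mul (by positivity), mul_assoc]
          rfl
  refine (lintegral_mono_ae hpt).trans ?_
  rw [lintegral_finsetSum]
  · calc ∑ x ∈ s, ∫⁻ ω, ENNReal.ofReal (√3 * √(w x)) * ENNReal.ofReal
          √‖resolv (cutHamiltonian m p.g lam ω α) z x t‖ ∂disorderLaw Λ ν₀
        ≤ ∑ x ∈ s, ENNReal.ofReal (√3 * K * (√(w x) *
          Real.exp (-p.μ * |(x.left : ℝ) - t.left|))) := by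
          refine Finset.sum_le_sum fun x hx => ?_
          rw [hs, Finset.mem_filter] at hx
          rw [lintegral_const_mul' _ _ ENNReal.ofReal_ne_top]
          refine (mul_le_mul_right (hyp x (mem_contiguousSet.1 hx.1) hx.2) _).trans ?_
          rw [← ENNReal.ofReal_mul (by positivity)]
          refine ENNReal.ofReal_le_ofReal (le_of_eq (by ring))
      _ = ENNReal.ofReal (√3 * K * ∑ x ∈ s, (√(w x) *
          Real.exp (-p.μ * |(x.left : ℝ) - t.left|))) := by
          rw [← ENNReal.ofReal_sum_of_nonneg fun _ _ => by positivity, Finset.mul_sum]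
      _ ≤ _ := by
          refine ENNReal.ofReal_le_ofReal ?_
          have := sum_contiguous_weights_le (Λ := Λ) (m := m) p α t.left
          calc √3 * K * ∑ x ∈ s, (√(w x) * Real.exp (-p.μ * |(x.left : ℝ) - t.left|))
              ≤ √3 * K * (p.S * Real.exp (-p.μ * |(α : ℝ) - t.left|)) := by gcongr
            _ = _ := by ring
  · intro x _
    refine Measurable.const_mul (ENNReal.measurable_ofReal.comp (Measurable.sqrt
      (Measurable.norm ?_))) _
    exact measurable_cutColumn p measurable_id measurable_const α t x

/-- Exponential decay of fractional moments of the resolvent between contiguous configurations. -/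
lemma lintegral_sqrt_resolv_le (h : LawBound ν₀ R W) (hlam : 0 < lam)
    (hsmall : √3 * p.S * apriori R W lam ≤ 1) {z : ℂ} (hz : 0 < z.im) (hzb : z.re ≤ p.b) (β : ℤ)
    {s t : Config Λ (m + 1)} (hsc : s.Contiguous) (htc : t.Contiguous) (hs : β < s.left)
    (ht : β < t.left) :
    ∫⁻ ω, ENNReal.ofReal √‖resolv (cutHamiltonian m p.g lam ω β) z s t‖ ∂disorderLaw Λ ν₀ ≤
      ENNReal.ofReal (apriori R W lam * Real.exp (-p.μ * |(s.left : ℝ) - t.left|)) := by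
  have hz0 : z ≠ 0 := by rintro rfl; simp at hz
  obtain ⟨c, hc⟩ := Λ.bddAbove
  -- The induction is on the length of chain remaining right of the cut; at length zero no
  -- configuration is left.
  suffices H : ∀ k : ℕ, ∀ β : ℤ, c - β ≤ k → ∀ s t : Config Λ (m + 1), s.Contiguous →
      t.Contiguous → β < s.left → β < t.left →
      ∫⁻ ω, ENNReal.ofReal √‖resolv (cutHamiltonian m p.g lam ω β) z s t‖ ∂disorderLaw Λ ν₀ ≤
      ENNReal.ofReal (apriori R W lam * Real.exp (-p.μ * |(s.left : ℝ) - t.left|)) from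
    H (c - β).toNat β (Int.self_le_toNat _) s t hsc htc hs ht
  intro k
  induction k with
  | zero =>
    intro β hβ s t _ _ hs _
    have : s.left ≤ c := hc (s.pos 0).2
    simp only [Nat.cast_zero] at hβ
    omega
  | succ k ih =>
    have key : ∀ β : ℤ, c - β ≤ (k + 1 : ℕ) → ∀ s t : Config Λ (m + 1), s.Contiguous →
        t.Contiguous → β < s.left → s.left < t.left →
        ∫⁻ ω, ENNReal.ofReal √‖resolv (cutHamiltonian m p.g lam ω β) z s t‖ ∂disorderLaw Λ ν₀ ≤
        ENNReal.ofReal (apriori R W lam * Real.exp (-p.μ * |(s.left : ℝ) - t.left|)) := by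
      intro β hβ s t hsc htc hs hst
      -- The new cut is at `s.left > β`, so the remaining chain is strictly shorter. `hsmall` then
      -- restores the same constant `apriori R W lam`.
      have h1 := lintegral_sqrt_source_le p h hlam hz hzb htc hst (apriori_nonneg R W lam)
        (fun x hxc hx => ih s.left (by push_cast at hβ; omega) x t hxc htc hx hst)
      have h2 := lintegral_sqrt_resolv_source_le p h hlam hz hs
        (χ := fun ω => cutSource m p.g lam ω s.left z t)
        (fun u => measurable_cutSource p measurable_id measurable_const _ _ _)
        (fun ω v => cutSource_update p ω v z t)
        (fun ω u hu => by simp [cutSource, hu])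
      simp only [← resolv_eq_mulVec_cutSource p (det_cut_ne_zero p _ _ hz) hz0 hst hs
        (det_cut_ne_zero p _ _ hz) rfl] at h2
      refine h2.trans ((mul_le_mul_right h1 _).trans ?_)
      rw [← ENNReal.ofReal_mul (apriori_nonneg R W lam)]
      refine ENNReal.ofReal_le_ofReal (mul_le_mul_of_nonneg_left ?_ (apriori_nonneg R W lam))
      exact mul_le_of_le_one_left (Real.exp_pos _).le hsmall
    intro β hβ s t hsc htc hs ht
    rcases lt_trichotomy s.left t.left with hst | hst | hst
    · exact key β hβ s t hsc htc hs hst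
    · have := hsc.ext htc hst
      subst this
      -- On the diagonal the constant unit source already lies in the range of the projection, so
      -- the a priori bound suffices.
      have h2 := lintegral_sqrt_resolv_source_le p h hlam hz hs
        (χ := fun _ => Pi.single s 1) (fun u => measurable_const) (fun _ _ => rfl)
        (fun ω u hu => Pi.single_eq_of_ne (by rintro rfl; exact hu rfl) _)
      have h3 : ∑ u : Config Λ (m + 1), ‖(Pi.single s 1 : Config Λ (m + 1) → ℂ) u‖ = 1 := by
        rw [Finset.sum_eq_single s]
        · simp
        · intro x _ hx; simp [hx]
        · simp
      simp only [mulVec_single_one, h3, Real.sqrt_one, ENNReal.ofReal_one, lintegral_one,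
        measure_univ, mul_one] at h2
      simpa using h2
    · have := key β hβ t s htc hsc ht hst
      simp only [resolv_symm (cutHamiltonian_symm _ _ _ _) z s t]
      rwa [abs_sub_comm]

/-- Exponential decay of the fractional moments of the source. -/
lemma lintegral_sqrt_cutSource_le (h : LawBound ν₀ R W) (hlam : 0 < lam)
    (hsmall : √3 * p.S * apriori R W lam ≤ 1) {z : ℂ} (hz : 0 < z.im) (hzb : z.re ≤ p.b) {α : ℤ}
    {t : Config Λ (m + 1)} (htc : t.Contiguous) (ht : α < t.left) :
    ∫⁻ ω, ENNReal.ofReal √(∑ u, ‖cutSource m p.g lam ω α z t u‖) ∂disorderLaw Λ ν₀ ≤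
      ENNReal.ofReal (Real.exp (-p.μ * |(α : ℝ) - t.left|)) := by
  refine (lintegral_sqrt_source_le p h hlam hz hzb htc ht (apriori_nonneg R W lam)
    fun x hxc hx => lintegral_sqrt_resolv_le p h hlam hsmall hz hzb α hxc htc hx ht).trans ?_
  exact ENNReal.ofReal_le_ofReal (mul_le_of_le_one_left (Real.exp_pos _).le hsmall)

end Averages

end HardCore

end

noncomputable section

namespace HardCore

/-! ### From fractional moments to eigenfunction correlators -/

section Correlators

open Matrix Filter Topology

variable {Λ : Finset ℤ} {m : ℕ} (p : Params)
variable {ν₀ : Measure ℝ} [IsProbabilityMeasure ν₀] {R : NNReal} {W lam : ℝ}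

open Classical in
/-- The square root of the `ℓ¹`-norm of the source at a real energy, infinite at singular
energies. -/
def sourceMoment (m : ℕ) (g lam : ℝ) (α : ℤ) (t : Config Λ (m + 1)) (ω : Λ → ℝ) (E : ℝ) :
    ENNReal :=
  if (cutHamiltonian m g lam ω α - (E : ℂ) • 1).det = 0 ∨ E = 0 then ⊤
  else ENNReal.ofReal √(∑ u, ‖cutSource m g lam ω α (E : ℂ) t u‖)

lemma measurable_sourceMoment (α : ℤ) (t : Config Λ (m + 1)) :
    Measurable (Function.uncurry (sourceMoment m p.g lam α t)) := by
  unfold sourceMoment Function.uncurry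
  refine Measurable.ite ?_ measurable_const ?_
  · refine MeasurableSet.union ?_ ?_
    · refine (measurable_det (M := fun q : (Λ → ℝ) × ℝ =>
        cutHamiltonian m p.g lam q.1 α - (q.2 : ℂ) • 1) fun x y => ?_) (measurableSet_singleton 0)
      simp only [Matrix.sub_apply, Matrix.smul_apply, smul_eq_mul]
      exact ((measurable_cutHamiltonian _ _ _ _ _).comp measurable_fst).sub
        ((Complex.measurable_ofReal.comp measurable_snd).mul_const _)
    · exact measurable_snd (measurableSet_singleton 0)
  · refine ENNReal.measurable_ofReal.comp (Measurable.sqrt (Finset.measurable_sum _ fun u _ =>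
      Measurable.norm ?_))
    exact measurable_cutSource p measurable_fst (Complex.measurable_ofReal.comp measurable_snd)
      α t u

lemma sourceMoment_update (ω : Λ → ℝ) {α : Λ} (v : ℝ) (t : Config Λ (m + 1)) (E : ℝ) :
    sourceMoment m p.g lam α t (Function.update ω α v) E = sourceMoment m p.g lam α t ω E := by
  simp only [sourceMoment, cutSource_update p,
    cutHamiltonian_update_of_le p.g lam ω (le_refl (α : ℤ))]

lemma finite_singular {X : Type} [Fintype X] [DecidableEq X] (M : Matrix X X ℂ) :
    {E : ℝ | (M - (E : ℂ) • (1 : Matrix X X ℂ)).det = 0}.Finite := by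
  refine (Matrix.finite_real_spectrum (A := M)).subset fun E hE => ?_
  rw [spectrum.mem_iff, Matrix.isUnit_iff_isUnit_det, isUnit_iff_ne_zero, not_not]
  have h1 : algebraMap ℝ (Matrix X X ℂ) E - M = -(M - (E : ℂ) • (1 : Matrix X X ℂ)) := by
    rw [neg_sub, Algebra.algebraMap_eq_smul_one]
    congr 1
  have hE' : (M - (E : ℂ) • (1 : Matrix X X ℂ)).det = 0 := hE
  rw [h1, Matrix.det_neg, hE', mul_zero]

/-- A complex energy above `E`. -/
def approxEnergy (E : ℝ) (j : ℕ) : ℂ := (E : ℂ) + (((1 : ℝ) / ((j : ℝ) + 1) : ℝ) : ℂ) * Complex.I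

lemma approxEnergy_im (E : ℝ) (j : ℕ) : 0 < (approxEnergy E j).im := by
  have : (0 : ℝ) < 1 / ((j : ℝ) + 1) := by positivity
  rwa [approxEnergy, Complex.add_im, Complex.ofReal_im, Complex.im_ofReal_mul, Complex.I_im, mul_one,
    zero_add]

lemma approxEnergy_re (E : ℝ) (j : ℕ) : (approxEnergy E j).re = E := by
  simp [approxEnergy]

lemma tendsto_approxEnergy (E : ℝ) : Tendsto (approxEnergy E) atTop (𝓝 (E : ℂ)) := by
  have h := (Complex.continuous_ofReal.tendsto 0).comp
    (tendsto_one_div_add_atTop_nhds_zero_nat (𝕜 := ℝ))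
  have h2 := (h.mul_const Complex.I).const_add (E : ℂ)
  rw [Complex.ofReal_zero, zero_mul, add_zero] at h2
  exact h2

lemma tendsto_cutSource {ω : Λ → ℝ} {α : ℤ} {E : ℝ} (t : Config Λ (m + 1))
    (hdet : (cutHamiltonian m p.g lam ω α - (E : ℂ) • 1).det ≠ 0) (u : Config Λ (m + 1)) :
    Tendsto (fun j => cutSource m p.g lam ω α (approxEnergy E j) t u) atTop
      (𝓝 (cutSource m p.g lam ω α (E : ℂ) t u)) := by
  unfold cutSource
  split_ifs
  · refine tendsto_finsetSum _ fun y _ => ?_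
    have hd : DifferentiableAt ℂ (fun z => (cutHamiltonian m p.g lam ω α -
        z • (1 : Matrix (Config Λ (m + 1)) (Config Λ (m + 1)) ℂ))⁻¹ y t) (E : ℂ) :=
      differentiableAt_inv_apply (fun i k => by
        simp only [Matrix.sub_apply, Matrix.smul_apply, smul_eq_mul]
        fun_prop) hdet y t
    exact hd.continuousAt.tendsto.comp (tendsto_approxEnergy E)
  · exact tendsto_const_nhds

/-- The fractional moments are uniform in `Im z > 0`, and for each disorder only finitely many
energies are singular. Two applications of Fatou's lemma therefore bring the bound to real energies,
averaged in `E`. -/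
lemma lintegral_sourceMoment_le (h : LawBound ν₀ R W) (hlam : 0 < lam)
    (hsmall : √3 * p.S * apriori R W lam ≤ 1) {α : ℤ} {t : Config Λ (m + 1)}
    (htc : t.Contiguous) (ht : α < t.left) (a : ℝ) :
    ∫⁻ ω, (∫⁻ E in Set.Icc a p.b, sourceMoment m p.g lam α t ω E) ∂disorderLaw Λ ν₀ ≤
      ENNReal.ofReal (p.b - a) * ENNReal.ofReal (Real.exp (-p.μ * |(α : ℝ) - t.left|)) := by
  set F : ℕ → (Λ → ℝ) → ℝ → ENNReal := fun j ω E =>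
    ENNReal.ofReal √(∑ u, ‖cutSource m p.g lam ω α (approxEnergy E j) t u‖) with hF
  have hFm : ∀ j, Measurable (Function.uncurry (F j)) := fun j => by
    simp only [hF]
    refine ENNReal.measurable_ofReal.comp (Measurable.sqrt (Finset.measurable_sum _ fun u _ =>
      Measurable.norm ?_))
    refine measurable_cutSource p measurable_fst ?_ α t u
    unfold approxEnergy
    exact (Complex.measurable_ofReal.comp measurable_snd).add_const _
  have hpt : ∀ ω, ∀ᵐ E ∂(volume.restrict (Set.Icc a p.b)),
      sourceMoment m p.g lam α t ω E ≤ liminf (fun j => F j ω E) atTop := fun ω => by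
    have hfin : ({E : ℝ | (cutHamiltonian m p.g lam ω α - (E : ℂ) • 1).det = 0} ∪ {0}).Finite :=
      (finite_singular _).union (Set.finite_singleton 0)
    have hae : ∀ᵐ E ∂(volume : Measure ℝ), E ∉
        ({E : ℝ | (cutHamiltonian m p.g lam ω α - (E : ℂ) • 1).det = 0} ∪ {0}) :=
      measure_eq_zero_iff_ae_notMem.1 (hfin.measure_zero volume)
    filter_upwards [ae_restrict_of_ae hae] with E hE
    rw [Set.mem_union, not_or] at hE
    have hdet : (cutHamiltonian m p.g lam ω α - (E : ℂ) • 1).det ≠ 0 := hE.1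
    have hE0 : E ≠ 0 := hE.2
    rw [sourceMoment, if_neg (not_or.2 ⟨hdet, hE0⟩)]
    refine le_of_eq (Tendsto.liminf_eq ?_).symm
    refine ENNReal.tendsto_ofReal ((Real.continuous_sqrt.tendsto _).comp ?_)
    exact tendsto_finsetSum _ fun u _ => (tendsto_cutSource p t hdet u).norm
  have hbound : ∀ j, ∫⁻ ω, (∫⁻ E in Set.Icc a p.b, F j ω E) ∂disorderLaw Λ ν₀ ≤
      ENNReal.ofReal (p.b - a) * ENNReal.ofReal (Real.exp (-p.μ * |(α : ℝ) - t.left|)) :=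
      fun j => by
    have : IsProbabilityMeasure (disorderLaw Λ ν₀) := inferInstance
    rw [lintegral_lintegral_swap (hFm j).aemeasurable]
    calc ∫⁻ E in Set.Icc a p.b, ∫⁻ ω, F j ω E ∂disorderLaw Λ ν₀
        ≤ ∫⁻ E in Set.Icc a p.b, ENNReal.ofReal (Real.exp (-p.μ * |(α : ℝ) - t.left|)) :=
          setLIntegral_mono' measurableSet_Icc fun E hE =>
            lintegral_sqrt_cutSource_le p h hlam hsmall (approxEnergy_im E j)
              (by rw [approxEnergy_re]; exact hE.2) htc ht
      _ = _ := by rw [setLIntegral_const, Real.volume_Icc, mul_comm]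
  calc ∫⁻ ω, (∫⁻ E in Set.Icc a p.b, sourceMoment m p.g lam α t ω E) ∂disorderLaw Λ ν₀
      ≤ ∫⁻ ω, (∫⁻ E in Set.Icc a p.b, liminf (fun j => F j ω E) atTop) ∂disorderLaw Λ ν₀ :=
        lintegral_mono fun ω => lintegral_mono_ae (hpt ω)
    _ ≤ ∫⁻ ω, liminf (fun j => ∫⁻ E in Set.Icc a p.b, F j ω E) atTop ∂disorderLaw Λ ν₀ :=
        lintegral_mono fun ω => lintegral_liminf_le fun j => (hFm j).of_uncurry_left
    _ ≤ liminf (fun j => ∫⁻ ω, (∫⁻ E in Set.Icc a p.b, F j ω E) ∂disorderLaw Λ ν₀) atTop :=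
        lintegral_liminf_le fun j => (hFm j).lintegral_prod_right
    _ ≤ _ := liminf_le_of_le (by isBoundedDefault) fun b hb => by
        obtain ⟨j, hj⟩ := hb.exists
        exact hj.trans (hbound j)

/-- The share of `u` in the source. -/
def sourceShare (m : ℕ) (g lam : ℝ) (α : ℤ) (t u : Config Λ (m + 1)) (ω : Λ → ℝ) (E : ℝ) : ℝ :=
  ‖cutSource m g lam ω α (E : ℂ) t u‖ / ∑ u', ‖cutSource m g lam ω α (E : ℂ) t u'‖

lemma sourceShare_nonneg (g lam : ℝ) (α : ℤ) (t u : Config Λ (m + 1)) (ω : Λ → ℝ) (E : ℝ) :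
    0 ≤ sourceShare m g lam α t u ω E :=
  div_nonneg (norm_nonneg _) (Finset.sum_nonneg fun _ _ => norm_nonneg _)

lemma sum_sourceShare_le (g lam : ℝ) (α : ℤ) (t : Config Λ (m + 1)) (ω : Λ → ℝ) (E : ℝ) :
    ∑ u, sourceShare m g lam α t u ω E ≤ 1 := by
  unfold sourceShare
  rw [← Finset.sum_div]
  exact div_self_le_one _

lemma sourceShare_update (ω : Λ → ℝ) {α : Λ} (v : ℝ) (t u : Config Λ (m + 1)) (E : ℝ) :
    sourceShare m p.g lam α t u (Function.update ω α v) E =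
      sourceShare m p.g lam α t u ω E := by
  simp only [sourceShare, cutSource_update p]

lemma measurable_sourceShare (α : ℤ) (t u : Config Λ (m + 1)) :
    Measurable (Function.uncurry (sourceShare m p.g lam α t u)) := by
  have h : ∀ u, Measurable fun q : (Λ → ℝ) × ℝ =>
      ‖cutSource m p.g lam q.1 α (q.2 : ℂ) t u‖ := fun u =>
    (measurable_cutSource p measurable_fst (Complex.measurable_ofReal.comp measurable_snd)
      α t u).norm
  exact (h u).div (Finset.measurable_sum _ fun u _ => h u)

/-- Using the first bound twice and the second once gives `P³ ≤ x y²`, where `x` and `y` are the two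
terms on the right. The exponents are chosen so that only `√N` appears, since only half moments of
the source are under control, and so that `a`, `b`, `c` enter quadratically, as spectral weights. -/
lemma interpolation_bound {P a b c N τ : ℝ} (hP : 0 ≤ P) (hN : 0 ≤ N) (hτ : 0 < τ) (h1 : P ≤ a * b) (h2 : P ≤ a * c * N) :
    P ≤ τ * b ^ 2 + √N / √τ * (a ^ 2 + c ^ 2) := by
  set x := τ * b ^ 2 with hx
  set y := √N / √τ * (a ^ 2 + c ^ 2) with hy
  have hx0 : 0 ≤ x := by positivity
  have hy0 : 0 ≤ y := by positivity
  have hxy : x * y ^ 2 = b ^ 2 * N * (a ^ 2 + c ^ 2) ^ 2 := by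
    rw [hx, hy, mul_pow, div_pow, Real.sq_sqrt hN, Real.sq_sqrt hτ.le]
    field_simp
  have hcube : P ^ 3 ≤ (x + y) ^ 3 := by
    have h3 : P ^ 3 ≤ (a * b) ^ 2 * (a * c * N) := by
      calc P ^ 3 = P ^ 2 * P := by ring
        _ ≤ (a * b) ^ 2 * (a * c * N) := by gcongr
    have h4 : a ^ 3 * c ≤ (a ^ 2 + c ^ 2) ^ 2 := by
      nlinarith [sq_nonneg (a ^ 2 - a * c), mul_nonneg (sq_nonneg a) (sq_nonneg c),
        sq_nonneg (c ^ 2), sq_nonneg (a ^ 2)]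
    have h5 : (a * b) ^ 2 * (a * c * N) ≤ x * y ^ 2 := by
      rw [hxy]
      calc (a * b) ^ 2 * (a * c * N) = b ^ 2 * N * (a ^ 3 * c) := by ring
        _ ≤ _ := by gcongr
    have h6 : x * y ^ 2 ≤ (x + y) ^ 3 := by
      nlinarith [mul_nonneg hx0 hy0, mul_nonneg (mul_nonneg hx0 hx0) hx0,
        mul_nonneg (mul_nonneg hx0 hx0) hy0, mul_nonneg (mul_nonneg hx0 hy0) hy0,
        mul_nonneg (mul_nonneg hy0 hy0) hy0]
    linarith
  exact le_of_pow_le_pow_left₀ (by norm_num) (by positivity) hcube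

/-- Interpolates between plain Cauchy–Schwarz and the source representation. In the latter,
Cauchy–Schwarz weighted by the source turns the entries at `u` into an average of spectral weights.
-/
lemma entry_le_source {ω : Λ → ℝ} {α : ℤ} {E : ℝ} {s t : Config Λ (m + 1)} (ht : α < t.left)
    (hdet : (cutHamiltonian m p.g lam ω α - (E : ℂ) • 1).det ≠ 0) (hE : E ≠ 0) {τ : ℝ}
    (hτ : 0 < τ) :
    ‖eigenprojectionEntry (hamiltonian (m + 1) p.g lam ω) E s t‖ ≤
      τ * eigWeight (hamiltonian (m + 1) p.g lam ω) E t +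
        √(∑ u, ‖cutSource m p.g lam ω α (E : ℂ) t u‖) / √τ *
          (eigWeight (hamiltonian (m + 1) p.g lam ω) E s +
            ∑ u, sourceShare m p.g lam α t u ω E *
              eigWeight (hamiltonian (m + 1) p.g lam ω) E u) := by
  set H := hamiltonian (m + 1) p.g lam ω
  set N := ∑ u, ‖cutSource m p.g lam ω α (E : ℂ) t u‖ with hN
  have hN0 : 0 ≤ N := Finset.sum_nonneg fun _ _ => norm_nonneg _
  set q := ∑ u, sourceShare m p.g lam α t u ω E * eigWeight H E u with hq
  have hq0 : 0 ≤ q := Finset.sum_nonneg fun u _ =>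
    mul_nonneg (sourceShare_nonneg _ _ _ _ _ _ _) (eigWeight_nonneg _ _ _)
  have hNq : N * q = ∑ u, ‖cutSource m p.g lam ω α (E : ℂ) t u‖ * eigWeight H E u := by
    rcases hN0.eq_or_lt with h0 | hpos
    · rw [← h0, zero_mul]
      have := (Finset.sum_eq_zero_iff_of_nonneg (fun u _ => norm_nonneg _)).1 h0.symm
      exact (Finset.sum_eq_zero fun u hu => by rw [this u hu, zero_mul]).symm
    · rw [hq, Finset.mul_sum]
      refine Finset.sum_congr rfl fun u _ => ?_
      rw [sourceShare, ← hN]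
      field_simp
  have h1 := norm_eigenprojectionEntry_le H E s t
  have h2 : ‖eigenprojectionEntry H E s t‖ ≤ √(eigWeight H E s) * √q * N := by
    rw [norm_eigenprojectionEntry_comm, eigenprojectionEntry_eq_sum_cutSource p hdet
      (by exact_mod_cast hE) ht rfl s]
    calc ‖∑ u, cutSource m p.g lam ω α (E : ℂ) t u * eigenprojectionEntry H E u s‖
        ≤ ∑ u, ‖cutSource m p.g lam ω α (E : ℂ) t u‖ *
          (√(eigWeight H E u) * √(eigWeight H E s)) := by
          refine (norm_sum_le _ _).trans (Finset.sum_le_sum fun u _ => ?_)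
          rw [norm_mul]
          gcongr
          exact norm_eigenprojectionEntry_le H E u s
      _ = √(eigWeight H E s) * ∑ u, ‖cutSource m p.g lam ω α (E : ℂ) t u‖ *
          √(eigWeight H E u) := by
          rw [Finset.mul_sum]
          exact Finset.sum_congr rfl fun u _ => by ring
      _ ≤ √(eigWeight H E s) * (√q * N) := by
          gcongr
          refine abs_le_of_sq_le_sq' ?_ (by positivity) |>.2
          rw [mul_pow, Real.sq_sqrt hq0]
          have h3 := Finset.sum_mul_sq_le_sq_mul_sq Finset.univ
            (fun u => √‖cutSource m p.g lam ω α (E : ℂ) t u‖)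
            (fun u => √‖cutSource m p.g lam ω α (E : ℂ) t u‖ * √(eigWeight H E u))
          have e1 : ∀ u, √‖cutSource m p.g lam ω α (E : ℂ) t u‖ *
              (√‖cutSource m p.g lam ω α (E : ℂ) t u‖ * √(eigWeight H E u)) =
              ‖cutSource m p.g lam ω α (E : ℂ) t u‖ * √(eigWeight H E u) := fun u => by
            rw [← mul_assoc, Real.mul_self_sqrt (norm_nonneg _)]
          have e2 : ∀ u, (√‖cutSource m p.g lam ω α (E : ℂ) t u‖ * √(eigWeight H E u)) ^ 2 =
              ‖cutSource m p.g lam ω α (E : ℂ) t u‖ * eigWeight H E u := fun u => by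
            rw [mul_pow, Real.sq_sqrt (norm_nonneg _), Real.sq_sqrt (eigWeight_nonneg _ _ _)]
          simp only [e1, e2, Real.sq_sqrt (norm_nonneg _)] at h3
          rw [← hNq, ← hN] at h3
          linarith
      _ = _ := by ring
  have h3 := interpolation_bound (norm_nonneg _) hN0 hτ h1 h2
  rwa [Real.sq_sqrt (eigWeight_nonneg _ _ _), Real.sq_sqrt (eigWeight_nonneg _ _ _),
    Real.sq_sqrt hq0] at h3

/-- Pointwise bound for the correlator by spectral integrals of the source. -/
lemma ofReal_correlator_le_source {ω : Λ → ℝ} {α : ℤ} {s t : Config Λ (m + 1)} (ht : α < t.left)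
    {τ : ℝ} (hτ : 0 < τ) (I : Set ℝ) :
    ENNReal.ofReal (correlator (hamiltonian (m + 1) p.g lam ω) I s t) ≤ ENNReal.ofReal τ +
      ENNReal.ofReal (√τ)⁻¹ *
        (∫⁻ E, I.indicator (sourceMoment m p.g lam α t ω) E
          ∂specMeasure (hamiltonian (m + 1) p.g lam ω) s +
        ∑ u, ∫⁻ E, I.indicator (fun E => sourceMoment m p.g lam α t ω E *
          ENNReal.ofReal (sourceShare m p.g lam α t u ω E)) E
          ∂specMeasure (hamiltonian (m + 1) p.g lam ω) u) := by
  classical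
  set H := hamiltonian (m + 1) p.g lam ω with hHdef
  have hH : H.IsHermitian := hamiltonian_isHermitian _ _ _ _
  simp only [lintegral_specMeasure]
  have hspec : spectrumIn H I = (specSet H).filter (· ∈ I) := by
    ext E; rw [mem_spectrumIn, Finset.mem_filter]
  have hτsum : ENNReal.ofReal τ = ∑ E ∈ specSet H, ENNReal.ofReal (τ * eigWeight H E t) := by
    rw [← ENNReal.ofReal_sum_of_nonneg fun E _ => mul_nonneg hτ.le (eigWeight_nonneg _ _ _),
      ← Finset.mul_sum, sum_eigWeight hH, mul_one]
  rw [Finset.sum_comm, ← Finset.sum_add_distrib, Finset.mul_sum, hτsum, ← Finset.sum_add_distrib,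
    correlator, ENNReal.ofReal_sum_of_nonneg fun _ _ => norm_nonneg _, hspec, Finset.sum_filter]
  refine Finset.sum_le_sum fun E _ => ?_
  split_ifs with hE
  swap
  · exact zero_le
  simp only [Set.indicator_of_mem hE]
  -- At singular energies the right side is infinite unless `s` has weight zero, in which case the
  -- left side vanishes.
  by_cases hsing : (cutHamiltonian m p.g lam ω α - (E : ℂ) • 1).det = 0 ∨ E = 0
  · have htop : sourceMoment m p.g lam α t ω E = ⊤ := by rw [sourceMoment, if_pos hsing]
    rcases (eigWeight_nonneg H E s).eq_or_lt with h0 | hpos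
    · have h1 := norm_eigenprojectionEntry_le H E s t
      rw [← h0, Real.sqrt_zero, zero_mul] at h1
      rw [ENNReal.ofReal_of_nonpos h1]
      exact zero_le
    · rw [htop, ENNReal.mul_top (by simpa using hpos), top_add, ENNReal.mul_top (by simpa using hτ),
        add_top]
      exact le_top
  · rw [not_or] at hsing
    have hm : sourceMoment m p.g lam α t ω E =
        ENNReal.ofReal √(∑ u, ‖cutSource m p.g lam ω α (E : ℂ) t u‖) := by
      rw [sourceMoment, if_neg (not_or.2 hsing)]
    rw [hm]
    refine (ENNReal.ofReal_le_ofReal (entry_le_source p (s := s) ht hsing.1 hsing.2 hτ)).trans ?_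
    have hsh : ∀ u, 0 ≤ sourceShare m p.g lam α t u ω E := fun u =>
      sourceShare_nonneg _ _ _ _ _ _ _
    have hw : ∀ u, 0 ≤ eigWeight H E u := fun u => eigWeight_nonneg _ _ _
    rw [ENNReal.ofReal_add (mul_nonneg hτ.le (hw t)) (mul_nonneg (by positivity)
      (add_nonneg (hw s) (Finset.sum_nonneg fun u _ => mul_nonneg (hsh u) (hw u))))]
    refine add_le_add le_rfl (le_of_eq ?_)
    rw [div_mul_eq_mul_div, div_eq_inv_mul, ENNReal.ofReal_mul (by positivity), mul_add,
      ENNReal.ofReal_add (mul_nonneg (by positivity) (hw s)) (mul_nonneg (by positivity)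
        (Finset.sum_nonneg fun u _ => mul_nonneg (hsh u) (hw u))), Finset.mul_sum,
      ENNReal.ofReal_sum_of_nonneg fun u _ => mul_nonneg (by positivity)
        (mul_nonneg (hsh u) (hw u))]
    congr 2
    · rw [← ENNReal.ofReal_mul (hw s), mul_comm]
    · refine Finset.sum_congr rfl fun u _ => ?_
      rw [← ENNReal.ofReal_mul (by positivity), ← ENNReal.ofReal_mul (hw u)]
      congr 1
      ring

/-- Disorder average of spectral integrals of functions independent of the disorder at the leftmost
site of `u`. -/
lemma lintegral_specMeasure_disorder_le (h : LawBound ν₀ R W) (hlam : 0 < lam)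
    (u : Config Λ (m + 1)) {F : (Λ → ℝ) → ℝ → ENNReal} (hF : Measurable (Function.uncurry F))
    (hupd : ∀ ω v, F (Function.update ω (u.pos 0) v) = F ω) :
    ∫⁻ ω, ∫⁻ E, F ω E ∂specMeasure (hamiltonian (m + 1) p.g lam ω) u ∂disorderLaw Λ ν₀ ≤
      ENNReal.ofReal (R * (2 * Real.pi / lam)) * ∫⁻ ω, (∫⁻ E, F ω E) ∂disorderLaw Λ ν₀ := by
  obtain ⟨c, hc⟩ := Λ.bddBelow
  have hβ : ∀ v ∈ Λ, c - 1 < v := fun v hv => by have := hc hv; omega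
  simp only [← cutHamiltonian_eq (m := m) (g := p.g) (lam := lam) hβ]
  have hmeas : Measurable fun ω => ∫⁻ E, F ω E ∂specMeasure (cutHamiltonian m p.g lam ω (c - 1)) u :=
    measurable_lintegral_specMeasure (measurable_cutHamiltonian _ _ _)
      (fun ω => cutHamiltonian_isHermitian _ _ _ _) u hF
  unfold disorderLaw
  rw [lintegral_resample ν₀ hmeas (u.pos 0), ← lintegral_const_mul' _ _ ENNReal.ofReal_ne_top]
  refine lintegral_mono fun ω => (h.lintegral_le _).trans ?_
  simp only [hupd]
  have h1 := lintegral_specMeasure_averaging (A := occupied m (c - 1) (u.pos 0)) (s := u)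
    (cutHamiltonian_isHermitian p.g lam (Function.update ω (u.pos 0) 0) (c - 1)) hlam
    (by
      simp only [occupied, Finset.mem_filter, Finset.mem_univ, true_and]
      exact ⟨hβ _ (u.pos 0).2, 0, rfl⟩) h.W_pos (hF.of_uncurry_left (x := ω))
  simp only [← cutHamiltonian_update] at h1
  calc (R : ENNReal) * _ ≤ (R : ENNReal) * (ENNReal.ofReal (2 * Real.pi / lam) * ∫⁻ E, F ω E) := by
        gcongr
    _ = _ := by
      rw [← mul_assoc, ENNReal.ofReal_mul (p := (R : ℝ)) R.coe_nonneg, ENNReal.ofReal_coe_nnreal]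

lemma measurable_indicator_uncurry {F : (Λ → ℝ) → ℝ → ENNReal}
    (hF : Measurable (Function.uncurry F)) {I : Set ℝ} (hI : MeasurableSet I) :
    Measurable (Function.uncurry fun ω => I.indicator (F ω)) :=
  hF.indicator (measurable_snd hI)

lemma measurable_correlator_hamiltonian {I : Set ℝ} (hI : MeasurableSet I)
    (s t : Config Λ (m + 1)) :
    Measurable fun ω : Λ → ℝ => correlator (hamiltonian (m + 1) p.g lam ω) I s t := by
  obtain ⟨c, hc⟩ := Λ.bddBelow
  have hβ : ∀ v ∈ Λ, c - 1 < v := fun v hv => by have := hc hv; omega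
  simp only [← cutHamiltonian_eq (m := m) (g := p.g) (lam := lam) hβ]
  exact measurable_correlator (measurable_cutHamiltonian _ _ _)
    (fun ω => cutHamiltonian_isHermitian _ _ _ _) hI s t

/-- With the cut at `α = s.left`, the source moment and its shares do not depend on `ω α`, while `s`
and every contributing `u` occupy `α`. Spectral averaging thus replaces each spectral measure by
Lebesgue measure. The `u`-terms recombine because the shares sum to at most 1, which avoids a count
of configurations. -/
lemma lintegral_correlator_lt (h : LawBound ν₀ R W) (hlam : 0 < lam)
    (hsmall : √3 * p.S * apriori R W lam ≤ 1) {s t : Config Λ (m + 1)}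
    (htc : t.Contiguous) (hst : s.left < t.left) (a : ℝ) {τ : ℝ} (hτ : 0 < τ) :
    ∫⁻ ω, ENNReal.ofReal (correlator (hamiltonian (m + 1) p.g lam ω) (Set.Icc a p.b) s t)
      ∂disorderLaw Λ ν₀ ≤ ENNReal.ofReal τ + ENNReal.ofReal (√τ)⁻¹ *
        (ENNReal.ofReal (R * (2 * Real.pi / lam)) * (2 * (ENNReal.ofReal (p.b - a) *
          ENNReal.ofReal (Real.exp (-p.μ * |(s.left : ℝ) - t.left|))))) := by
  set I := Set.Icc a p.b with hI
  have hIm : MeasurableSet I := measurableSet_Icc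
  set N : (Λ → ℝ) → ℝ → ENNReal := fun ω => I.indicator (sourceMoment m p.g lam s.left t ω) with hN
  set M : Config Λ (m + 1) → (Λ → ℝ) → ℝ → ENNReal := fun u ω => I.indicator fun E =>
    sourceMoment m p.g lam s.left t ω E *
      ENNReal.ofReal (sourceShare m p.g lam s.left t u ω E) with hM
  have hNm : Measurable (Function.uncurry N) :=
    measurable_indicator_uncurry (measurable_sourceMoment p _ _) hIm
  have hMm : ∀ u, Measurable (Function.uncurry (M u)) := fun u =>
    measurable_indicator_uncurry (F := fun ω E => sourceMoment m p.g lam s.left t ω E *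
      ENNReal.ofReal (sourceShare m p.g lam s.left t u ω E))
      ((measurable_sourceMoment p _ _).mul
        (ENNReal.measurable_ofReal.comp (measurable_sourceShare p _ _ _))) hIm
  obtain ⟨c, hc⟩ := Λ.bddBelow
  have hβ : ∀ v ∈ Λ, c - 1 < v := fun v hv => by have := hc hv; omega
  have hspecm : ∀ (u : Config Λ (m + 1)) {F : (Λ → ℝ) → ℝ → ENNReal},
      Measurable (Function.uncurry F) → Measurable fun ω =>
        ∫⁻ E, F ω E ∂specMeasure (hamiltonian (m + 1) p.g lam ω) u := fun u F hF => by
    simp only [← cutHamiltonian_eq (m := m) (g := p.g) (lam := lam) hβ]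
    exact measurable_lintegral_specMeasure (measurable_cutHamiltonian _ _ _)
      (fun ω => cutHamiltonian_isHermitian _ _ _ _) u hF
  set C := ENNReal.ofReal (R * (2 * Real.pi / lam)) with hC
  have hone : ∫⁻ ω, (∫⁻ E, N ω E) ∂disorderLaw Λ ν₀ ≤ ENNReal.ofReal (p.b - a) *
      ENNReal.ofReal (Real.exp (-p.μ * |(s.left : ℝ) - t.left|)) := by
    simp only [hN, lintegral_indicator hIm]
    exact lintegral_sourceMoment_le p h hlam hsmall htc hst a
  have hs : ∫⁻ ω, ∫⁻ E, N ω E ∂specMeasure (hamiltonian (m + 1) p.g lam ω) s ∂disorderLaw Λ ν₀ ≤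
      C * ∫⁻ ω, (∫⁻ E, N ω E) ∂disorderLaw Λ ν₀ := by
    refine lintegral_specMeasure_disorder_le p h hlam s hNm fun ω v => ?_
    simp only [hN]
    congr 1
    funext E
    exact sourceMoment_update p ω v t E
  have hu : ∀ u, ∫⁻ ω, ∫⁻ E, M u ω E ∂specMeasure (hamiltonian (m + 1) p.g lam ω) u
      ∂disorderLaw Λ ν₀ ≤ C * ∫⁻ ω, (∫⁻ E, M u ω E) ∂disorderLaw Λ ν₀ := fun u => by
    by_cases hul : u.left = s.left
    · refine lintegral_specMeasure_disorder_le p h hlam u (hMm u) fun ω v => ?_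
      simp only [hM]
      congr 1
      funext E
      have hpos : u.pos 0 = s.pos 0 := Subtype.ext hul
      rw [hpos]
      congr 1
      · exact sourceMoment_update p ω v t E
      · congr 1
        exact sourceShare_update p ω v t u E
    · have hz : ∀ ω E, M u ω E = 0 := fun ω E => by
        have : sourceShare m p.g lam s.left t u ω E = 0 := by
          simp [sourceShare, cutSource, hul]
        simp [hM, this, Set.indicator]
      simp [hz]
  have hsumM : ∑ u, ∫⁻ ω, (∫⁻ E, M u ω E) ∂disorderLaw Λ ν₀ ≤
      ∫⁻ ω, (∫⁻ E, N ω E) ∂disorderLaw Λ ν₀ := by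
    rw [← lintegral_finsetSum _ fun u _ => (hMm u).lintegral_prod_right]
    refine lintegral_mono fun ω => ?_
    rw [← lintegral_finsetSum _ fun u _ => (hMm u).of_uncurry_left]
    refine lintegral_mono fun E => ?_
    by_cases hE : E ∈ I
    · simp only [hM, hN, Set.indicator_of_mem hE]
      rw [← Finset.mul_sum, ← ENNReal.ofReal_sum_of_nonneg fun u _ =>
        sourceShare_nonneg _ _ _ _ _ _ _]
      refine (mul_le_mul_right (ENNReal.ofReal_le_ofReal (sum_sourceShare_le _ _ _ _ _ _)) _).trans ?_
      simp
    · simp [hM, hN, Set.indicator_of_notMem hE]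
  calc ∫⁻ ω, ENNReal.ofReal (correlator (hamiltonian (m + 1) p.g lam ω) I s t) ∂disorderLaw Λ ν₀
      ≤ ∫⁻ ω, (ENNReal.ofReal τ + ENNReal.ofReal (√τ)⁻¹ *
        (∫⁻ E, N ω E ∂specMeasure (hamiltonian (m + 1) p.g lam ω) s +
        ∑ u, ∫⁻ E, M u ω E ∂specMeasure (hamiltonian (m + 1) p.g lam ω) u)) ∂disorderLaw Λ ν₀ :=
        lintegral_mono fun ω => ofReal_correlator_le_source p hst hτ I
    _ = ENNReal.ofReal τ + ENNReal.ofReal (√τ)⁻¹ *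
        (∫⁻ ω, ∫⁻ E, N ω E ∂specMeasure (hamiltonian (m + 1) p.g lam ω) s ∂disorderLaw Λ ν₀ +
        ∑ u, ∫⁻ ω, ∫⁻ E, M u ω E ∂specMeasure (hamiltonian (m + 1) p.g lam ω) u
          ∂disorderLaw Λ ν₀) := by
        rw [lintegral_add_left measurable_const, lintegral_const_mul' _ _ ENNReal.ofReal_ne_top,
          lintegral_add_left (hspecm s hNm), lintegral_finsetSum _ fun u _ => hspecm u (hMm u)]
        simp
    _ ≤ ENNReal.ofReal τ + ENNReal.ofReal (√τ)⁻¹ *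
        (C * (∫⁻ ω, (∫⁻ E, N ω E) ∂disorderLaw Λ ν₀) +
        ∑ u, C * ∫⁻ ω, (∫⁻ E, M u ω E) ∂disorderLaw Λ ν₀) := by
        gcongr with u _
        exact hu u
    _ ≤ _ := by
        rw [← Finset.mul_sum, ← mul_add]
        gcongr
        rw [two_mul]
        exact add_le_add hone (hsumM.trans hone)

/-- Exponential decay of averaged correlators between contiguous configurations. -/
lemma lintegral_correlator_le (h : LawBound ν₀ R W) (hlam : 1 ≤ lam)
    (hsmall : √3 * p.S * apriori R W lam ≤ 1) {s t : Config Λ (m + 1)}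
    (hsc : s.Contiguous) (htc : t.Contiguous) {a : ℝ} (hab : a ≤ p.b) :
    ∫⁻ ω, ENNReal.ofReal (correlator (hamiltonian (m + 1) p.g lam ω) (Set.Icc a p.b) s t)
      ∂disorderLaw Λ ν₀ ≤ ENNReal.ofReal ((1 + 4 * Real.pi * R * (p.b - a)) *
        Real.exp (-p.μ / 2 * |(s.left : ℝ) - t.left|)) := by
  have hba : 0 ≤ p.b - a := by linarith
  have key : ∀ s t : Config Λ (m + 1), t.Contiguous → s.left < t.left →
      ∫⁻ ω, ENNReal.ofReal (correlator (hamiltonian (m + 1) p.g lam ω) (Set.Icc a p.b) s t)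
      ∂disorderLaw Λ ν₀ ≤ ENNReal.ofReal ((1 + 4 * Real.pi * R * (p.b - a)) *
        Real.exp (-p.μ / 2 * |(s.left : ℝ) - t.left|)) := by
    intro s t htc hst
    set d := |(s.left : ℝ) - t.left| with hd
    have hd0 : 0 ≤ d := abs_nonneg _
    -- The choice `τ = exp (-μ d)` makes the second term `exp (μ d / 2) exp (-μ d)`, so half the
    -- rate survives.
    refine (lintegral_correlator_lt p h (by linarith) hsmall htc hst a
      (Real.exp_pos (-p.μ * d))).trans ?_
    have e1 : (√(Real.exp (-p.μ * d)))⁻¹ = Real.exp (p.μ / 2 * d) := by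
      rw [← Real.exp_half, ← Real.exp_neg]; congr 1; ring
    rw [e1, ← hd, show (2 : ENNReal) = ENNReal.ofReal 2 by simp,
      ← ENNReal.ofReal_mul hba, ← ENNReal.ofReal_mul (by norm_num),
      ← ENNReal.ofReal_mul (by positivity), ← ENNReal.ofReal_mul (by positivity),
      ← ENNReal.ofReal_add (by positivity) (by positivity)]
    refine ENNReal.ofReal_le_ofReal ?_
    have hμ := p.μ_pos
    have h1 : Real.exp (-p.μ * d) ≤ Real.exp (-p.μ / 2 * d) := by
      rw [Real.exp_le_exp]; nlinarith
    have h2 : Real.exp (p.μ / 2 * d) * Real.exp (-p.μ * d) = Real.exp (-p.μ / 2 * d) := by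
      rw [← Real.exp_add]; congr 1; ring
    have h3 : 2 * Real.pi / lam ≤ 2 * Real.pi := div_le_self (by positivity) hlam
    calc Real.exp (-p.μ * d) + Real.exp (p.μ / 2 * d) *
          (R * (2 * Real.pi / lam) * (2 * ((p.b - a) * Real.exp (-p.μ * d))))
        = Real.exp (-p.μ * d) + R * (2 * Real.pi / lam) * 2 * (p.b - a) *
          (Real.exp (p.μ / 2 * d) * Real.exp (-p.μ * d)) := by ring
      _ ≤ Real.exp (-p.μ / 2 * d) + R * (2 * Real.pi) * 2 * (p.b - a) *
          Real.exp (-p.μ / 2 * d) := by rw [h2]; gcongr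
      _ = _ := by ring
  rcases lt_trichotomy s.left t.left with hst | hst | hst
  · exact key s t htc hst
  · calc ∫⁻ ω, ENNReal.ofReal (correlator (hamiltonian (m + 1) p.g lam ω) (Set.Icc a p.b) s t)
          ∂disorderLaw Λ ν₀ ≤ ∫⁻ _ω, 1 ∂disorderLaw Λ ν₀ := lintegral_mono fun ω => by
          rw [← ENNReal.ofReal_one]
          exact ENNReal.ofReal_le_ofReal (correlator_le_one (hamiltonian_isHermitian _ _ _ _) _ _ _)
      _ = ENNReal.ofReal 1 := by simp
      _ ≤ _ := by
          refine ENNReal.ofReal_le_ofReal ?_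
          rw [hst, sub_self, abs_zero, mul_zero, Real.exp_zero, mul_one]
          have : 0 ≤ 4 * Real.pi * R * (p.b - a) := by positivity
          linarith
  · simp only [correlator_comm _ _ s t]
    rw [abs_sub_comm]
    exact key t s hsc hst

end Correlators

end HardCore

end

noncomputable section

namespace HardCore

/-! ### Summation over configurations and rarity of bad blocks -/

section Localization

variable {Λ : Finset ℤ} {m : ℕ} (p : Params)

lemma summedCorrelator_eq (n : ℕ) (g lam : ℝ) (ω : Λ → ℝ) (U V : Finset ℤ) (I : Set ℝ) :
    summedCorrelator n g lam ω U V I =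
      ∑ x : Config Λ n with (x.sites ∩ U).Nonempty, ∑ y : Config Λ n with (y.sites ∩ V).Nonempty,
        correlator (hamiltonian n g lam ω) I x y := by
  unfold summedCorrelator correlator
  rw [Finset.sum_comm]
  refine Finset.sum_congr (by congr) fun x _ => ?_
  rw [Finset.sum_comm]

lemma summedCorrelator_comm (n : ℕ) (g lam : ℝ) (ω : Λ → ℝ) (U V : Finset ℤ) (I : Set ℝ) :
    summedCorrelator n g lam ω U V I = summedCorrelator n g lam ω V U I := by
  rw [summedCorrelator_eq, summedCorrelator_eq, Finset.sum_comm]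
  simp only [correlator_comm _ I]

lemma siteDist_comm (U V : Finset ℤ) : siteDist U V = siteDist V U := by
  unfold siteDist
  congr 1
  ext r
  constructor
  · rintro ⟨u, hu, v, hv, rfl⟩
    exact ⟨v, hv, u, hu, by omega⟩
  · rintro ⟨u, hu, v, hv, rfl⟩
    exact ⟨v, hv, u, hu, by omega⟩

lemma siteDist_le {U V : Finset ℤ} {u v : ℤ} (hu : u ∈ U) (hv : v ∈ V) :
    siteDist U V ≤ (u - v).natAbs := Nat.sInf_le ⟨u, hu, v, hv, rfl⟩

/-- Of two disjoint connected sets, one lies to the left of the other. -/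
lemma IsConnectedSites.lt_or_lt {U V : Finset ℤ} (hU : IsConnectedSites U)
    (hV : IsConnectedSites V) (h : Disjoint U V) :
    (∀ u ∈ U, ∀ v ∈ V, u < v) ∨ ∀ u ∈ U, ∀ v ∈ V, v < u := by
  have hne : ∀ u ∈ U, ∀ v ∈ V, u ≠ v := fun u hu v hv => Finset.disjoint_iff_ne.1 h u hu v hv
  by_contra hcon
  push Not at hcon
  obtain ⟨⟨u, hu, v, hv, huv⟩, u', hu', v', hv', huv'⟩ := hcon
  rcases le_total u' v with h1 | h1
  · exact hne v (hU.2.out hu' hu ⟨h1, huv⟩ |> fun h => by exact_mod_cast h) v hv rfl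
  · exact hne u' hu' u' (hV.2.out hv hv' ⟨h1, huv'⟩ |> fun h => by exact_mod_cast h) rfl

/-- The concentration estimate is applied in each variable in turn, using the symmetry of the
moduli. The weights equal 1 on the sets summed over and decay away from them. -/
lemma sum_sum_eigenprojectionEntry_le {lam : ℝ} (hlam : 0 ≤ lam) {ω : Λ → ℝ} (hω : ∀ α, 0 ≤ ω α)
    {E : ℝ} (hE : E ≤ p.b) {φ ψ : Config Λ (m + 1) → ℝ}
    (hφ : ∀ x, ∀ y ∈ x.nbrs, |φ x - φ y| ≤ 1) (hψ : ∀ x, ∀ y ∈ x.nbrs, |ψ x - ψ y| ≤ 1)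
    {A B : Finset (Config Λ (m + 1))} (hA : ∀ x ∈ A, φ x = 0) (hB : ∀ y ∈ B, ψ y = 0) :
    ∑ x ∈ A, ∑ y ∈ B, ‖eigenprojectionEntry (hamiltonian (m + 1) p.g lam ω) E x y‖ ≤
      9 / 4 * ∑ s ∈ badSet p m lam ω, ∑ t ∈ badSet p m lam ω,
        Real.exp (-p.ν * φ s) * Real.exp (-p.ν * ψ t) *
          ‖eigenprojectionEntry (hamiltonian (m + 1) p.g lam ω) E s t‖ := by
  set N : Config Λ (m + 1) → Config Λ (m + 1) → ℝ := fun x y =>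
    ‖eigenprojectionEntry (hamiltonian (m + 1) p.g lam ω) E x y‖ with hN
  have hNc : ∀ x y, N x y = N y x := fun x y => norm_eigenprojectionEntry_comm _ _ _ _
  have half : ∀ {χ : Config Λ (m + 1) → ℝ} {D : Finset (Config Λ (m + 1))},
      (∀ x, ∀ y ∈ x.nbrs, |χ x - χ y| ≤ 1) → (∀ x ∈ D, χ x = 0) → ∀ y,
      ∑ x ∈ D, N x y ≤ 3 / 2 * ∑ s ∈ badSet p m lam ω, Real.exp (-p.ν * χ s) * N s y := by
    intro χ D hχ hD y
    refine le_trans ?_ (sum_eigenprojectionEntry_le p hlam hω hE hχ y)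
    calc ∑ x ∈ D, N x y = ∑ x ∈ D, Real.exp (-p.ν * χ x) * N x y :=
          Finset.sum_congr rfl fun x hx => by rw [hD x hx]; simp
      _ ≤ _ := Finset.sum_le_sum_of_subset_of_nonneg (Finset.subset_univ _)
          fun _ _ _ => by positivity
  calc ∑ x ∈ A, ∑ y ∈ B, N x y
      ≤ ∑ x ∈ A, 3 / 2 * ∑ t ∈ badSet p m lam ω, Real.exp (-p.ν * ψ t) * N t x := by
        refine Finset.sum_le_sum fun x _ => ?_
        simp only [hNc x]
        exact half hψ hB x
    _ = 3 / 2 * ∑ t ∈ badSet p m lam ω, Real.exp (-p.ν * ψ t) * ∑ x ∈ A, N x t := by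
        rw [← Finset.mul_sum, Finset.sum_comm]
        simp only [← Finset.mul_sum, hNc]
    _ ≤ 3 / 2 * ∑ t ∈ badSet p m lam ω, Real.exp (-p.ν * ψ t) *
        (3 / 2 * ∑ s ∈ badSet p m lam ω, Real.exp (-p.ν * φ s) * N s t) := by
        gcongr with t _
        exact half hφ hA t
    _ = _ := by
        rw [Finset.sum_comm (s := badSet p m lam ω) (t := badSet p m lam ω)]
        simp only [Finset.mul_sum]
        refine Finset.sum_congr rfl fun t _ => Finset.sum_congr rfl fun s _ => ?_
        ring

/-- The excess of the leftmost particle over `u`. -/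
def leftExcess (u : ℤ) (x : Config Λ (m + 1)) : ℝ := max ((x.left : ℝ) - u) 0

/-- The deficit of the rightmost particle below `v`. -/
def rightDeficit (v : ℤ) (x : Config Λ (m + 1)) : ℝ := max ((v : ℝ) - x.right) 0

lemma abs_leftExcess_sub_le (u : ℤ) (x y : Config Λ (m + 1)) (hy : y ∈ x.nbrs) :
    |leftExcess u x - leftExcess u y| ≤ 1 := by
  have h : |(x.left : ℝ) - y.left| ≤ 1 := by exact_mod_cast Config.abs_left_sub_le hy
  refine (abs_max_sub_max_le_abs _ _ _).trans ?_
  rwa [sub_sub_sub_cancel_right]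

lemma abs_rightDeficit_sub_le (v : ℤ) (x y : Config Λ (m + 1)) (hy : y ∈ x.nbrs) :
    |rightDeficit v x - rightDeficit v y| ≤ 1 := by
  have h : |(x.right : ℝ) - y.right| ≤ 1 := by exact_mod_cast Config.abs_right_sub_le hy
  refine (abs_max_sub_max_le_abs _ _ _).trans ?_
  rwa [sub_sub_sub_cancel_left, abs_sub_comm]

/-- The summed correlator is controlled by correlators between bad configurations. -/
lemma summedCorrelator_le {lam : ℝ} (hlam : 0 ≤ lam) {ω : Λ → ℝ} (hω : ∀ α, 0 ≤ ω α)
    {U V : Finset ℤ} {u v : ℤ} (hu : ∀ i ∈ U, i ≤ u) (hv : ∀ i ∈ V, v ≤ i) (a : ℝ) :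
    summedCorrelator (m + 1) p.g lam ω U V (Set.Icc a p.b) ≤
      9 / 4 * ∑ s ∈ badSet p m lam ω, ∑ t ∈ badSet p m lam ω,
        Real.exp (-p.ν * leftExcess u s) * Real.exp (-p.ν * rightDeficit v t) *
          correlator (hamiltonian (m + 1) p.g lam ω) (Set.Icc a p.b) s t := by
  have h1 : ∀ x : Config Λ (m + 1), (x.sites ∩ U).Nonempty → leftExcess u x = 0 := by
    rintro x ⟨i, hi⟩
    rw [Finset.mem_inter, Config.mem_sites] at hi
    obtain ⟨⟨j, hj⟩, hiU⟩ := hi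
    have h2 : x.left ≤ u := by
      have := x.left_le_pos j
      have := hu i hiU
      omega
    have : (x.left : ℝ) ≤ u := by exact_mod_cast h2
    exact max_eq_right (by linarith)
  have h2 : ∀ y : Config Λ (m + 1), (y.sites ∩ V).Nonempty → rightDeficit v y = 0 := by
    rintro y ⟨i, hi⟩
    rw [Finset.mem_inter, Config.mem_sites] at hi
    obtain ⟨⟨j, hj⟩, hiV⟩ := hi
    have h2 : v ≤ y.right := by
      have := y.pos_le_right j
      have := hv i hiV
      omega
    have : (v : ℝ) ≤ y.right := by exact_mod_cast h2
    exact max_eq_right (by linarith)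
  unfold summedCorrelator correlator
  refine (Finset.sum_le_sum fun E hE => sum_sum_eigenprojectionEntry_le p hlam hω
    (mem_spectrumIn.1 hE).2.2 (abs_leftExcess_sub_le u) (abs_rightDeficit_sub_le v)
    (fun x hx => h1 x (Finset.mem_filter.1 hx).2)
    fun y hy => h2 y (Finset.mem_filter.1 hy).2).trans (le_of_eq ?_)
  rw [← Finset.mul_sum, Finset.sum_comm]
  refine congrArg _ (Finset.sum_congr rfl fun s _ => ?_)
  rw [Finset.sum_comm]
  exact Finset.sum_congr rfl fun t _ => (Finset.mul_sum _ _ _).symm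

lemma sum_geometric_natAbs_le {q : ℝ} (hq0 : 0 ≤ q) (hq : q < 1) {ι : Type*} (s : Finset ι)
    (k : ι → ℤ) (hk : Set.InjOn k s) : ∑ i ∈ s, q ^ (k i).natAbs ≤ 2 * (1 - q)⁻¹ := by
  rw [← Finset.sum_filter_add_sum_filter_not s fun i => 0 ≤ k i, two_mul]
  refine add_le_add (sum_geometric_le hq0 hq _ _ fun i hi j hj hij => ?_)
    (sum_geometric_le hq0 hq _ _ fun i hi j hj hij => ?_)
  all_goals
    rw [Finset.mem_coe, Finset.mem_filter] at hi hj
    refine hk hi.1 hj.1 ?_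
    have := hi.2
    have := hj.2
    omega

/-- The decay rate of the summed correlator. -/
def Params.κ : ℝ := p.μ / 4

lemma Params.κ_pos : 0 < p.κ := by
  have := p.μ_pos
  unfold Params.κ
  linarith

lemma Params.exp_neg_κ_lt : Real.exp (-p.κ) < 1 := by
  rw [Real.exp_lt_one_iff]; linarith [p.κ_pos]

/-- Summing the weights of pairs of contiguous configurations. -/
lemma sum_pair_weights_le (u v : ℤ) :
    ∑ s ∈ contiguousSet Λ m, ∑ t ∈ contiguousSet Λ m,
      Real.exp (-p.ν * leftExcess u s) * Real.exp (-p.ν * rightDeficit v t) *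
        Real.exp (-p.κ * |(s.left : ℝ) - t.left|) ≤
      Real.exp (p.κ * m) * Real.exp (-p.κ * ((v : ℝ) - u)) * (2 * (1 - Real.exp (-p.κ))⁻¹) ^ 2 := by
  set q := Real.exp (-p.κ) with hq
  have hpow : ∀ k : ℤ, q ^ k.natAbs = Real.exp (-p.κ * |(k : ℝ)|) := fun k => by
    rw [hq, ← Real.exp_nat_mul, Nat.cast_natAbs, mul_comm, Int.cast_abs]
  have hterm : ∀ s ∈ contiguousSet Λ m, ∀ t ∈ contiguousSet Λ m,
      Real.exp (-p.ν * leftExcess u s) * Real.exp (-p.ν * rightDeficit v t) *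
        Real.exp (-p.κ * |(s.left : ℝ) - t.left|) ≤
      Real.exp (p.κ * m) * Real.exp (-p.κ * ((v : ℝ) - u)) *
        (q ^ (s.left - u).natAbs * q ^ (v - t.right).natAbs) := by
    intro s _ t ht
    have hr : (t.right : ℝ) = t.left + m := by
      exact_mod_cast (mem_contiguousSet.1 ht).right_eq
    rw [hpow, hpow, ← Real.exp_add, ← Real.exp_add, ← Real.exp_add, ← Real.exp_add,
      ← Real.exp_add, Real.exp_le_exp]
    have hκ := p.κ_pos
    have hν : p.ν = 16 * p.κ := by unfold Params.κ Params.μ; ring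
    have e1 : ∀ x : ℝ, 2 * max x 0 = x + |x| := fun x => by
      rcases le_total 0 x with h | h
      · rw [max_eq_left h, abs_of_nonneg h]; ring
      · rw [max_eq_right h, abs_of_nonpos h]; ring
    have h1 := e1 ((s.left : ℝ) - u)
    have h2 := e1 ((v : ℝ) - t.right)
    have h3 : 0 ≤ leftExcess u s := le_max_right _ _
    have h4 : 0 ≤ rightDeficit v t := le_max_right _ _
    have h5 := neg_abs_le ((s.left : ℝ) - t.left)
    unfold leftExcess at *
    unfold rightDeficit at *
    push_cast
    rw [hν]
    -- The way from `u` to `v` runs through `s.left`, `t.left` and `t.right`. The width `m` of the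
    -- block at `t` is the only uncompensated term and produces the loss `exp (κ m)`; the absolute
    -- values provide summability over both ends.
    have key : ((v : ℝ) - u) + |(s.left : ℝ) - u| + |(v : ℝ) - t.right| ≤
        m + 16 * max ((s.left : ℝ) - u) 0 + 16 * max ((v : ℝ) - t.right) 0 +
          |(s.left : ℝ) - t.left| := by linarith
    nlinarith [mul_le_mul_of_nonneg_left key hκ.le]
  refine (Finset.sum_le_sum fun s hs => Finset.sum_le_sum fun t ht => hterm s hs t ht).trans ?_
  simp only [← Finset.mul_sum]
  rw [← Finset.sum_mul]
  have hs := sum_geometric_natAbs_le (Real.exp_pos (-p.κ)).le p.exp_neg_κ_lt (contiguousSet Λ m)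
    (fun s => s.left - u) fun x hx y hy hxy => by
      refine (mem_contiguousSet.1 hx).ext (mem_contiguousSet.1 hy) ?_
      simp only at hxy
      omega
  have ht := sum_geometric_natAbs_le (Real.exp_pos (-p.κ)).le p.exp_neg_κ_lt (contiguousSet Λ m)
    (fun t => v - t.right) fun x hx y hy hxy => by
      refine (mem_contiguousSet.1 hx).ext (mem_contiguousSet.1 hy) ?_
      have := (mem_contiguousSet.1 hx).right_eq
      have := (mem_contiguousSet.1 hy).right_eq
      simp only at hxy
      omega
  have h0 : 0 ≤ 2 * (1 - q)⁻¹ := mul_nonneg zero_le_two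
    (inv_nonneg.2 (sub_nonneg.2 p.exp_neg_κ_lt.le))
  rw [pow_two]
  gcongr

variable {ν₀ : Measure ℝ} [IsProbabilityMeasure ν₀] {R : NNReal} {W lam : ℝ}

/-- Bad configurations are exponentially unlikely in the particle number. -/
lemma measure_bad_le (h : LawBound ν₀ R W) (hlam : 0 < lam) (s : Config Λ (m + 1)) :
    disorderLaw Λ ν₀ {ω | s ∈ badSet p m lam ω} ≤
      ENNReal.ofReal ((R * (p.b / (2 * lam))) ^ (m + 1)) := by
  classical
  set T := Set.Ico (0 : ℝ) (p.b / (2 * lam)) with hT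
  have hTle : ν₀ T ≤ ENNReal.ofReal (R * (p.b / (2 * lam))) := by
    refine (h.le T).trans ?_
    rw [Measure.smul_apply, ENNReal.smul_def, smul_eq_mul, ENNReal.ofReal_mul R.coe_nonneg,
      ENNReal.ofReal_coe_nnreal]
    gcongr
    refine (Measure.restrict_apply_le _ _).trans (le_of_eq ?_)
    rw [hT, Real.volume_Ico, sub_zero]
  set J : Finset Λ := Finset.univ.image s.pos with hJ
  have hcard : J.card = m + 1 := by
    rw [hJ, Finset.card_image_of_injective _ fun i j hij =>
      s.pos_injective (congrArg Subtype.val hij), Finset.card_univ, Fintype.card_fin]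
  calc disorderLaw Λ ν₀ {ω | s ∈ badSet p m lam ω}
      ≤ disorderLaw Λ ν₀ (Set.univ.pi fun α => if α ∈ J then T else Set.univ) := by
        -- Since the disorder is almost surely non-negative, a small sum forces each of its `m + 1`
        -- terms to be small, and these are independent.
        refine measure_mono_ae ?_
        filter_upwards [h.ae_nonneg] with ω hω hbad
        have hbad' := ((mem_badSet p).1 hbad).2
        intro α _
        beta_reduce
        split_ifs with hα
        · rw [hJ, Finset.mem_image] at hα
          obtain ⟨j, -, rfl⟩ := hα
          refine ⟨hω _, ?_⟩
          have h1 : ω (s.pos j) ≤ ∑ j, ω (s.pos j) :=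
            Finset.single_le_sum (f := fun j => ω (s.pos j)) (fun i _ => hω _) (Finset.mem_univ j)
          rw [lt_div_iff₀ (by positivity)]
          nlinarith
        · trivial
    _ = ν₀ T ^ (m + 1) := by
        rw [disorderLaw, Measure.pi_pi, ← hcard, ← Finset.prod_const,
          ← Finset.prod_subset (Finset.subset_univ J)]
        · exact Finset.prod_congr rfl fun α hα => by rw [if_pos hα]
        · intro α _ hα
          rw [if_neg hα, measure_univ]
    _ ≤ _ := by
        rw [ENNReal.ofReal_pow (mul_nonneg R.coe_nonneg (div_nonneg p.hb0 (by positivity)))]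
        gcongr

/-- The prefactor in the decay of averaged correlators. -/
def Params.prefactor (p : Params) (R : NNReal) (a : ℝ) : ℝ := 1 + 4 * Real.pi * R * (p.b - a)

/-- Averaged correlators on the event that `s` is bad. -/
lemma lintegral_correlator_bad_le (h : LawBound ν₀ R W) (hlam : 1 ≤ lam)
    (hsmall : √3 * p.S * apriori R W lam ≤ 1)
    (hrare : R * (p.b / (2 * lam)) ≤ Real.exp (-2 * (p.κ + 1)))
    {s t : Config Λ (m + 1)} (hsc : s.Contiguous) (htc : t.Contiguous) {a : ℝ} (hab : a ≤ p.b) :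
    ∫⁻ ω in {ω | s ∈ badSet p m lam ω},
      ENNReal.ofReal (correlator (hamiltonian (m + 1) p.g lam ω) (Set.Icc a p.b) s t)
      ∂disorderLaw Λ ν₀ ≤ ENNReal.ofReal (√(p.prefactor R a) *
        Real.exp (-(p.κ + 1) * (m + 1)) * Real.exp (-p.κ * |(s.left : ℝ) - t.left|)) := by
  have hpre : 0 ≤ p.prefactor R a := by
    have : 0 ≤ p.b - a := by linarith
    unfold Params.prefactor
    positivity
  set x := Real.exp (-(p.κ + 1) * (m + 1)) with hx
  set y := √(p.prefactor R a) * Real.exp (-p.κ * |(s.left : ℝ) - t.left|) with hy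
  have h1 : ∫⁻ ω in {ω | s ∈ badSet p m lam ω},
      ENNReal.ofReal (correlator (hamiltonian (m + 1) p.g lam ω) (Set.Icc a p.b) s t)
      ∂disorderLaw Λ ν₀ ≤ ENNReal.ofReal (x ^ 2) := by
    calc _ ≤ ∫⁻ _ω in {ω | s ∈ badSet p m lam ω}, 1 ∂disorderLaw Λ ν₀ :=
          lintegral_mono fun ω => by
            rw [← ENNReal.ofReal_one]
            exact ENNReal.ofReal_le_ofReal
              (correlator_le_one (hamiltonian_isHermitian _ _ _ _) _ _ _)
      _ = disorderLaw Λ ν₀ {ω | s ∈ badSet p m lam ω} := setLIntegral_one _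
      _ ≤ _ := measure_bad_le p h (by linarith) s
      _ ≤ ENNReal.ofReal (Real.exp (-2 * (p.κ + 1)) ^ (m + 1)) := by
          refine ENNReal.ofReal_le_ofReal ?_
          have : 0 ≤ R * (p.b / (2 * lam)) :=
            mul_nonneg R.coe_nonneg (div_nonneg p.hb0 (by linarith))
          gcongr
      _ = _ := by
          rw [hx, ← Real.exp_nat_mul, ← Real.exp_nat_mul]
          congr 2
          push_cast
          ring
  have h2 : ∫⁻ ω in {ω | s ∈ badSet p m lam ω},
      ENNReal.ofReal (correlator (hamiltonian (m + 1) p.g lam ω) (Set.Icc a p.b) s t)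
      ∂disorderLaw Λ ν₀ ≤ ENNReal.ofReal (y ^ 2) := by
    refine (setLIntegral_le_lintegral _ _).trans
      ((lintegral_correlator_le p h hlam hsmall hsc htc hab).trans (le_of_eq ?_))
    rw [hy, mul_pow, Real.sq_sqrt hpre, ← Real.exp_nat_mul]
    congr 3
    unfold Params.κ
    push_cast
    ring
  have hx0 : 0 ≤ x := by positivity
  have hy0 : 0 ≤ y := by positivity
  have h3 : √(p.prefactor R a) * x * Real.exp (-p.κ * |(s.left : ℝ) - t.left|) = x * y := by
    rw [hy]; ring
  rw [h3]
  -- The integral is at most both `x²` (rarity) and `y²` (decay), hence at most `x y`: half of each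
  -- exponent is kept.
  rcases le_total x y with hxy | hxy
  · exact h1.trans (ENNReal.ofReal_le_ofReal (by nlinarith))
  · exact h2.trans (ENNReal.ofReal_le_ofReal (by nlinarith))

lemma measurableSet_bad (s : Config Λ (m + 1)) :
    MeasurableSet {ω : Λ → ℝ | s ∈ badSet p m lam ω} := by
  simp only [mem_badSet]
  have h : Measurable fun ω : Λ → ℝ => lam * ∑ j, ω (s.pos j) := by fun_prop
  exact (MeasurableSet.const s.Contiguous).inter (measurableSet_lt h measurable_const)

lemma measurable_summedCorrelator (U V : Finset ℤ) {I : Set ℝ} (hI : MeasurableSet I) :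
    Measurable fun ω : Λ → ℝ => summedCorrelator (m + 1) p.g lam ω U V I := by
  simp only [summedCorrelator_eq]
  exact Finset.measurable_sum _ fun x _ => Finset.measurable_sum _ fun y _ =>
    measurable_correlator_hamiltonian p hI x y

lemma summedCorrelator_nonneg (n : ℕ) (g lam : ℝ) (ω : Λ → ℝ) (U V : Finset ℤ) (I : Set ℝ) :
    0 ≤ summedCorrelator n g lam ω U V I :=
  Finset.sum_nonneg fun _ _ => Finset.sum_nonneg fun _ _ => Finset.sum_nonneg fun _ _ =>
    norm_nonneg _

/-- The constant in the localization bound. -/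
def Params.bound (p : Params) (R : NNReal) (a : ℝ) : ℝ :=
  9 / 4 * √(p.prefactor R a) * (2 * (1 - Real.exp (-p.κ))⁻¹) ^ 2

lemma lintegral_summedCorrelator_le_of_le (h : LawBound ν₀ R W) (hlam : 1 ≤ lam)
    (hsmall : √3 * p.S * apriori R W lam ≤ 1)
    (hrare : R * (p.b / (2 * lam)) ≤ Real.exp (-2 * (p.κ + 1))) {a : ℝ} (hab : a ≤ p.b)
    {U V : Finset ℤ} {u v : ℤ} (hu : ∀ i ∈ U, i ≤ u) (hv : ∀ i ∈ V, v ≤ i) :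
    ∫⁻ ω, ENNReal.ofReal (summedCorrelator (m + 1) p.g lam ω U V (Set.Icc a p.b))
      ∂disorderLaw Λ ν₀ ≤ ENNReal.ofReal (p.bound R a * Real.exp (-(m + 1 : ℝ)) *
        Real.exp (-p.κ * ((v : ℝ) - u))) := by
  classical
  set c : (Λ → ℝ) → Config Λ (m + 1) → Config Λ (m + 1) → ℝ := fun ω s t =>
    correlator (hamiltonian (m + 1) p.g lam ω) (Set.Icc a p.b) s t with hc
  have hc0 : ∀ ω s t, 0 ≤ c ω s t := fun _ _ _ => correlator_nonneg _ _ _ _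
  set w : Config Λ (m + 1) → Config Λ (m + 1) → ℝ := fun s t =>
    Real.exp (-p.ν * leftExcess u s) * Real.exp (-p.ν * rightDeficit v t) with hw
  have hw0 : ∀ s t, 0 ≤ w s t := fun s t => by positivity
  have hcm : ∀ s t, Measurable fun ω => ENNReal.ofReal (c ω s t) := fun s t =>
    ENNReal.measurable_ofReal.comp (measurable_correlator_hamiltonian p measurableSet_Icc s t)
  have hpt : ∀ᵐ ω ∂disorderLaw Λ ν₀,
      ENNReal.ofReal (summedCorrelator (m + 1) p.g lam ω U V (Set.Icc a p.b)) ≤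
      ∑ s ∈ contiguousSet Λ m, ∑ t ∈ contiguousSet Λ m, ENNReal.ofReal (9 / 4 * w s t) *
        {ω | s ∈ badSet p m lam ω}.indicator (fun ω => ENNReal.ofReal (c ω s t)) ω := by
    filter_upwards [h.ae_nonneg] with ω hω
    have hsub : badSet p m lam ω ⊆ contiguousSet Λ m := fun x hx =>
      mem_contiguousSet.2 ((mem_badSet p).1 hx).1
    refine (ENNReal.ofReal_le_ofReal
      (summedCorrelator_le p (by linarith) hω hu hv a)).trans ?_
    rw [Finset.mul_sum, ENNReal.ofReal_sum_of_nonneg fun s _ => mul_nonneg (by norm_num)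
      (Finset.sum_nonneg fun t _ => mul_nonneg (hw0 s t) (hc0 ω s t))]
    calc ∑ s ∈ badSet p m lam ω, ENNReal.ofReal
          (9 / 4 * ∑ t ∈ badSet p m lam ω, w s t * c ω s t)
        ≤ ∑ s ∈ badSet p m lam ω, ∑ t ∈ contiguousSet Λ m, ENNReal.ofReal (9 / 4 * w s t) *
          {ω | s ∈ badSet p m lam ω}.indicator (fun ω => ENNReal.ofReal (c ω s t)) ω := by
          refine Finset.sum_le_sum fun s hs => ?_
          rw [Finset.mul_sum, ENNReal.ofReal_sum_of_nonneg fun t _ => mul_nonneg (by norm_num)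
            (mul_nonneg (hw0 s t) (hc0 ω s t))]
          -- Badness is retained only for `s`, where its probability is used; `t` is relaxed to an
          -- arbitrary block so that the index sets become deterministic.
          refine (Finset.sum_le_sum_of_subset hsub).trans (Finset.sum_le_sum fun t _ => ?_)
          rw [Set.indicator_of_mem (by exact hs), ← ENNReal.ofReal_mul
            (mul_nonneg (by norm_num) (hw0 s t)), mul_assoc (9 / 4 : ℝ)]
      _ ≤ _ := Finset.sum_le_sum_of_subset hsub
  have hmeas : ∀ s t, Measurable fun ω => ENNReal.ofReal (9 / 4 * w s t) *
      {ω | s ∈ badSet p m lam ω}.indicator (fun ω => ENNReal.ofReal (c ω s t)) ω := fun s t =>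
    ((hcm s t).indicator (measurableSet_bad p s)).const_mul _
  refine (lintegral_mono_ae hpt).trans ?_
  rw [lintegral_finsetSum _ fun s _ => Finset.measurable_sum _ fun t _ => hmeas s t]
  set D := √(p.prefactor R a) * Real.exp (-(p.κ + 1) * (m + 1)) with hD
  calc ∑ s ∈ contiguousSet Λ m, ∫⁻ ω, ∑ t ∈ contiguousSet Λ m, ENNReal.ofReal (9 / 4 * w s t) *
        {ω | s ∈ badSet p m lam ω}.indicator (fun ω => ENNReal.ofReal (c ω s t)) ω
          ∂disorderLaw Λ ν₀
      ≤ ∑ s ∈ contiguousSet Λ m, ∑ t ∈ contiguousSet Λ m, ENNReal.ofReal (9 / 4 * D *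
        (w s t * Real.exp (-p.κ * |(s.left : ℝ) - t.left|))) := by
        refine Finset.sum_le_sum fun s hs => ?_
        rw [lintegral_finsetSum _ fun t _ => hmeas s t]
        refine Finset.sum_le_sum fun t ht => ?_
        rw [lintegral_const_mul' _ _ ENNReal.ofReal_ne_top,
          lintegral_indicator (measurableSet_bad p s)]
        refine (mul_le_mul_right (lintegral_correlator_bad_le p h hlam hsmall hrare
          (mem_contiguousSet.1 hs) (mem_contiguousSet.1 ht) hab) _).trans ?_
        rw [← ENNReal.ofReal_mul (mul_nonneg (by norm_num) (hw0 s t))]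
        exact ENNReal.ofReal_le_ofReal (le_of_eq (by rw [hD]; ring))
    _ = ENNReal.ofReal (9 / 4 * D * ∑ s ∈ contiguousSet Λ m, ∑ t ∈ contiguousSet Λ m,
        w s t * Real.exp (-p.κ * |(s.left : ℝ) - t.left|)) := by
        simp only [Finset.mul_sum]
        rw [ENNReal.ofReal_sum_of_nonneg fun s _ => Finset.sum_nonneg fun t _ => by positivity]
        exact Finset.sum_congr rfl fun s _ =>
          (ENNReal.ofReal_sum_of_nonneg fun t _ => by positivity).symm
    _ ≤ ENNReal.ofReal (9 / 4 * D * (Real.exp (p.κ * m) * Real.exp (-p.κ * ((v : ℝ) - u)) *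
        (2 * (1 - Real.exp (-p.κ))⁻¹) ^ 2)) := by
        refine ENNReal.ofReal_le_ofReal ?_
        have := sum_pair_weights_le (Λ := Λ) (m := m) p u v
        gcongr
    _ ≤ _ := by
        refine ENNReal.ofReal_le_ofReal ?_
        -- The rarity exponent `κ + 1` was chosen to beat the block-width loss `κ` and leave rate 1
        -- in the particle number.
        have hexp : Real.exp (-(p.κ + 1) * (m + 1)) * Real.exp (p.κ * m) ≤
            Real.exp (-(m + 1 : ℝ)) := by
          rw [← Real.exp_add, Real.exp_le_exp]
          nlinarith [p.κ_pos]
        calc _ = p.bound R a * (Real.exp (-(p.κ + 1) * (m + 1)) * Real.exp (p.κ * m)) *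
              Real.exp (-p.κ * ((v : ℝ) - u)) := by rw [hD, Params.bound]; ring
          _ ≤ _ := by
            have : 0 ≤ p.bound R a := by unfold Params.bound; positivity
            gcongr

/-- Exponential localization of the averaged summed correlator. -/
lemma lintegral_summedCorrelator_le (h : LawBound ν₀ R W) (hlam : 1 ≤ lam)
    (hsmall : √3 * p.S * apriori R W lam ≤ 1)
    (hrare : R * (p.b / (2 * lam)) ≤ Real.exp (-2 * (p.κ + 1))) {a : ℝ} (hab : a ≤ p.b)
    {U V : Finset ℤ} (hU : IsConnectedSites U) (hV : IsConnectedSites V) (hUV : Disjoint U V) :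
    ∫⁻ ω, ENNReal.ofReal (summedCorrelator (m + 1) p.g lam ω U V (Set.Icc a p.b))
      ∂disorderLaw Λ ν₀ ≤ ENNReal.ofReal (p.bound R a * Real.exp (-(m + 1 : ℝ)) *
        Real.exp (-p.κ * siteDist U V)) := by
  have key : ∀ U V : Finset ℤ, U.Nonempty → V.Nonempty → (∀ u ∈ U, ∀ v ∈ V, u < v) →
      ∫⁻ ω, ENNReal.ofReal (summedCorrelator (m + 1) p.g lam ω U V (Set.Icc a p.b))
      ∂disorderLaw Λ ν₀ ≤ ENNReal.ofReal (p.bound R a * Real.exp (-(m + 1 : ℝ)) *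
        Real.exp (-p.κ * siteDist U V)) := by
    intro U V hU hV hlt
    refine (lintegral_summedCorrelator_le_of_le p h hlam hsmall hrare hab
      (u := U.max' hU) (v := V.min' hV) (U.le_max' ·) (V.min'_le ·)).trans
      (ENNReal.ofReal_le_ofReal ?_)
    have h1 := siteDist_le (U.max'_mem hU) (V.min'_mem hV)
    have h2 := hlt _ (U.max'_mem hU) _ (V.min'_mem hV)
    have h3 : (siteDist U V : ℤ) ≤ V.min' hV - U.max' hU := by omega
    have h4 : (siteDist U V : ℝ) ≤ (V.min' hV : ℝ) - U.max' hU := by exact_mod_cast h3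
    have h5 : 0 ≤ p.bound R a := by unfold Params.bound; positivity
    have h6 : -p.κ * ((V.min' hV : ℝ) - U.max' hU) ≤ -p.κ * siteDist U V := by
      nlinarith [p.κ_pos]
    gcongr
  rcases hU.lt_or_lt hV hUV with hlt | hlt
  · exact key U V hU.1 hV.1 hlt
  · simp only [summedCorrelator_comm _ _ _ _ U V, siteDist_comm U V]
    exact key V U hV.1 hU.1 fun v hv u hu => hlt u hu v hv

end Localization

end HardCore

end

noncomputable section

namespace HardCore

/-! ### The single-site law and the disorder threshold -/

section Disorder

variable {ρ : ℝ → ℝ} {ωmax : ℝ}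

/-- The single-site law with density `ρ`. -/
abbrev siteLaw (ρ : ℝ → ℝ) : Measure ℝ := volume.withDensity fun v => ENNReal.ofReal (ρ v)

lemma IsAdmissibleDensity.isProbabilityMeasure (hρ : IsAdmissibleDensity ρ ωmax) :
    IsProbabilityMeasure (siteLaw ρ) := by
  refine ⟨?_⟩
  have hint : Integrable ρ := Integrable.of_integral_ne_zero (by rw [hρ.total]; exact one_ne_zero)
  rw [withDensity_apply _ MeasurableSet.univ, Measure.restrict_univ,
    ← ofReal_integral_eq_lintegral_ofReal hint hρ.nonneg, hρ.total, ENNReal.ofReal_one]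

/-- The essential supremum of the density serves as `R`. The support is enlarged to a symmetric
window, as the half-plane estimate requires, and the maximum with 1 keeps it non-degenerate. -/
lemma IsAdmissibleDensity.exists_lawBound (hρ : IsAdmissibleDensity ρ ωmax) :
    ∃ R : NNReal, LawBound (siteLaw ρ) R (max ωmax 1) := by
  set W := max ωmax 1 with hW
  have hW1 : 1 ≤ W := le_max_right _ _
  refine ⟨(eLpNormEssSup ρ volume).toNNReal, by linarith, ?_, ?_⟩
  · have hfin : eLpNormEssSup ρ volume ≠ ⊤ := by
      have := hρ.bounded.2
      rw [eLpNorm_exponent_top] at this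
      exact this.ne
    have hle : (fun v => ENNReal.ofReal (ρ v)) ≤ᵐ[volume]
        (Set.Icc (-W) W).indicator fun _ => ((eLpNormEssSup ρ volume).toNNReal : ENNReal) := by
      filter_upwards [hρ.support, ae_le_eLpNormEssSup (f := ρ) (μ := volume)] with v hv hb
      by_cases hmem : v ∈ Set.Icc (-W) W
      · rw [Set.indicator_of_mem hmem, ENNReal.coe_toNNReal hfin]
        refine le_trans ?_ hb
        rw [← ofReal_norm]
        exact ENNReal.ofReal_le_ofReal (le_abs_self _)
      · rw [hv fun h => hmem ⟨by linarith [h.1], h.2.trans (le_max_left _ _)⟩]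
        simp
    refine (withDensity_mono hle).trans (le_of_eq ?_)
    rw [withDensity_indicator measurableSet_Icc, withDensity_const]
    rfl
  · have hm : AEMeasurable (fun v => ENNReal.ofReal (ρ v)) volume :=
      ENNReal.measurable_ofReal.comp_aemeasurable hρ.bounded.1.aemeasurable
    rw [ae_withDensity_iff' hm]
    filter_upwards [hρ.support] with v hv hne
    by_contra hneg
    exact hne (by rw [hv fun h => hneg h.1, ENNReal.ofReal_zero])

lemma IsDisorder.map_eq {Λ : Finset ℤ} {Ω : Type*} [MeasurableSpace Ω] {P : Measure Ω}
    [IsProbabilityMeasure P] {ω : Λ → Ω → ℝ} (hω : IsDisorder ρ P ω) :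
    P.map (fun w α => ω α w) = disorderLaw Λ (siteLaw ρ) := by
  rw [(iIndepFun_iff_map_fun_eq_pi_map fun α => (hω.measurable α).aemeasurable).1 hω.indep]
  simp only [hω.law]
  rfl

/-- The disorder strength above which localization holds. -/
def Params.threshold (p : Params) (R : NNReal) (W : ℝ) : ℝ :=
  1 + (√3 * p.S * (R * (16 * Real.pi))) ^ 2 * W + R * p.b * Real.exp (2 * (p.κ + 1))

lemma Params.one_le_threshold (p : Params) (R : NNReal) {W : ℝ} (hW : 0 ≤ W) :
    1 ≤ p.threshold R W := by
  have h1 : 0 ≤ R * p.b * Real.exp (2 * (p.κ + 1)) :=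
    mul_nonneg (mul_nonneg R.coe_nonneg p.hb0) (Real.exp_pos _).le
  have h2 : 0 ≤ (√3 * p.S * (R * (16 * Real.pi))) ^ 2 * W := by positivity
  unfold Params.threshold
  linarith

/-- The second summand of `threshold` is tuned to this condition, which makes the recursion
contract; the third one serves `Params.rare`. -/
lemma Params.apriori_small (p : Params) {R : NNReal} {W lam : ℝ} (hW : 0 ≤ W)
    (hlam : p.threshold R W < lam) : √3 * p.S * apriori R W lam ≤ 1 := by
  have h1 : 0 ≤ R * p.b * Real.exp (2 * (p.κ + 1)) :=
    mul_nonneg (mul_nonneg R.coe_nonneg p.hb0) (Real.exp_pos _).le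
  have hlam0 : 0 < lam := by linarith [p.one_le_threshold R hW]
  set K := √3 * p.S * (R * (16 * Real.pi)) with hK
  have hK0 : 0 ≤ K := by have := p.S_pos; positivity
  have h2 : K ^ 2 * W ≤ lam := by
    unfold Params.threshold at hlam
    linarith
  calc √3 * p.S * apriori R W lam = K * √(W / lam) := by rw [hK, apriori]; ring
    _ = √(K ^ 2 * (W / lam)) := by rw [Real.sqrt_mul (sq_nonneg K), Real.sqrt_sq hK0]
    _ ≤ 1 := by
      rw [← Real.sqrt_one]
      refine Real.sqrt_le_sqrt ?_
      rw [← mul_div_assoc, div_le_one hlam0]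
      exact h2

lemma Params.rare (p : Params) {R : NNReal} {W lam : ℝ} (hW : 0 ≤ W)
    (hlam : p.threshold R W < lam) :
    R * (p.b / (2 * lam)) ≤ Real.exp (-2 * (p.κ + 1)) := by
  have hlam0 : 0 < lam := by linarith [p.one_le_threshold R hW]
  have h2 : 0 ≤ (√3 * p.S * (R * (16 * Real.pi))) ^ 2 * W := by positivity
  have h3 : R * p.b * Real.exp (2 * (p.κ + 1)) ≤ 2 * lam := by
    unfold Params.threshold at hlam
    linarith
  rw [← mul_div_assoc, div_le_iff₀ (by positivity), neg_mul, Real.exp_neg, inv_mul_eq_div,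
    le_div_iff₀ (Real.exp_pos _)]
  exact h3

lemma Params.bound_pos (p : Params) (R : NNReal) {a : ℝ} (hab : a ≤ p.b) : 0 < p.bound R a := by
  have h1 : 0 ≤ p.b - a := by linarith
  have h2 : 0 < p.prefactor R a := by unfold Params.prefactor; positivity
  have h3 : 0 < (1 - Real.exp (-p.κ))⁻¹ := inv_pos.2 (by linarith [p.exp_neg_κ_lt])
  have h4 := Real.sqrt_pos.2 h2
  unfold Params.bound
  positivity

end Disorder

end HardCore

end

/-! ### Conclusion: transfer to an arbitrary probability space -/

theorem corollary1p4
    (g μT : ℝ) (hg : 1 < g) (hμT : 0 < μT) (hE : 0 < HardCore.energyThreshold g μT)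
    (a b : ℝ) (ha : 0 ≤ a) (hab : a ≤ b) (hb : b < HardCore.energyThreshold g μT)
    (ρ : ℝ → ℝ) (ωmax : ℝ) (hρ : HardCore.IsAdmissibleDensity ρ ωmax) :
    ∃ lam₀ C c μ : ℝ, 0 < lam₀ ∧ 0 < C ∧ 0 < c ∧ 0 < μ ∧
      ∀ lam : ℝ, lam₀ < lam → ∀ n : ℕ, 2 ≤ n → ∀ L : ℕ,
        ∀ (Ω : Type*) [MeasurableSpace Ω] (P : Measure Ω) [IsProbabilityMeasure P]
          (ω : HardCore.box L → Ω → ℝ), HardCore.IsDisorder ρ P ω →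
        ∀ U V : Finset ℤ, U ⊆ HardCore.box L → V ⊆ HardCore.box L →
          HardCore.IsConnectedSites U → HardCore.IsConnectedSites V → Disjoint U V →
          Integrable (fun w => HardCore.summedCorrelator n g lam (fun α => ω α w) U V
            (Set.Icc a b)) P ∧
          ∫ w, HardCore.summedCorrelator n g lam (fun α => ω α w) U V (Set.Icc a b) ∂P ≤
            C * Real.exp (-c * n) * Real.exp (-μ * HardCore.siteDist U V) := by
  have hprob := hρ.isProbabilityMeasure
  obtain ⟨R, hR⟩ := hρ.exists_lawBound
  let p : HardCore.Params := ⟨g, μT, b, hg, hμT, ha.trans hab, hb⟩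
  have hW := hR.W_pos.le
  -- The rate in the particle number is 1 and the spatial rate is `κ = μT / 16`. None of the four
  -- constants involves `lam`, `n`, `L` or the probability space.
  refine ⟨p.threshold R (max ωmax 1), p.bound R a, 1, p.κ,
    zero_lt_one.trans_le (p.one_le_threshold R hW), p.bound_pos R hab, one_pos, p.κ_pos, ?_⟩
  intro lam hlam n hn L Ω _ P _ ω hω U V _ _ hU hV hUV
  obtain ⟨m, rfl⟩ : ∃ m, n = m + 1 := ⟨n - 1, by omega⟩
  set B := p.bound R a * Real.exp (-1 * (m + 1 : ℕ)) * Real.exp (-p.κ * HardCore.siteDist U V)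
    with hB
  have hB0 : 0 ≤ B := by have := p.bound_pos R hab; positivity
  set f : (HardCore.box L → ℝ) → ℝ := fun η =>
    HardCore.summedCorrelator (m + 1) g lam η U V (Set.Icc a b) with hf
  have hfm : Measurable f :=
    HardCore.measurable_summedCorrelator p (lam := lam) U V measurableSet_Icc
  have hωm : Measurable fun w α => ω α w := measurable_pi_lambda _ hω.measurable
  have hf0 : ∀ w, 0 ≤ f fun α => ω α w := fun w => HardCore.summedCorrelator_nonneg _ _ _ _ _ _ _
  have hle : ∫⁻ w, ENNReal.ofReal (f fun α => ω α w) ∂P ≤ ENNReal.ofReal B := by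
    have h1 := HardCore.lintegral_summedCorrelator_le (Λ := HardCore.box L) (m := m) p hR
      ((p.one_le_threshold R hW).trans hlam.le) (p.apriori_small hW hlam) (p.rare hW hlam) hab
      hU hV hUV
    rw [← hω.map_eq] at h1
    refine (lintegral_map (ENNReal.measurable_ofReal.comp hfm) hωm).symm.trans_le
      (h1.trans (le_of_eq ?_))
    rw [hB]
    push_cast
    rw [neg_one_mul]
  have hfi : Integrable (fun w => f fun α => ω α w) P := by
    refine ⟨(hfm.comp hωm).aestronglyMeasurable, ?_⟩
    rw [hasFiniteIntegral_iff_ofReal (Filter.Eventually.of_forall hf0)]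
    exact hle.trans_lt ENNReal.ofReal_lt_top
  refine ⟨hfi, ?_⟩
  rw [integral_eq_lintegral_of_nonneg_ae (Filter.Eventually.of_forall hf0) hfi.1]
  exact ENNReal.toReal_le_of_le_ofReal hB0 hle
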